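/- The following is provable in $\mathsf{RCA}_0+\Sigma^0_2\text{-}\mathsf{IND}$ (equivalently, it holds in every, possibly nonstandard, model of this theory, with all notions, such as "finite", "infinitely often", "function" and "path", read inside the model; $\mathbb N$ is the first-order domain). Let $Q$ be a finite set and $q_{\mathrm I}\in Q$. A $Q$-dag is an infinite word $\alpha\in[Q]^{\mathbb N}$, where $[Q]$ is the set of functions $M:Q\times Q\to\{0,1,\star\}$; it is seen as a graph on $Q\times\mathbb N$ with an edge from $(p,n)$ to $(q,n+1)$ iff $\alpha(n)(p,q)\neq 0$, the edge being accepting iff $\alpha(n)(p,q)=\star$. It is tree-shaped if every node has at most one incoming edge. An accepting path is an infinite path that starts in $(q_{\mathrm I},0)$ and contains infinitely many accepting edges. A $Q$-scheme is a finite rooted tree with nodes labelled by $Q$, distinct leaves having distinct labels, with edges labelled by pairwise distinct identifiers from $\{0,\dots,2|Q|\}$ and each marked accepting or non-accepting, such that the root is not a leaf and every node that is neither the root nor a leaf has at least two children. The $Q$-scheme automaton has as states the $Q$-schemes and, in addition, the dead state consisting of a root alone, which is never left. Its initial state has one edge, non-accepting, with identifier $0$, from a root to a leaf, both labelled $q_{\mathrm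 I}$. On reading a tree-shaped letter $M$ in the state $\tau$ it performs four steps. (1) To each leaf of $\tau$ labelled $p$ it appends, for each $q$ with $M(p,q)\ne0$, a new leaf labelled $q$; the new edge has no identifier and is accepting iff $M(p,q)=\star$. (2) It removes the nodes other than the root that have no new leaf as a descendant or equal to them. (3) It eliminates all non-root nodes with exactly one child: each maximal path passing only through such nodes is collapsed into one edge, which inherits the identifier (if any) of the first edge of the path, and is accepting iff some edge of the path is. (4) The edges without identifier receive arbitrary pairwise distinct identifiers from $\{0,\dots,2|Q|\}$ that are not in use after step (3). In such a transition an identifier of $\tau$ is deleted if its edge is removed in step (2), or is collapsed in step (3) into a path of which it is not the first edge. It is refreshed if its edge is the first edge of a path collapsed in step (3) and some other edge of this path (possibly a new one) is accepting. Then for every tree-shaped $Q$-dag $\alpha$ the automaton has a run over $\alpha$; there is even one in which step (4) is made deterministic by serving the new leaves in increasing order of their states and giving each the least identifier still unused. Moreover, for every run over $\alpha$, whatever the choices in step (4), the following are equivalent: 1. $\alpha$ contains an accepting path; 2. some identifier is deleted in only finitely many transitions and refreshed in infinitely many transitions of the run. (Condition 2 is a Rabin condition on the transitions of this deterministic automaton,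 with one pair for each identifier.) -/

import Mathlib

/-! ### Second-order arithmetic

A structure for the two-sorted language of second-order arithmetic consists of a first-order
domain `N` with `0, 1, +, ·, ≤` and a family `S : Set (Set N)`, the range of the set variables.
The domain `N` may be nonstandard. Variables are de Bruijn indices; number variables and set
variables are valued separately. -/

namespace SOA

/-- Terms of the language. -/
inductive Term : Type
  | var : ℕ → Term
  | zero : Term
  | one : Term
  | add : Term → Term → Term
  | mul : Term → Term → Term

/-- Formulas without set quantifiers. The bounding term `t` of a bounded quantifier is read
outside the scope of that quantifier. -/
inductive Formula : Type
  | eq : Term → Term → Formula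
  | le : Term → Term → Formula
  | mem : Term → ℕ → Formula
  | neg : Formula → Formula
  | and : Formula → Formula → Formula
  | or : Formula → Formula → Formula
  | ballLe : Term → Formula → Formula
  | bexLe : Term → Formula → Formula
  | all : Formula → Formula
  | ex : Formula → Formula

/-- The valuation that sends variable `0` to `a` and variable `k + 1` to `e k`. -/
def cons {N : Type*} (a : N) (e : ℕ → N) : ℕ → N
  | 0 => a
  | k + 1 => e k

def Term.eval {N : Type*} [CommSemiring N] (e : ℕ → N) : Term → N
  | .var k => e k
  | .zero => 0
  | .one => 1
  | .add s t => s.eval e + t.eval e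
  | .mul s t => s.eval e * t.eval e

def Formula.Realize {N : Type*} [CommSemiring N] [LinearOrder N] (E : ℕ → Set N) :
    Formula → (ℕ → N) → Prop
  | .eq s t, e => s.eval e = t.eval e
  | .le s t, e => s.eval e ≤ t.eval e
  | .mem t k, e => t.eval e ∈ E k
  | .neg φ, e => ¬ φ.Realize E e
  | .and φ ψ, e => φ.Realize E e ∧ ψ.Realize E e
  | .or φ ψ, e => φ.Realize E e ∨ ψ.Realize E e
  | .ballLe t φ, e => ∀ a, a ≤ t.eval e → φ.Realize E (cons a e)
  | .bexLe t φ, e => ∃ a, a ≤ t.eval e ∧ φ.Realize E (cons a e)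
  | .all φ, e => ∀ a, φ.Realize E (cons a e)
  | .ex φ, e => ∃ a, φ.Realize E (cons a e)

/-- `Δ⁰₀` formulas: all quantifiers are bounded. -/
inductive IsDelta00 : Formula → Prop
  | eq (s t : Term) : IsDelta00 (.eq s t)
  | le (s t : Term) : IsDelta00 (.le s t)
  | mem (t : Term) (k : ℕ) : IsDelta00 (.mem t k)
  | neg {φ : Formula} : IsDelta00 φ → IsDelta00 (.neg φ)
  | and {φ ψ : Formula} : IsDelta00 φ → IsDelta00 ψ → IsDelta00 (.and φ ψ)
  | or {φ ψ : Formula} : IsDelta00 φ → IsDelta00 ψ → IsDelta00 (.or φ ψ)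
  | ballLe (t : Term) {φ : Formula} : IsDelta00 φ → IsDelta00 (.ballLe t φ)
  | bexLe (t : Term) {φ : Formula} : IsDelta00 φ → IsDelta00 (.bexLe t φ)

/-- `Σ⁰₁` formulas: a block of `∃` in front of a `Δ⁰₀` formula. -/
inductive IsSigma01 : Formula → Prop
  | delta {φ : Formula} : IsDelta00 φ → IsSigma01 φ
  | ex {φ : Formula} : IsSigma01 φ → IsSigma01 (.ex φ)

/-- `Π⁰₁` formulas: a block of `∀` in front of a `Δ⁰₀` formula. -/
inductive IsPi01 : Formula → Prop
  | delta {φ : Formula} : IsDelta00 φ → IsPi01 φ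
  | all {φ : Formula} : IsPi01 φ → IsPi01 (.all φ)

/-- `Σ⁰₂` formulas: a block of `∃` in front of a `Π⁰₁` formula. -/
inductive IsSigma02 : Formula → Prop
  | pi {φ : Formula} : IsPi01 φ → IsSigma02 φ
  | ex {φ : Formula} : IsSigma02 φ → IsSigma02 (.ex φ)

/-- The induction axioms for the formulas of the class `C`, with arbitrary number parameters
`e` and set parameters `E` from the structure; the induction variable is variable `0`. -/
def Induction {N : Type*} [CommSemiring N] [LinearOrder N] (S : Set (Set N))
    (C : Formula → Prop) : Prop :=
  ∀ φ : Formula, C φ → ∀ (e : ℕ → N) (E : ℕ → Set N), (∀ k, E k ∈ S) →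
    φ.Realize E (cons 0 e) →
    (∀ x, φ.Realize E (cons x e) → φ.Realize E (cons (x + 1) e)) →
    ∀ x, φ.Realize E (cons x e)

/-- `(N, S)` is a model of `RCA₀`. The algebraic type classes together with `discrete` say that
`N` is the non-negative part of a discretely ordered commutative ring. -/
structure ModelsRCA0 {N : Type*} [CommSemiring N] [LinearOrder N] [IsStrictOrderedRing N]
    [CanonicallyOrderedAdd N] (S : Set (Set N)) : Prop where
  discrete : ∀ x : N, 0 < x → 1 ≤ x
  nonempty : S.Nonempty
  delta01_comprehension : ∀ φ ψ : Formula, IsSigma01 φ → IsSigma01 ψ →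
    ∀ (e : ℕ → N) (E : ℕ → Set N), (∀ k, E k ∈ S) →
      (∀ x, φ.Realize E (cons x e) ↔ ¬ ψ.Realize E (cons x e)) →
      {x | φ.Realize E (cons x e)} ∈ S
  sigma01_induction : Induction S IsSigma01

/-- `(N, S)` satisfies `Σ⁰₂-IND`. -/
def ModelsSigma02Ind {N : Type*} [CommSemiring N] [LinearOrder N] (S : Set (Set N)) : Prop :=
  Induction S IsSigma02

section Coding

variable {N : Type*} [CommSemiring N]

/-- The usual pairing function of second-order arithmetic. -/
def pair (x y : N) : N := (x + y) * (x + y) + x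

/-- The binary relation `R` belongs to the second-order part of the structure. -/
def IsRel₂ (S : Set (Set N)) (R : N → N → Prop) : Prop :=
  {z | ∃ x y, z = pair x y ∧ R x y} ∈ S

/-- The ternary relation `R` belongs to the second-order part of the structure. -/
def IsRel₃ (S : Set (Set N)) (R : N → N → N → Prop) : Prop :=
  {z | ∃ x y w, z = pair x (pair y w) ∧ R x y w} ∈ S

/-- The function `f` belongs to the second-order part of the structure. -/
def IsFun₁ (S : Set (Set N)) (f : N → N) : Prop :=
  IsRel₂ S fun x y => f x = y

/-- The binary function `f` belongs to the second-order part of the structure. -/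
def IsFun₂ (S : Set (Set N)) (f : N → N → N) : Prop :=
  IsRel₃ S fun x y w => f x y = w

/-- `Q` is, in the sense of the structure, a finite set with `c` elements. -/
def IsFiniteSet [LinearOrder N] (S : Set (Set N)) (Q : Set N) (c : N) : Prop :=
  Q ∈ S ∧ ∃ f : N → N, IsFun₁ S f ∧ Set.BijOn f (Set.Iio c) Q

end Coding

/-- `P` holds for infinitely many numbers of the structure. -/
def InfinitelyOften {N : Type*} [LinearOrder N] (P : N → Prop) : Prop :=
  ∀ m, ∃ n, m ≤ n ∧ P n

/-- `P` holds for only finitely many numbers of the structure. -/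
def FinitelyOften {N : Type*} [LinearOrder N] (P : N → Prop) : Prop :=
  ∃ m, ∀ n, m ≤ n → ¬ P n

end SOA

/-! ### `Q`-dags -/

namespace QDag

open SOA

/-- Entries of a transition matrix: no edge, a non-accepting edge, an accepting edge. -/
inductive Mark : Type
  | zero
  | one
  | star

/-- A transition matrix. -/
abbrev Letter (N : Type*) := N → N → Mark

/-- `α` is an infinite word over `[Q]` that belongs to the structure, that is, a `Q`-dag:
`α n p q` describes the edge from `(p, n)` to `(q, n + 1)`. -/
structure IsQDag {N : Type*} [CommSemiring N] (S : Set (Set N)) (Q : Set N)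
    (α : N → Letter N) : Prop where
  mem : ∀ n p q, α n p q ≠ Mark.zero → p ∈ Q ∧ q ∈ Q
  coded_one : IsRel₃ S fun n p q => α n p q = Mark.one
  coded_star : IsRel₃ S fun n p q => α n p q = Mark.star

/-- A letter is tree-shaped if every target has at most one incoming edge. -/
def Letter.TreeShaped {N : Type*} (M : Letter N) : Prop :=
  ∀ p p' q, M p q ≠ Mark.zero → M p' q ≠ Mark.zero → p = p'

/-- The `Q`-dag `α` with root `(qI, 0)` contains, inside the structure, an accepting path. -/
def HasAcceptingPath {N : Type*} [CommSemiring N] [LinearOrder N] (S : Set (Set N)) (qI : N)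
    (α : N → Letter N) : Prop :=
  ∃ π : N → N, IsFun₁ S π ∧ π 0 = qI ∧
    (∀ n, α n (π n) (π (n + 1)) ≠ Mark.zero) ∧
    InfinitelyOften fun n => α n (π n) (π (n + 1)) = Mark.star

/-! ### Labelled trees and `Q`-schemes -/

/-- A rooted tree whose nodes are labelled by states and whose edges are marked accepting or
not. The root is implicit; `node` is the set of the other nodes, named by elements of `V`. An edge
is referred to by its lower end, so `acc v` says that the edge that enters `v` is accepting.
The shape is given by the strict ancestor relation `anc` between non-root nodes. -/
structure LTree (N V : Type*) where
  node : V → Prop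
  anc : V → V → Prop
  label : V → N
  acc : V → Prop
  rootLabel : N

namespace LTree

variable {N V : Type*} (T : LTree N V)

/-- `v` is a non-root leaf. -/
def Leaf (v : V) : Prop := T.node v ∧ ∀ w, T.node w → ¬ T.anc v w

/-- `w` is a child of the non-root node `v`. -/
def Child (v w : V) : Prop :=
  T.node v ∧ T.node w ∧ T.anc v w ∧ ∀ x, T.node x → ¬ (T.anc v x ∧ T.anc x w)

/-- The non-root node `v` has exactly one child. -/
def Unary (v : V) : Prop := ∃! w, T.Child v w

/-- The subtree formed by the root and the nodes that satisfy `P`. -/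
def restrict (P : V → Prop) : LTree N V where
  node v := T.node v ∧ P v
  anc v w := (T.node v ∧ P v) ∧ (T.node w ∧ P w) ∧ T.anc v w
  label := T.label
  acc := T.acc
  rootLabel := T.rootLabel

/-- `v` remains when the unary nodes are eliminated (the root always remains). -/
def Kept (v : V) : Prop := T.node v ∧ ¬ T.Unary v

/-- The edge that enters `x` lies on the path that is collapsed into a single edge entering the
kept node `v`: all the nodes from `x` down to `v`, the latter excluded, are unary. -/
def OnPath (v x : V) : Prop :=
  T.Kept v ∧ T.node x ∧
    (x = v ∨ (T.anc x v ∧ T.Unary x ∧ ∀ y, T.node y → T.anc x y → T.anc y v → T.Unary y))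

/-- The edge that enters `x` is the first (the closest to the root) edge of that path. -/
def FirstOnPath (v x : V) : Prop :=
  T.OnPath v x ∧ ∀ y, T.OnPath v y → ¬ T.anc y x

/-- Elimination of the unary nodes: a collapsed edge is accepting iff one of its edges is. -/
def collapse : LTree N V where
  node := T.Kept
  anc v w := T.Kept v ∧ T.Kept w ∧ T.anc v w
  label := T.label
  acc v := ∃ x, T.OnPath v x ∧ T.acc x
  rootLabel := T.rootLabel

end LTree

/-- A tree whose edges carry pairwise distinct identifiers from `N`: every non-root node is named
by the identifier of the edge that enters it. -/
abbrev Scheme (N : Type*) := LTree N N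

/-- `τ` is a `Q`-scheme, where `c` is the number of elements of `Q`. -/
structure IsQScheme {N : Type*} [CommSemiring N] [LinearOrder N] (Q : Set N) (c : N)
    (τ : Scheme N) : Prop where
  identifier_le : ∀ i, τ.node i → i ≤ 2 * c
  label_mem : ∀ i, τ.node i → τ.label i ∈ Q
  rootLabel_mem : τ.rootLabel ∈ Q
  anc_node : ∀ i j, τ.anc i j → τ.node i ∧ τ.node j
  anc_irrefl : ∀ i, ¬ τ.anc i i
  anc_trans : ∀ i j k, τ.anc i j → τ.anc j k → τ.anc i k
  anc_linear : ∀ i j k, τ.anc i k → τ.anc j k → i = j ∨ τ.anc i j ∨ τ.anc j i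
  leaf_unique : ∀ i j, τ.Leaf i → τ.Leaf j → τ.label i = τ.label j → i = j
  branching : ∀ i, τ.node i → ¬ τ.Leaf i → ∃ j k, j ≠ k ∧ τ.Child i j ∧ τ.Child i k
  root_not_leaf : ∃ i, τ.node i

/-- The tree that consists of the root alone: what is left when all the paths have died out. -/
def IsDead {N : Type*} (Q : Set N) (τ : Scheme N) : Prop :=
  (∀ i, ¬ τ.node i) ∧ (∀ i j, ¬ τ.anc i j) ∧ τ.rootLabel ∈ Q

/-- The initial state: one edge, non-accepting, with identifier `0`. -/
def IsInitial {N : Type*} [CommSemiring N] (qI : N) (τ : Scheme N) : Prop :=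
  (∀ i, τ.node i ↔ i = 0) ∧ (∀ i j, ¬ τ.anc i j) ∧ τ.label 0 = qI ∧ ¬ τ.acc 0 ∧
    τ.rootLabel = qI

section Transition

variable {N : Type*}

/-- `M` has an edge into `q` from the state that labels the leaf `p` of `τ`. -/
def EdgeFrom (τ : Scheme N) (M : Letter N) (p q : N) : Prop :=
  τ.Leaf p ∧ M (τ.label p) q ≠ Mark.zero

/-- Step 1: the letter `M` is appended to `τ`. The node `inl i` is the node `i` of `τ`; the node
`inr q` is the new leaf given by the target `q` of `M`, and the edge that enters it has no
identifier. -/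
def append (τ : Scheme N) (M : Letter N) : LTree N (N ⊕ N) where
  node
    | .inl i => τ.node i
    | .inr q => ∃ p, EdgeFrom τ M p q
  anc
    | .inl i, .inl j => τ.anc i j
    | .inl i, .inr q => ∃ p, EdgeFrom τ M p q ∧ (i = p ∨ τ.anc i p)
    | .inr _, _ => False
  label
    | .inl i => τ.label i
    | .inr q => q
  acc
    | .inl i => τ.acc i
    | .inr q => ∃ p, τ.Leaf p ∧ M (τ.label p) q = Mark.star
  rootLabel := τ.rootLabel

/-- Step 2: the nodes from which no target of `M` can be reached are removed. -/
def prune (τ : Scheme N) (M : Letter N) : LTree N (N ⊕ N) :=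
  (append τ M).restrict fun v =>
    ∃ q, (append τ M).node (.inr q) ∧ (v = .inr q ∨ (append τ M).anc v (.inr q))

/-- Step 3: the unary nodes are eliminated. -/
def merge (τ : Scheme N) (M : Letter N) : LTree N (N ⊕ N) := (prune τ M).collapse

/-- After Step 3, the edge that enters `v` has the identifier `i`, inherited from the first edge
of the path that was collapsed. -/
def Inherits (τ : Scheme N) (M : Letter N) (v : N ⊕ N) (i : N) : Prop :=
  (prune τ M).FirstOnPath v (.inl i)

/-- After Step 3, the edge that enters the new leaf `q` has no identifier. -/
def Unnamed (τ : Scheme N) (M : Letter N) (q : N) : Prop :=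
  (prune τ M).FirstOnPath (.inr q) (.inr q)

/-- The identifier `i` is used after Step 3. -/
def Used (τ : Scheme N) (M : Letter N) (i : N) : Prop := ∃ v, Inherits τ M v i

/-- Step 4, the choice: `ν` gives pairwise distinct identifiers from `{0, …, 2c}`, none of them
in use, to the edges without identifier. -/
structure IsFreshNaming [CommSemiring N] [LinearOrder N] (c : N) (τ : Scheme N) (M : Letter N)
    (ν : N → N) : Prop where
  le : ∀ q, Unnamed τ M q → ν q ≤ 2 * c
  not_used : ∀ q, Unnamed τ M q → ¬ Used τ M (ν q)
  inj : ∀ q q', Unnamed τ M q → Unnamed τ M q' → ν q = ν q' → q = q'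

/-- The deterministic way to make the choice in Step 4: the new leaves are served in increasing
order of their states, and each of them receives the least identifier that is still unused. -/
def IsLeastNaming [LinearOrder N] (τ : Scheme N) (M : Letter N) (ν : N → N) : Prop :=
  ∀ q, Unnamed τ M q → ∀ j, j < ν q →
    Used τ M j ∨ ∃ q', q' < q ∧ Unnamed τ M q' ∧ ν q' = j

/-- After Step 4 with the choice `ν`, the edge that enters `v` has the identifier `i`. -/
def HasIdentifier (τ : Scheme N) (M : Letter N) (ν : N → N) (v : N ⊕ N) (i : N) : Prop :=
  Inherits τ M v i ∨ ∃ q, v = .inr q ∧ Unnamed τ M q ∧ i = ν q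

/-- The transition from `τ` to `τ'` over the letter `M`, with the choice `ν` in Step 4. -/
structure IsTransition [CommSemiring N] [LinearOrder N] (c : N) (τ : Scheme N) (M : Letter N)
    (ν : N → N) (τ' : Scheme N) : Prop where
  fresh : IsFreshNaming c τ M ν
  node_iff : ∀ i, τ'.node i ↔ ∃ v, (merge τ M).node v ∧ HasIdentifier τ M ν v i
  anc_iff : ∀ u v i j, (merge τ M).node u → (merge τ M).node v →
    HasIdentifier τ M ν u i → HasIdentifier τ M ν v j →
    (τ'.anc i j ↔ (merge τ M).anc u v)
  label_eq : ∀ v i, (merge τ M).node v → HasIdentifier τ M ν v i →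
    τ'.label i = (merge τ M).label v
  acc_iff : ∀ v i, (merge τ M).node v → HasIdentifier τ M ν v i →
    (τ'.acc i ↔ (merge τ M).acc v)
  rootLabel_eq : τ'.rootLabel = (merge τ M).rootLabel

/-- The identifier `i` is deleted when `τ` reads `M`: its edge dies out in Step 2, or it is merged
in Step 3 into a path of which it is not the first edge. -/
def Deleted (τ : Scheme N) (M : Letter N) (i : N) : Prop :=
  τ.node i ∧ (¬ (prune τ M).node (.inl i) ∨
    ∃ v, (prune τ M).OnPath v (.inl i) ∧ ¬ (prune τ M).FirstOnPath v (.inl i))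

/-- The identifier `i` is refreshed when `τ` reads `M`: in Step 3 a path is folded into its first
edge, which is identified by `i`, and some other edge of the path is accepting. -/
def Refreshed (τ : Scheme N) (M : Letter N) (i : N) : Prop :=
  ∃ v, (prune τ M).FirstOnPath v (.inl i) ∧
    ∃ x, (prune τ M).OnPath v x ∧ x ≠ .inl i ∧ (prune τ M).acc x

end Transition

/-- `ρ` is, inside the structure, a run of the `Q`-scheme automaton over `α`; `ν n` is the choice
of new identifiers in the `n`-th transition. The states are the `Q`-schemes and the tree that
consists of the root alone. -/
structure IsRun {N : Type*} [CommSemiring N] [LinearOrder N] (S : Set (Set N)) (Q : Set N)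
    (c qI : N) (α : N → Letter N) (ρ : N → Scheme N) (ν : N → N → N) : Prop where
  coded_node : IsRel₂ S fun n i => (ρ n).node i
  coded_anc : IsRel₃ S fun n i j => (ρ n).anc i j
  coded_label : IsRel₃ S fun n i q => (ρ n).node i ∧ (ρ n).label i = q
  coded_acc : IsRel₂ S fun n i => (ρ n).node i ∧ (ρ n).acc i
  coded_rootLabel : IsFun₁ S fun n => (ρ n).rootLabel
  coded_choice : IsFun₂ S ν
  state : ∀ n, IsQScheme Q c (ρ n) ∨ IsDead Q (ρ n)
  initial : IsInitial qI (ρ 0)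
  transition : ∀ n, IsTransition c (ρ n) (α n) (ν n) (ρ (n + 1))

end QDag

set_option linter.unusedSectionVars false
set_option synthInstance.maxSize 10000
set_option synthInstance.maxHeartbeats 200000

universe u

/-! The structure is studied from outside, but comprehension and induction apply only to predicates
whose set of codes lies in `S`. The classes `InS` and `FunS` record this and are closed under
connectives, substitution and bounded quantifiers. `Σ⁰₁` induction then gives finite sets coded by
divisibility, selectors by least witnesses, primitive recursion and the pigeonhole principle; `Σ⁰₂`
induction gives strong collection.

One transition is understood through the leaves below each edge. All edges of a collapsed path have
the same leaves below them, so an undeleted identifier keeps its leaves, transported along the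
letter (`StepCtx.survives`). An accepting edge of a scheme stands for an accepting edge of the dag
whose live descendants are exactly the leaves below it (`RunCtx.accepting_spec`).

From the Rabin condition to a path (`RunCtx.hasAcceptingPath_of_refreshed`): let `i` be permanent
from some time on. Each refreshment of `i` produces an accepting dag edge above all leaves below
`i`, at a level strictly greater than those of all earlier ones, because an edge strictly below `i`
misses some leaf of `i`. The common ancestors of the leaves below `i` at late times therefore form
an accepting path. This direction needs no more than `RCA₀`.

From a path to the Rabin condition: the branch of the schemes that leads to the current state of the
path is described by `IsBranch`. Suppose no permanent edge of it is refreshed infinitely often.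
Below a permanent edge that is no longer refreshed, accepting edges arriving from the path must stay
strictly below; they can only move upwards, so the topmost one reached is permanent
(`IsBranch.exists_permanent`, by strong collection). Iterating by `Σ⁰₂` induction gives a chain of
permanent edges longer than the supply of identifiers, against the pigeonhole principle
(`IsBranch.exists_refreshed`).

Runs are built by primitive recursion on codes of schemes (`exists_run`). The identifiers suffice
because the non-root branching nodes inject into the leaves, so that fewer than `2c` edges are ever
present after a transition (`StepCtx.naming_le`). -/

namespace SOA


/-! ### Discrete order and the pairing function -/

section Arithmetic

variable {N : Type u} [CommSemiring N] [LinearOrder N] [IsStrictOrderedRing N]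
  [CanonicallyOrderedAdd N] {S : Set (Set N)}

theorem succ_le_of_lt (hS : ModelsRCA0 S) {x y : N} (h : x < y) : x + 1 ≤ y := by
  obtain ⟨d, rfl⟩ := exists_add_of_le h.le
  have : 0 < d := by
    rcases eq_or_ne d 0 with rfl | hd
    · simp at h
    · exact pos_iff_ne_zero.2 hd
  gcongr
  exact hS.discrete _ this

theorem lt_succ_iff (hS : ModelsRCA0 S) {x y : N} : x < y + 1 ↔ x ≤ y := by
  constructor
  · intro h
    by_contra hc
    exact absurd (succ_le_of_lt hS (not_le.1 hc)) (not_le.2 h)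
  · intro h
    exact lt_of_le_of_lt h (lt_add_one y)

theorem le_succ_iff (hS : ModelsRCA0 S) {x y : N} : x ≤ y + 1 ↔ x ≤ y ∨ x = y + 1 := by
  rw [le_iff_lt_or_eq, lt_succ_iff hS]

theorem eq_zero_or_succ (hS : ModelsRCA0 S) (x : N) : x = 0 ∨ ∃ y, x = y + 1 := by
  rcases eq_or_ne x 0 with rfl | h
  · exact .inl rfl
  · obtain ⟨d, rfl⟩ := exists_add_of_le (hS.discrete _ (pos_iff_ne_zero.2 h))
    exact .inr ⟨d, add_comm _ _⟩

theorem le_mul_self (hS : ModelsRCA0 S) (x : N) : x ≤ x * x := by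
  rcases eq_zero_or_succ hS x with rfl | ⟨y, rfl⟩
  · simp
  · calc y + 1 = (y + 1) * 1 := (mul_one _).symm
      _ ≤ _ := by gcongr; exact le_add_self

theorem left_le_pair (x y : N) : x ≤ pair x y := le_add_self

theorem right_le_pair (hS : ModelsRCA0 S) (x y : N) : y ≤ pair x y :=
  calc y ≤ x + y := le_add_self
    _ ≤ _ := le_mul_self hS _
    _ ≤ _ := le_self_add

theorem pair_lt (x y : N) : pair x y < (x + y + 1) * (x + y + 1) := by
  have : (x + y + 1) * (x + y + 1) = pair x y + (x + y + y + 1) := by unfold pair; ring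
  rw [this]
  exact lt_add_of_pos_right _ (lt_of_lt_of_le zero_lt_one le_add_self)

/-- The code lies between the squares of `x + y` and `x + y + 1`, which determines the sum;
cancelling it gives `x`, then `y`. -/
theorem pair_inj (hS : ModelsRCA0 S) {x y x' y' : N} (h : pair x y = pair x' y') :
    x = x' ∧ y = y' := by
  have key : ∀ a b a' b' : N, pair a b = pair a' b' → ¬ a + b < a' + b' := by
    intro a b a' b' h hlt
    have h1 := succ_le_of_lt hS hlt
    have h2 : (a + b + 1) * (a + b + 1) ≤ (a' + b') * (a' + b') := by gcongr
    have h3 : (a' + b') * (a' + b') ≤ pair a' b' := le_self_add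
    exact absurd (pair_lt a b) (not_lt.2 (h ▸ h2.trans h3))
  have e : x + y = x' + y' :=
    le_antisymm (not_lt.1 (key _ _ _ _ h.symm)) (not_lt.1 (key _ _ _ _ h))
  have hx : x = x' := by
    unfold pair at h
    rw [e] at h
    exact add_left_cancel h
  subst hx
  exact ⟨rfl, add_left_cancel e⟩

theorem pair_mono {x y x' y' : N} (hx : x ≤ x') (hy : y ≤ y') : pair x y ≤ pair x' y' := by
  unfold pair
  gcongr

end Arithmetic

/-! ### Comprehension with three set parameters -/

section Comprehension

variable {N : Type u} [CommSemiring N] [LinearOrder N] [IsStrictOrderedRing N]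
  [CanonicallyOrderedAdd N] {S : Set (Set N)}

/-- The term for the pairing function. -/
def Term.pr (s t : Term) : Term := .add (.mul (.add s t) (.add s t)) s

/-- Three set parameters. -/
def params (X Y Z : Set N) : ℕ → Set N
  | 0 => X
  | 1 => Y
  | _ => Z

theorem params_mem {X Y Z : Set N} (hX : X ∈ S) (hY : Y ∈ S) (hZ : Z ∈ S) :
    ∀ k, params X Y Z k ∈ S
  | 0 => hX
  | 1 => hY
  | _ + 2 => hZ

theorem delta00_mem (hS : ModelsRCA0 S) {X Y Z : Set N} (hX : X ∈ S) (hY : Y ∈ S) (hZ : Z ∈ S)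
    (e : ℕ → N) (φ : Formula) (hφ : IsDelta00 φ) :
    {x | φ.Realize (params X Y Z) (cons x e)} ∈ S :=
  hS.delta01_comprehension φ (.neg φ) (.delta hφ) (.delta hφ.neg) e _ (params_mem hX hY hZ)
    fun _ => not_not.symm

theorem sigma01_mem (hS : ModelsRCA0 S) {X Y Z : Set N} (hX : X ∈ S) (hY : Y ∈ S) (hZ : Z ∈ S)
    (φ ψ : Formula) (hφ : IsDelta00 φ) (hψ : IsDelta00 ψ)
    (h : ∀ x, (∃ y, φ.Realize (params X Y Z) (cons y (cons x fun _ => 0))) ↔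
      ¬ ∃ y, ψ.Realize (params X Y Z) (cons y (cons x fun _ => 0))) :
    {x | ∃ y, φ.Realize (params X Y Z) (cons y (cons x fun _ => 0))} ∈ S :=
  hS.delta01_comprehension (.ex φ) (.ex ψ) (.ex (.delta hφ)) (.ex (.delta hψ)) _ _
    (params_mem hX hY hZ) h

end Comprehension

/-! ### Coded types and the closure properties of definable predicates -/

/-- A type whose elements are coded by numbers. -/
class Coded {N : Type u} (S : Set (Set N)) (A : Type u) where
  enc : A → N
  enc_inj : Function.Injective enc
  range_mem : Set.range enc ∈ S

section Calculus

variable {N : Type u} [CommSemiring N] [LinearOrder N] [IsStrictOrderedRing N]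
  [CanonicallyOrderedAdd N]

/-- The set of the codes of the elements with the property `P`. -/
def codeSet (S : Set (Set N)) {A : Type u} [Coded S A] (P : A → Prop) : Set N :=
  {z | ∃ a, z = Coded.enc S a ∧ P a}

/-- The predicate `P` belongs to the second-order part. -/
class InS (S : Set (Set N)) {A : Type u} [Coded S A] (P : A → Prop) : Prop where
  mem : codeSet S P ∈ S

variable {S : Set (Set N)} [hS : Fact (ModelsRCA0 S)]

theorem univ_mem : (Set.univ : Set N) ∈ S := by
  obtain ⟨X, hX⟩ := hS.out.nonempty
  have := delta00_mem hS.out hX hX hX (fun _ => 0) (.eq (.var 0) (.var 0)) (by constructor)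
  convert this
  simp [Formula.Realize]

instance codedSelf : Coded S N where
  enc := id
  enc_inj := Function.injective_id
  range_mem := by simpa using univ_mem

variable {A B C V : Type u} [Coded S A] [Coded S B] [Coded S C] [Coded S V]

instance codedProd : Coded S (A × B) where
  enc p := pair (Coded.enc S p.1) (Coded.enc S p.2)
  enc_inj := by
    rintro ⟨a, b⟩ ⟨a', b'⟩ h
    obtain ⟨h1, h2⟩ := pair_inj hS.out h
    exact Prod.ext (Coded.enc_inj h1) (Coded.enc_inj h2)
  range_mem := by
    have := delta00_mem hS.out (Coded.range_mem (S := S) (A := A))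
      (Coded.range_mem (S := S) (A := B)) univ_mem (fun _ => 0)
      (.bexLe (.var 0) (.bexLe (.var 1) (.and (.eq (.var 2) (Term.pr (.var 1) (.var 0)))
        (.and (.mem (.var 1) 0) (.mem (.var 0) 1)))))
      (by repeat constructor)
    convert this using 1
    ext z
    constructor
    · rintro ⟨⟨a, b⟩, rfl⟩
      exact ⟨_, left_le_pair _ _, _, right_le_pair hS.out _ _, rfl, ⟨a, rfl⟩, ⟨b, rfl⟩⟩
    · rintro ⟨_, _, _, _, h, ⟨a, rfl⟩, ⟨b, rfl⟩⟩
      exact ⟨(a, b), h.symm⟩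

instance codedSum : Coded S (A ⊕ B) where
  enc v := v.elim (fun a => pair 0 (Coded.enc S a)) fun b => pair 1 (Coded.enc S b)
  enc_inj := by
    rintro (a | a) (b | b) h <;> obtain ⟨h1, h2⟩ := pair_inj hS.out h
    · exact congrArg _ (Coded.enc_inj h2)
    · simp at h1
    · simp at h1
    · exact congrArg _ (Coded.enc_inj h2)
  range_mem := by
    have := delta00_mem hS.out (Coded.range_mem (S := S) (A := A))
      (Coded.range_mem (S := S) (A := B)) univ_mem (fun _ => 0)
      (.bexLe (.var 0) (.or (.and (.eq (.var 1) (Term.pr .zero (.var 0))) (.mem (.var 0) 0))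
        (.and (.eq (.var 1) (Term.pr .one (.var 0))) (.mem (.var 0) 1))))
      (by repeat constructor)
    convert this using 1
    ext z
    constructor
    · rintro ⟨a | b, rfl⟩
      · exact ⟨_, right_le_pair hS.out _ _, .inl ⟨rfl, a, rfl⟩⟩
      · exact ⟨_, right_le_pair hS.out _ _, .inr ⟨rfl, b, rfl⟩⟩
    · rintro ⟨_, _, ⟨h, a, rfl⟩ | ⟨h, b, rfl⟩⟩
      · exact ⟨.inl a, h.symm⟩
      · exact ⟨.inr b, h.symm⟩

theorem enc_mem_codeSet {P : A → Prop} {a : A} : Coded.enc S a ∈ codeSet S P ↔ P a :=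
  ⟨fun ⟨_, h, hb⟩ => Coded.enc_inj h ▸ hb, fun h => ⟨a, rfl, h⟩⟩

theorem InS.congr {P P' : A → Prop} [h : InS S P] (hP : ∀ a, P' a ↔ P a) : InS S P' := by
  rwa [show P' = P from funext fun a => propext (hP a)]

end Calculus
end SOA

namespace SOA


section Calculus

variable {N : Type u} [CommSemiring N] [LinearOrder N] [IsStrictOrderedRing N]
  [CanonicallyOrderedAdd N]
variable {S : Set (Set N)} [hS : Fact (ModelsRCA0 S)]
variable {A B C V : Type u} [Coded S A] [Coded S B] [Coded S C] [Coded S V]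

/-- The function `f` belongs to the second-order part. -/
class FunS (S : Set (Set N)) [Fact (ModelsRCA0 S)] {A B : Type u} [Coded S A] [Coded S B]
    (f : A → B) : Prop where
  graph : InS S fun p : A × B => f p.1 = p.2

theorem pair_mem_codeSet {P : A × B → Prop} {a : A} {b : B} :
    pair (Coded.enc S a) (Coded.enc S b) ∈ codeSet S P ↔ P (a, b) :=
  enc_mem_codeSet (a := (a, b))

/-! #### Connectives -/

instance InS.not {P : A → Prop} [hP : InS S P] : InS S fun a => ¬ P a where
  mem := by
    have := delta00_mem hS.out hP.mem (Coded.range_mem (S := S) (A := A)) univ_mem (fun _ => 0)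
      (.and (.mem (.var 0) 1) (.neg (.mem (.var 0) 0))) (by repeat constructor)
    convert this using 1
    ext z
    constructor
    · rintro ⟨a, rfl, h⟩
      exact ⟨⟨a, rfl⟩, fun h' => h (enc_mem_codeSet.1 h')⟩
    · rintro ⟨⟨a, rfl⟩, h⟩
      exact ⟨a, rfl, fun h' => h (enc_mem_codeSet.2 h')⟩

instance InS.and {P P' : A → Prop} [hP : InS S P] [hP' : InS S P'] :
    InS S fun a => P a ∧ P' a where
  mem := by
    have := delta00_mem hS.out hP.mem hP'.mem univ_mem (fun _ => 0)
      (.and (.mem (.var 0) 0) (.mem (.var 0) 1)) (by repeat constructor)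
    convert this using 1
    ext z
    constructor
    · rintro ⟨a, rfl, h⟩
      exact ⟨enc_mem_codeSet.2 h.1, enc_mem_codeSet.2 h.2⟩
    · rintro ⟨⟨a, rfl, h⟩, h'⟩
      exact ⟨a, rfl, h, enc_mem_codeSet.1 h'⟩

instance InS.or {P P' : A → Prop} [hP : InS S P] [hP' : InS S P'] :
    InS S fun a => P a ∨ P' a :=
  InS.congr (P := fun a => ¬ (¬ P a ∧ ¬ P' a)) fun a => by tauto

instance InS.imp {P P' : A → Prop} [hP : InS S P] [hP' : InS S P'] :
    InS S fun a => P a → P' a :=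
  InS.congr (P := fun a => ¬ P a ∨ P' a) fun a => by tauto

instance InS.iff {P P' : A → Prop} [hP : InS S P] [hP' : InS S P'] :
    InS S fun a => P a ↔ P' a :=
  InS.congr (P := fun a => (P a → P' a) ∧ (P' a → P a)) fun a => by tauto

/-- The truth value of `p` is settled outside the structure, so `p` itself need not be expressible.
-/
instance InS.const (p : Prop) : InS S fun _ : A => p := by
  have h : InS S fun _ : A => True := ⟨by
    convert Coded.range_mem (S := S) (A := A) using 1
    ext z
    exact ⟨fun ⟨a, h, _⟩ => ⟨a, h.symm⟩, fun ⟨a, h⟩ => ⟨a, h.symm, trivial⟩⟩⟩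
  by_cases hp : p
  · exact InS.congr (P := fun _ => True) fun a => by tauto
  · exact InS.congr (P := fun _ => ¬ True) fun a => by tauto

/-! #### Substitution -/

/-- The value of `f` may be quantified existentially both in `P (f a)` and in its negation, so the
predicate is `Δ⁰₁`. -/
theorem InS.comp {P : B → Prop} {f : A → B} (hP : InS S P) (hf : FunS S f) :
    InS S fun a => P (f a) where
  mem := by
    have := sigma01_mem hS.out hf.graph.mem hP.mem (Coded.range_mem (S := S) (A := A))
      (.and (.mem (Term.pr (.var 1) (.var 0)) 0) (.mem (.var 0) 1))
      -- The first disjunct catches the numbers that code no element, so that the two formulas are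
      -- complementary on the whole domain.
      (.or (.neg (.mem (.var 1) 2))
        (.and (.mem (Term.pr (.var 1) (.var 0)) 0) (.neg (.mem (.var 0) 1))))
      (by repeat constructor) (by repeat constructor) ?_
    · convert this using 1
      ext z
      constructor
      · rintro ⟨a, rfl, h⟩
        exact ⟨Coded.enc S (f a), pair_mem_codeSet.2 rfl, enc_mem_codeSet.2 h⟩
      · rintro ⟨y, ⟨⟨a, b⟩, h1, h2⟩, ⟨b', rfl, h⟩⟩
        obtain ⟨rfl, h4⟩ := pair_inj hS.out h1
        obtain rfl := Coded.enc_inj h4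
        exact ⟨a, rfl, by simpa only [h2] using h⟩
    · intro z
      by_cases hz : z ∈ Set.range (Coded.enc S (A := A))
      · obtain ⟨a, rfl⟩ := hz
        constructor
        · rintro ⟨y, h1, h2⟩ ⟨y', h | ⟨h3, h4⟩⟩
          · exact h ⟨a, rfl⟩
          · obtain ⟨⟨a1, b1⟩, e1, g1⟩ := h1
            obtain ⟨⟨a2, b2⟩, e2, g2⟩ := h3
            obtain ⟨e3, e4⟩ := pair_inj hS.out e1
            obtain ⟨e5, e6⟩ := pair_inj hS.out e2
            obtain rfl := Coded.enc_inj e3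
            obtain rfl := Coded.enc_inj e5
            have : b1 = b2 := g1.symm.trans g2
            subst this
            apply h4
            change y' ∈ _
            rw [show y' = y from e6.trans e4.symm]
            exact h2
        · intro h
          refine ⟨Coded.enc S (f a), pair_mem_codeSet.2 rfl, ?_⟩
          by_contra hc
          exact h ⟨Coded.enc S (f a), .inr ⟨pair_mem_codeSet.2 rfl, hc⟩⟩
      · constructor
        · rintro ⟨y, ⟨⟨a, b⟩, h1, h2⟩, _⟩
          exact absurd ⟨a, (pair_inj hS.out h1).1.symm⟩ hz
        · intro h
          exact absurd ⟨0, .inl hz⟩ h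

theorem FunS.comp {g : B → C} {f : A → B} (hg : FunS S g) (hf : FunS S f) :
    FunS S fun a => g (f a) where
  graph := ⟨by
    have := sigma01_mem hS.out hf.graph.mem hg.graph.mem (Coded.range_mem (S := S) (A := A × C))
      (.bexLe (.var 1) (.bexLe (.var 2) (.and (.eq (.var 3) (Term.pr (.var 1) (.var 0)))
        (.and (.mem (Term.pr (.var 1) (.var 2)) 0) (.mem (Term.pr (.var 2) (.var 0)) 1)))))
      (.or (.neg (.mem (.var 1) 2))
        (.bexLe (.var 1) (.bexLe (.var 2) (.and (.eq (.var 3) (Term.pr (.var 1) (.var 0)))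
        (.and (.mem (Term.pr (.var 1) (.var 2)) 0) (.neg (.mem (Term.pr (.var 2) (.var 0)) 1)))))))
      (by repeat constructor) (by repeat constructor) ?_
    · convert this using 1
      ext z
      constructor
      · rintro ⟨⟨a, d⟩, rfl, h⟩
        exact ⟨Coded.enc S (f a), Coded.enc S a, left_le_pair _ _, Coded.enc S d,
          right_le_pair hS.out _ _, rfl, pair_mem_codeSet.2 rfl, pair_mem_codeSet.2 h⟩
      · rintro ⟨y, x, _, w, _, h, ⟨⟨a, b⟩, h1, h2⟩, ⟨⟨b', d⟩, h3, h4⟩⟩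
        obtain ⟨rfl, h5⟩ := pair_inj hS.out h1
        obtain ⟨h6, rfl⟩ := pair_inj hS.out h3
        obtain rfl := Coded.enc_inj (h5.symm.trans h6)
        exact ⟨(a, d), h, by simpa only [h2] using h4⟩
    · intro z
      by_cases hz : z ∈ Set.range (Coded.enc S (A := A × C))
      · obtain ⟨⟨a, d⟩, rfl⟩ := hz
        constructor
        · rintro ⟨y, x, _, w, _, h, h1, h2⟩ ⟨y', h' | ⟨x', _, w', _, h3, h4, h5⟩⟩
          · exact h' ⟨(a, d), rfl⟩
          · obtain ⟨rfl, rfl⟩ := pair_inj hS.out h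
            obtain ⟨rfl, rfl⟩ := pair_inj hS.out h3
            obtain ⟨⟨a1, b1⟩, e1, g1⟩ := h1
            obtain ⟨⟨a2, b2⟩, e2, g2⟩ := h4
            obtain ⟨e3, e4⟩ := pair_inj hS.out e1
            obtain ⟨e5, e6⟩ := pair_inj hS.out e2
            obtain rfl := Coded.enc_inj e3
            obtain rfl := Coded.enc_inj e5
            have : b1 = b2 := g1.symm.trans g2
            subst this
            apply h5
            change pair y' _ ∈ _
            rw [show y' = y from e6.trans e4.symm]
            exact h2
        · intro h
          refine ⟨Coded.enc S (f a), Coded.enc S a, left_le_pair _ _, Coded.enc S d,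
            right_le_pair hS.out _ _, rfl, pair_mem_codeSet.2 rfl, ?_⟩
          by_contra hc
          exact h ⟨Coded.enc S (f a), .inr ⟨Coded.enc S a, left_le_pair _ _, Coded.enc S d,
            right_le_pair hS.out _ _, rfl, pair_mem_codeSet.2 rfl, hc⟩⟩
      · constructor
        · rintro ⟨y, x, _, w, _, h, ⟨⟨a, b⟩, h1, h2⟩, ⟨⟨b', d⟩, h3, h4⟩⟩
          obtain ⟨rfl, h5⟩ := pair_inj hS.out h1
          obtain ⟨h6, rfl⟩ := pair_inj hS.out h3
          exact absurd ⟨(a, d), h.symm⟩ hz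
        · intro h
          exact absurd ⟨0, .inl hz⟩ h⟩

instance (priority := low) InS.subst {P : B → Prop} {f : A → B} [hP : InS S P] [hf : FunS S f] :
    InS S fun a => P (f a) := hP.comp hf

instance (priority := low) FunS.subst {g : B → C} {f : A → B} [hg : FunS S g] [hf : FunS S f] :
    FunS S fun a => g (f a) := hg.comp hf

instance (priority := high) FunS.id : FunS S fun a : A => a where
  graph := ⟨by
    have := delta00_mem hS.out (Coded.range_mem (S := S) (A := A)) univ_mem univ_mem (fun _ => 0)
      (.bexLe (.var 0) (.and (.eq (.var 1) (Term.pr (.var 0) (.var 0))) (.mem (.var 0) 0)))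
      (by repeat constructor)
    convert this using 1
    ext z
    constructor
    · rintro ⟨⟨a, b⟩, rfl, h⟩
      obtain rfl : a = b := h
      exact ⟨Coded.enc S a, left_le_pair _ _, rfl, a, rfl⟩
    · rintro ⟨_, _, h, a, rfl⟩
      exact ⟨(a, a), h, rfl⟩⟩

instance (priority := high) FunS.const (b : B) : FunS S fun _ : A => b where
  graph := ⟨by
    have := delta00_mem hS.out (Coded.range_mem (S := S) (A := A)) univ_mem univ_mem
      (fun _ => Coded.enc S b)
      (.bexLe (.var 0) (.and (.eq (.var 1) (Term.pr (.var 0) (.var 2))) (.mem (.var 0) 0)))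
      (by repeat constructor)
    convert this using 1
    ext z
    constructor
    · rintro ⟨⟨a, b'⟩, rfl, h⟩
      obtain rfl : b = b' := h
      exact ⟨Coded.enc S a, left_le_pair _ _, rfl, a, rfl⟩
    · rintro ⟨_, _, h, a, rfl⟩
      exact ⟨(a, b), h, rfl⟩⟩

theorem FunS.prodFst : FunS S (Prod.fst : A × B → A) where
  graph := ⟨by
    have := delta00_mem hS.out (Coded.range_mem (S := S) (A := A))
      (Coded.range_mem (S := S) (A := B)) univ_mem (fun _ => 0)
      (.bexLe (.var 0) (.bexLe (.var 1) (.and (.eq (.var 2)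
        (Term.pr (Term.pr (.var 1) (.var 0)) (.var 1))) (.and (.mem (.var 1) 0) (.mem (.var 0) 1)))))
      (by repeat constructor)
    convert this using 1
    ext z
    constructor
    · rintro ⟨⟨⟨a, b⟩, a'⟩, rfl, h⟩
      obtain rfl : a = a' := h
      exact ⟨Coded.enc S a, right_le_pair hS.out _ _, Coded.enc S b,
        (right_le_pair hS.out _ _).trans (left_le_pair _ _), rfl, ⟨a, rfl⟩, ⟨b, rfl⟩⟩
    · rintro ⟨_, _, _, _, h, ⟨a, rfl⟩, ⟨b, rfl⟩⟩
      exact ⟨((a, b), a), h, rfl⟩⟩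

theorem FunS.prodSnd : FunS S (Prod.snd : A × B → B) where
  graph := ⟨by
    have := delta00_mem hS.out (Coded.range_mem (S := S) (A := A))
      (Coded.range_mem (S := S) (A := B)) univ_mem (fun _ => 0)
      (.bexLe (.var 0) (.bexLe (.var 1) (.and (.eq (.var 2)
        (Term.pr (Term.pr (.var 1) (.var 0)) (.var 0))) (.and (.mem (.var 1) 0) (.mem (.var 0) 1)))))
      (by repeat constructor)
    convert this using 1
    ext z
    constructor
    · rintro ⟨⟨⟨a, b⟩, a'⟩, rfl, h⟩
      obtain rfl : b = a' := h
      exact ⟨Coded.enc S a, (left_le_pair _ _).trans (left_le_pair _ _), Coded.enc S b,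
        right_le_pair hS.out _ _, rfl, ⟨a, rfl⟩, ⟨b, rfl⟩⟩
    · rintro ⟨_, _, _, _, h, ⟨a, rfl⟩, ⟨b, rfl⟩⟩
      exact ⟨((a, b), b), h, rfl⟩⟩

instance (priority := high) FunS.fst {f : A → B × C} [hf : FunS S f] : FunS S fun a => (f a).1 :=
  FunS.prodFst.comp hf

instance (priority := high) FunS.snd {f : A → B × C} [hf : FunS S f] : FunS S fun a => (f a).2 :=
  FunS.prodSnd.comp hf

instance FunS.prodMk {f : A → B} {g : A → C} [hf : FunS S f] [hg : FunS S g] :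
    FunS S fun a => (f a, g a) where
  graph := ⟨by
    have := delta00_mem hS.out hf.graph.mem hg.graph.mem univ_mem (fun _ => 0)
      (.bexLe (.var 0) (.bexLe (.var 1) (.bexLe (.var 2) (.and (.eq (.var 3)
        (Term.pr (.var 2) (Term.pr (.var 1) (.var 0)))) (.and (.mem (Term.pr (.var 2) (.var 1)) 0)
          (.mem (Term.pr (.var 2) (.var 0)) 1))))))
      (by repeat constructor)
    convert this using 1
    ext z
    constructor
    · rintro ⟨⟨a, b, d⟩, rfl, h⟩
      obtain ⟨h1, h2⟩ := Prod.ext_iff.1 h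
      obtain rfl : f a = b := h1
      obtain rfl : g a = d := h2
      exact ⟨_, left_le_pair _ _, _, (left_le_pair _ _).trans (right_le_pair hS.out _ _), _,
        (right_le_pair hS.out _ _).trans (right_le_pair hS.out _ _), rfl,
        pair_mem_codeSet.2 rfl, pair_mem_codeSet.2 rfl⟩
    · rintro ⟨x, _, y, _, w, _, h, ⟨⟨a, b⟩, h1, h2⟩, ⟨⟨a', d⟩, h3, h4⟩⟩
      obtain ⟨rfl, rfl⟩ := pair_inj hS.out h1
      obtain ⟨h5, rfl⟩ := pair_inj hS.out h3
      obtain rfl := Coded.enc_inj h5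
      exact ⟨(a, b, d), h, Prod.ext h2 h4⟩⟩

instance InS.eq {f g : A → B} [FunS S f] [FunS S g] : InS S fun a => f a = g a :=
  (FunS.id (S := S) (A := B)).graph.comp (f := fun a => (f a, g a)) inferInstance

instance InS.ne {f g : A → B} [FunS S f] [FunS S g] : InS S fun a => f a ≠ g a :=
  InS.not

theorem FunS.add' : FunS S fun p : N × N => p.1 + p.2 where
  graph := ⟨by
    have := delta00_mem hS.out univ_mem univ_mem univ_mem (fun _ => 0)
      (.bexLe (.var 0) (.bexLe (.var 1) (.eq (.var 2)
        (Term.pr (Term.pr (.var 1) (.var 0)) (.add (.var 1) (.var 0))))))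
      (by repeat constructor)
    convert this using 1
    ext z
    constructor
    · rintro ⟨⟨⟨a, b⟩, a'⟩, rfl, h⟩
      obtain rfl : a + b = a' := h
      exact ⟨a, (left_le_pair _ _).trans (left_le_pair _ _), b,
        (right_le_pair hS.out _ _).trans (left_le_pair _ _), rfl⟩
    · rintro ⟨a, _, b, _, h⟩
      exact ⟨((a, b), a + b), h, rfl⟩⟩

theorem FunS.mul' : FunS S fun p : N × N => p.1 * p.2 where
  graph := ⟨by
    have := delta00_mem hS.out univ_mem univ_mem univ_mem (fun _ => 0)
      (.bexLe (.var 0) (.bexLe (.var 1) (.eq (.var 2)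
        (Term.pr (Term.pr (.var 1) (.var 0)) (.mul (.var 1) (.var 0))))))
      (by repeat constructor)
    convert this using 1
    ext z
    constructor
    · rintro ⟨⟨⟨a, b⟩, a'⟩, rfl, h⟩
      obtain rfl : a * b = a' := h
      exact ⟨a, (left_le_pair _ _).trans (left_le_pair _ _), b,
        (right_le_pair hS.out _ _).trans (left_le_pair _ _), rfl⟩
    · rintro ⟨a, _, b, _, h⟩
      exact ⟨((a, b), a * b), h, rfl⟩⟩

instance FunS.add {f g : A → N} [FunS S f] [FunS S g] : FunS S fun a => f a + g a :=
  FunS.add'.comp (f := fun a => (f a, g a)) inferInstance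

instance FunS.mul {f g : A → N} [FunS S f] [FunS S g] : FunS S fun a => f a * g a :=
  FunS.mul'.comp (f := fun a => (f a, g a)) inferInstance

instance FunS.pair {f g : A → N} [FunS S f] [FunS S g] : FunS S fun a => pair (f a) (g a) := by
  unfold SOA.pair
  infer_instance

theorem FunS.enc' : FunS S fun a : A => Coded.enc S a where
  graph := ⟨by
    have := delta00_mem hS.out (Coded.range_mem (S := S) (A := A)) univ_mem univ_mem (fun _ => 0)
      (.bexLe (.var 0) (.and (.eq (.var 1) (Term.pr (.var 0) (.var 0))) (.mem (.var 0) 0)))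
      (by repeat constructor)
    convert this using 1
    ext z
    constructor
    · rintro ⟨⟨a, b⟩, rfl, h⟩
      obtain rfl : Coded.enc S a = b := h
      exact ⟨Coded.enc S a, left_le_pair _ _, rfl, a, rfl⟩
    · rintro ⟨_, _, h, a, rfl⟩
      exact ⟨(a, Coded.enc S a), h, rfl⟩⟩

instance FunS.enc {f : A → B} [hf : FunS S f] : FunS S fun a => Coded.enc S (f a) :=
  FunS.enc'.comp hf

theorem FunS.inl' : FunS S (Sum.inl : A → A ⊕ B) where
  graph := ⟨by
    have := delta00_mem hS.out (Coded.range_mem (S := S) (A := A)) univ_mem univ_mem (fun _ => 0)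
      (.bexLe (.var 0) (.and (.eq (.var 1) (Term.pr (.var 0) (Term.pr .zero (.var 0))))
        (.mem (.var 0) 0)))
      (by repeat constructor)
    convert this using 1
    ext z
    constructor
    · rintro ⟨⟨a, b⟩, rfl, h⟩
      obtain rfl : Sum.inl a = b := h
      exact ⟨Coded.enc S a, left_le_pair _ _, rfl, a, rfl⟩
    · rintro ⟨_, _, h, a, rfl⟩
      exact ⟨(a, .inl a), h, rfl⟩⟩

theorem FunS.inr' : FunS S (Sum.inr : B → A ⊕ B) where
  graph := ⟨by
    have := delta00_mem hS.out (Coded.range_mem (S := S) (A := B)) univ_mem univ_mem (fun _ => 0)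
      (.bexLe (.var 0) (.and (.eq (.var 1) (Term.pr (.var 0) (Term.pr .one (.var 0))))
        (.mem (.var 0) 0)))
      (by repeat constructor)
    convert this using 1
    ext z
    constructor
    · rintro ⟨⟨a, b⟩, rfl, h⟩
      obtain rfl : Sum.inr a = b := h
      exact ⟨Coded.enc S a, left_le_pair _ _, rfl, a, rfl⟩
    · rintro ⟨_, _, h, a, rfl⟩
      exact ⟨(a, .inr a), h, rfl⟩⟩

instance FunS.inl {f : A → B} [hf : FunS S f] : FunS S fun a => (Sum.inl (f a) : B ⊕ C) :=
  FunS.inl'.comp hf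

instance FunS.inr {f : A → C} [hf : FunS S f] : FunS S fun a => (Sum.inr (f a) : B ⊕ C) :=
  FunS.inr'.comp hf

theorem InS.sum {P : A × (B ⊕ C) → Prop} (h1 : InS S fun p : A × B => P (p.1, .inl p.2))
    (h2 : InS S fun p : A × C => P (p.1, .inr p.2)) : InS S P where
  mem := by
    have := delta00_mem hS.out h1.mem h2.mem univ_mem (fun _ => 0)
      (.bexLe (.var 0) (.bexLe (.var 1) (.or
        (.and (.eq (.var 2) (Term.pr (.var 1) (Term.pr .zero (.var 0))))
          (.mem (Term.pr (.var 1) (.var 0)) 0))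
        (.and (.eq (.var 2) (Term.pr (.var 1) (Term.pr .one (.var 0))))
          (.mem (Term.pr (.var 1) (.var 0)) 1)))))
      (by repeat constructor)
    convert this using 1
    ext z
    constructor
    · rintro ⟨⟨a, b | b⟩, rfl, h⟩
      · exact ⟨_, left_le_pair _ _, _, (right_le_pair hS.out _ _).trans (right_le_pair hS.out _ _),
          .inl ⟨rfl, pair_mem_codeSet.2 h⟩⟩
      · exact ⟨_, left_le_pair _ _, _, (right_le_pair hS.out _ _).trans (right_le_pair hS.out _ _),
          .inr ⟨rfl, pair_mem_codeSet.2 h⟩⟩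
    · rintro ⟨_, _, _, _, ⟨h, ⟨a, b⟩, h1, h2⟩ | ⟨h, ⟨a, b⟩, h1, h2⟩⟩
      · obtain ⟨rfl, rfl⟩ := pair_inj hS.out h1
        exact ⟨(a, .inl b), h, h2⟩
      · obtain ⟨rfl, rfl⟩ := pair_inj hS.out h1
        exact ⟨(a, .inr b), h, h2⟩

/-! #### Order and bounded quantifiers -/

theorem InS.bexEnc' {P : A × V → Prop} (hP : InS S P) :
    InS S fun p : A × N => ∃ v, Coded.enc S v ≤ p.2 ∧ P (p.1, v) where
  mem := by
    have := delta00_mem hS.out hP.mem (Coded.range_mem (S := S) (A := A)) univ_mem (fun _ => 0)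
      (.bexLe (.var 0) (.bexLe (.var 1) (.and (.eq (.var 2) (Term.pr (.var 1) (.var 0)))
        (.and (.mem (.var 1) 1) (.bexLe (.var 0) (.mem (Term.pr (.var 2) (.var 0)) 0))))))
      (by repeat constructor)
    convert this using 1
    ext z
    constructor
    · rintro ⟨⟨a, w⟩, rfl, v, hv, h⟩
      exact ⟨_, left_le_pair _ _, w, right_le_pair hS.out _ _, rfl, ⟨a, rfl⟩, _, hv,
        pair_mem_codeSet.2 h⟩
    · rintro ⟨_, _, w, _, h, ⟨a, rfl⟩, y, hy, ⟨a', v⟩, h1, h2⟩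
      obtain ⟨h3, rfl⟩ := pair_inj hS.out h1
      obtain rfl := Coded.enc_inj h3
      exact ⟨(a, w), h, v, hy, h2⟩

instance InS.bexEnc {t : A → N} {P : A → V → Prop} [ht : FunS S t]
    [hP : InS S fun p : A × V => P p.1 p.2] :
    InS S fun a => ∃ v, Coded.enc S v ≤ t a ∧ P a v :=
  (InS.bexEnc' hP).comp (f := fun a => (a, t a)) inferInstance

instance InS.ballEnc {t : A → N} {P : A → V → Prop} [ht : FunS S t]
    [hP : InS S fun p : A × V => P p.1 p.2] :
    InS S fun a => ∀ v, Coded.enc S v ≤ t a → P a v :=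
  InS.congr (P := fun a => ¬ ∃ v, Coded.enc S v ≤ t a ∧ ¬ P a v) fun a => by
    simp only [not_exists, not_and, not_not]

instance InS.bex {t : A → N} {P : A → N → Prop} [ht : FunS S t]
    [hP : InS S fun p : A × N => P p.1 p.2] :
    InS S fun a => ∃ v, v ≤ t a ∧ P a v :=
  InS.bexEnc (V := N)

instance InS.ball {t : A → N} {P : A → N → Prop} [ht : FunS S t]
    [hP : InS S fun p : A × N => P p.1 p.2] :
    InS S fun a => ∀ v, v ≤ t a → P a v :=
  InS.ballEnc (V := N)

instance InS.le {f g : A → N} [FunS S f] [FunS S g] : InS S fun a => f a ≤ g a :=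
  InS.congr (P := fun a => ∃ v, v ≤ g a ∧ v = f a) fun a => by simp

instance InS.lt {f g : A → N} [FunS S f] [FunS S g] : InS S fun a => f a < g a :=
  InS.congr (P := fun a => ¬ g a ≤ f a) fun a => by simp

/-! Partial applications. -/

instance FunS.prodMk_apply (a : A) : FunS S (Prod.mk a : B → A × B) :=
  FunS.prodMk (f := fun _ => a) (g := fun b => b)

instance FunS.add_apply (x : N) : FunS S (HAdd.hAdd x : N → N) :=
  FunS.add (f := fun _ => x) (g := fun b => b)

instance FunS.inr_apply : FunS S (Sum.inr : B → A ⊕ B) := FunS.inr'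

/-- A quantifier is bounded if all its witnesses are. -/
theorem InS.exists_of_bdd {P : A → V → Prop} (t : A → N) [FunS S t]
    (hP : InS S fun p : A × V => P p.1 p.2) (hb : ∀ a v, P a v → Coded.enc S v ≤ t a) :
    InS S fun a => ∃ v, P a v :=
  InS.congr (P := fun a => ∃ v, Coded.enc S v ≤ t a ∧ P a v) fun a =>
    ⟨fun ⟨v, h⟩ => ⟨v, hb a v h, h⟩, fun ⟨v, _, h⟩ => ⟨v, h⟩⟩

/-! #### `Δ⁰₁` comprehension and minimization -/

theorem InS.of_sigma {P : A → Prop} (R : A × B → Prop) (R' : A × C → Prop) [hR : InS S R]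
    [hR' : InS S R'] (h : ∀ a, P a ↔ ∃ b, R (a, b)) (h' : ∀ a, ¬ P a ↔ ∃ b, R' (a, b)) :
    InS S P where
  mem := by
    have := sigma01_mem hS.out hR.mem hR'.mem (Coded.range_mem (S := S) (A := A))
      (.mem (Term.pr (.var 1) (.var 0)) 0)
      (.or (.neg (.mem (.var 1) 2)) (.mem (Term.pr (.var 1) (.var 0)) 1))
      (by repeat constructor) (by repeat constructor) ?_
    · convert this using 1
      ext z
      constructor
      · rintro ⟨a, rfl, ha⟩
        obtain ⟨b, hb⟩ := (h a).1 ha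
        exact ⟨_, pair_mem_codeSet.2 hb⟩
      · rintro ⟨y, ⟨a, b⟩, h1, h2⟩
        exact ⟨a, (pair_inj hS.out h1).1, (h a).2 ⟨b, h2⟩⟩
    · intro z
      constructor
      · rintro ⟨y, ⟨a, b⟩, h1, h2⟩ ⟨y', h3 | ⟨⟨a', b'⟩, h3, h4⟩⟩
        · exact h3 ⟨a, (pair_inj hS.out h1).1.symm⟩
        · obtain rfl := Coded.enc_inj ((pair_inj hS.out h1).1.symm.trans (pair_inj hS.out h3).1)
          exact (h' a).2 ⟨b', h4⟩ ((h a).2 ⟨b, h2⟩)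
      · intro hz
        by_cases hr : z ∈ Set.range (Coded.enc S (A := A))
        · obtain ⟨a, rfl⟩ := hr
          by_contra hc
          have : ¬ P a := fun ha => by
            obtain ⟨b, hb⟩ := (h a).1 ha
            exact hc ⟨_, pair_mem_codeSet.2 hb⟩
          obtain ⟨b, hb⟩ := (h' a).1 this
          exact hz ⟨_, .inr (pair_mem_codeSet.2 hb)⟩
        · exact absurd ⟨0, .inl hr⟩ hz

/-- Since `f` is total, a wrong value is refuted by a witness for a different value; hence a `Σ⁰₁`
graph is `Δ⁰₁`. -/
theorem FunS.of_sigma {f : A → B} (R : (A × B) × C → Prop) [hR : InS S R]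
    (h : ∀ a b, f a = b ↔ ∃ d, R ((a, b), d)) : FunS S f where
  graph := by
    refine InS.of_sigma R
      (fun p : (A × B) × (B × C) => p.2.1 ≠ p.1.2 ∧ R ((p.1.1, p.2.1), p.2.2))
      (fun p => h p.1 p.2) fun p => ⟨fun hp => ?_, ?_⟩
    · obtain ⟨d, hd⟩ := (h p.1 (f p.1)).1 rfl
      exact ⟨(f p.1, d), hp, hd⟩
    · rintro ⟨⟨b, d⟩, h1, h2⟩ h3
      exact h1 (((h p.1 b).2 ⟨d, h2⟩).symm.trans h3)

end Calculus

end SOA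

namespace SOA


/-! ### Induction, least elements and selectors -/

section Induction

variable {N : Type u} [CommSemiring N] [LinearOrder N] [IsStrictOrderedRing N]
  [CanonicallyOrderedAdd N]
variable {S : Set (Set N)} [hS : Fact (ModelsRCA0 S)]
variable {A B C V : Type u} [Coded S A] [Coded S B] [Coded S C] [Coded S V]

theorem sigma_induction {P : N → Prop} (R : N × B → Prop) (hR : InS S R)
    (hP : ∀ x, P x ↔ ∃ b, R (x, b)) (h0 : P 0) (hs : ∀ x, P x → P (x + 1)) (x : N) : P x := by
  have key : ∀ x, P x ↔ (Formula.ex (.mem (Term.pr (.var 1) (.var 0)) 0)).Realize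
      (params (codeSet S R) Set.univ Set.univ) (cons x fun _ => 0) := by
    intro x
    rw [hP]
    constructor
    · rintro ⟨b, hb⟩
      exact ⟨_, pair_mem_codeSet.2 hb⟩
    · rintro ⟨y, ⟨a, b⟩, h1, h2⟩
      obtain rfl : x = a := (pair_inj hS.out h1).1
      exact ⟨b, h2⟩
  rw [key]
  exact hS.out.sigma01_induction _ (.ex (.delta (by repeat constructor))) _ _
    (params_mem hR.mem univ_mem univ_mem) ((key 0).1 h0)
    (fun x h => (key _).1 (hs x ((key x).2 h))) x

theorem InS.induction {P : N → Prop} (hP : InS S P) (h0 : P 0) (hs : ∀ x, P x → P (x + 1))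
    (x : N) : P x :=
  sigma_induction (S := S) (B := N) (fun p => P p.1) inferInstance (fun _ => ⟨fun h => ⟨0, h⟩, fun ⟨_, h⟩ => h⟩)
    h0 hs x

theorem InS.induction_from {P : N → Prop} (hP : InS S P) (m : N) (h0 : P m)
    (hs : ∀ x, m ≤ x → P x → P (x + 1)) {x : N} (hx : m ≤ x) : P x := by
  obtain ⟨d, rfl⟩ := exists_add_of_le hx
  refine InS.induction (S := S) (P := fun d => P (m + d)) inferInstance (by simpa using h0)
    (fun d h => ?_) d
  rw [← add_assoc]
  exact hs _ le_self_add h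

theorem InS.exists_least {P : N → Prop} (hP : InS S P) (h : ∃ x, P x) :
    ∃ x, P x ∧ ∀ y, P y → x ≤ y := by
  by_contra hc
  push Not at hc
  have : ∀ x, ∀ y, y ≤ x → ¬ P y := by
    intro x
    refine InS.induction (S := S) (P := fun x => ∀ y, y ≤ x → ¬ P y) inferInstance ?_ ?_ x
    · intro y hy hPy
      obtain ⟨z, _, hz⟩ := hc y hPy
      exact absurd (hz.trans_le hy) (not_lt.2 (zero_le))
    · intro x ih y hy hPy
      obtain ⟨z, hPz, hz⟩ := hc y hPy
      exact ih z ((lt_succ_iff hS.out).1 (hz.trans_le hy)) hPz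
  obtain ⟨x, hx⟩ := h
  exact this x x le_rfl hx

/-- Every nonempty predicate of the second-order part holds for an element with least code. -/
theorem InS.exists_least_enc {P : B → Prop} (hP : InS S P) (h : ∃ x, P x) :
    ∃ x, P x ∧ ∀ y, P y → Coded.enc S x ≤ Coded.enc S y := by
  have hQ : InS S fun z : N => ∃ b, Coded.enc S b ≤ z ∧ (Coded.enc S b = z ∧ P b) := inferInstance
  obtain ⟨b, hb⟩ := h
  obtain ⟨z, ⟨b', _, rfl, hb'⟩, hz⟩ := hQ.exists_least ⟨_, b, le_rfl, rfl, hb⟩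
  exact ⟨b', hb', fun y hy => hz _ ⟨y, le_rfl, rfl, hy⟩⟩

/-- A total relation of the second-order part contains a function of the second-order part. -/
theorem exists_selector {R : A × B → Prop} (hR : InS S R) (h : ∀ a, ∃ b, R (a, b)) :
    ∃ f : A → B, FunS S f ∧ ∀ a, R (a, f a) := by
  have : ∀ a, ∃ b, R (a, b) ∧ ∀ y, R (a, y) → Coded.enc S b ≤ Coded.enc S y := fun a =>
    InS.exists_least_enc (S := S) (P := fun b => R (a, b)) inferInstance (h a)
  choose f hf hmin using this
  -- Taking the witness with the least code makes the graph definable by a quantifier bounded by the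
  -- code of the value.
  refine ⟨f, ⟨InS.congr (P := fun p : A × B => R p ∧
    ∀ b, Coded.enc S b ≤ Coded.enc S p.2 → R (p.1, b) → b = p.2) ?_⟩, hf⟩
  rintro ⟨a, b⟩
  constructor
  · intro hb
    obtain rfl : f a = b := hb
    exact ⟨hf a, fun b h1 h2 => Coded.enc_inj (le_antisymm h1 (hmin a b h2))⟩
  · rintro ⟨h1, h2⟩
    exact h2 _ (hmin a b h1) (hf a)

end Induction

/-! ### Finite sets coded by divisibility -/

section FiniteSets

variable {N : Type u} [CommSemiring N] [LinearOrder N] [IsStrictOrderedRing N]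
  [CanonicallyOrderedAdd N]

/-- A code `(a, m, b)` of a finite set. -/
abbrev FinCode (N : Type u) := N × N × N

/-- `x` belongs to the finite set with the code `s`. -/
def FinCode.Mem (x : N) (s : FinCode N) : Prop :=
  x ≤ s.2.2 ∧ ∃ z, z ≤ s.1 ∧ s.1 = (1 + (x + 1) * s.2.1) * z

/-- In the absence of subtraction, the two quotients are compared and their difference is taken in
the order. -/
theorem dvd_of_dvd_add {x y z : N} (h : x ∣ y) (h' : x ∣ y + z) : x ∣ z := by
  obtain ⟨k, rfl⟩ := h
  obtain ⟨l, hl⟩ := h'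
  rcases eq_or_ne x 0 with rfl | hx
  · simp at hl
    simp [hl]
  · have : k ≤ l := by
      by_contra hc
      have h1 : x * l < x * k := mul_lt_mul_of_pos_left (not_le.1 hc) (pos_iff_ne_zero.2 hx)
      exact absurd (hl ▸ le_self_add : x * k ≤ x * l) (not_le.2 h1)
    obtain ⟨d, rfl⟩ := exists_add_of_le this
    rw [mul_add] at hl
    exact ⟨d, add_left_cancel hl⟩

/-- The factors that code different elements are coprime. -/
theorem dvd_of_dvd_mul_factor {a m i j d e : N} (hij : i = j + d ∨ j = i + d) (hm : m = d * e)
    (h : (1 + (j + 1) * m) ∣ a * (1 + (i + 1) * m)) : (1 + (j + 1) * m) ∣ a := by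
  subst hm
  -- The products `(j + 1)(1 + (i + 1)m)` and `(i + 1)(1 + (j + 1)m)` differ by `d`, so the factor
  -- of `j` divides `a * d`. Multiplying by `(j + 1)e` turns `d` into `(j + 1)m`, which is `-1`
  -- modulo that factor.
  have key : (1 + (j + 1) * (d * e)) ∣ a * d := by
    rcases hij with rfl | rfl
    · have h1 : (1 + (j + 1) * (d * e)) ∣ (j + 1) * (a * (1 + (j + d + 1) * (d * e))) :=
        h.mul_left _
      have h2 : (j + 1) * (a * (1 + (j + d + 1) * (d * e))) + a * d =
          (1 + (j + 1) * (d * e)) * (a * (j + d + 1)) := by ring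
      exact dvd_of_dvd_add h1 (h2 ▸ Dvd.intro _ rfl)
    · have h1 : (1 + (i + d + 1) * (d * e)) ∣ (i + d + 1) * (a * (1 + (i + 1) * (d * e))) :=
        h.mul_left _
      have h2 : (1 + (i + d + 1) * (d * e)) * (a * (i + 1)) + a * d =
          (i + d + 1) * (a * (1 + (i + 1) * (d * e))) := by ring
      exact dvd_of_dvd_add (Dvd.intro _ rfl) (h2 ▸ h1)
  have h3 : (1 + (j + 1) * (d * e)) ∣ (a * d) * ((j + 1) * e) := key.mul_right _
  have h4 : (a * d) * ((j + 1) * e) + a = (1 + (j + 1) * (d * e)) * a := by ring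
  exact dvd_of_dvd_add h3 (h4 ▸ Dvd.intro _ rfl)

variable {S : Set (Set N)} [hS : Fact (ModelsRCA0 S)]
variable {A B C V : Type u} [Coded S A] [Coded S B] [Coded S C] [Coded S V]

instance InS.finMem {f : A → N} {s : A → FinCode N} [FunS S f] [FunS S s] :
    InS S fun a => FinCode.Mem (f a) (s a) := by
  unfold FinCode.Mem
  infer_instance

theorem FinCode.mem_iff_dvd {x : N} {s : FinCode N} :
    FinCode.Mem x s ↔ x ≤ s.2.2 ∧ (1 + (x + 1) * s.2.1) ∣ s.1 := by
  refine and_congr_right fun _ => ⟨fun ⟨z, _, h⟩ => ⟨z, h⟩, fun ⟨z, h⟩ => ⟨z, ?_, h⟩⟩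
  rw [h, add_mul, one_mul]
  exact le_self_add

/-- A substitute for the factorial of `b`: with such an `m` the factors `1 + (x + 1)m`, for `x ≤ b`,
are pairwise coprime. The bound on `e` keeps the claim `Σ⁰₁`. -/
theorem exists_common_multiple (S : Set (Set N)) [hS : Fact (ModelsRCA0 S)] (b : N) :
    ∃ m : N, m ≠ 0 ∧ ∀ d, d ≤ b → d ≠ 0 → ∃ e, e ≤ m ∧ m = d * e := by
  refine sigma_induction (S := S) (B := N)
    (fun p => p.2 ≠ 0 ∧ ∀ d, d ≤ p.1 → d ≠ 0 → ∃ e, e ≤ p.2 ∧ p.2 = d * e) inferInstance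
    (fun x => Iff.rfl) ?_ ?_ b
  · exact ⟨1, one_ne_zero, fun d hd h => absurd (le_antisymm hd zero_le) h⟩
  · rintro x ⟨m, hm0, hm⟩
    have hx : (x + 1 : N) ≠ 0 := by simp
    refine ⟨m * (x + 1), mul_ne_zero hm0 hx, fun d hd h => ?_⟩
    rcases (le_succ_iff hS.out).1 hd with hd | rfl
    · obtain ⟨e, he, rfl⟩ := hm d hd h
      exact ⟨e * (x + 1), mul_le_mul_left he _, mul_assoc _ _ _⟩
    · exact ⟨m, le_mul_of_one_le_right zero_le le_add_self, mul_comm _ _⟩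

/-- The code `a` is the product of the factors of the members, accumulated by `Σ⁰₁` induction over
initial segments; by coprimality no other factor divides it. -/
theorem exists_finCode {P : N → Prop} (hP : InS S P) (b : N) :
    ∃ s : FinCode N, s.2.2 = b ∧ ∀ x, FinCode.Mem x s ↔ x ≤ b ∧ P x := by
  obtain ⟨m, hm0, hm⟩ := exists_common_multiple S b
  have key : ∀ k, ∃ a, ∀ x, x ≤ b → (FinCode.Mem x (a, m, b) ↔ x < k ∧ P x) := by
    intro k
    refine sigma_induction (S := S) (B := N)
      (fun p => ∀ x, x ≤ b → (FinCode.Mem x (p.2, m, b) ↔ x < p.1 ∧ P x)) inferInstance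
      (fun x => Iff.rfl) ?_ ?_ k
    -- The empty product codes the empty set, because every factor exceeds `1` when `m ≠ 0`.
    · refine ⟨1, fun x hx => ⟨fun h => ?_, fun h => absurd h.1 (not_lt.2 zero_le)⟩⟩
      obtain ⟨z, hz⟩ := (FinCode.mem_iff_dvd.1 h).2
      have hz1 : (1 : N) = z + (x + 1) * m * z := by
        rw [← one_mul z, ← mul_assoc, mul_one, ← add_mul]
        exact hz
      have hz0 : z ≠ 0 := by
        rintro rfl
        simp at hz1
      have h1 : 1 ≤ z := hS.out.discrete _ (pos_iff_ne_zero.2 hz0)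
      have h2 : 0 < (x + 1) * m * z :=
        pos_iff_ne_zero.2 (mul_ne_zero (mul_ne_zero (by simp) hm0) hz0)
      have : (1 : N) < z + (x + 1) * m * z := lt_of_le_of_lt h1 (lt_add_of_pos_right _ h2)
      exact absurd hz1 this.ne
    · rintro k ⟨a, ha⟩
      by_cases hk : k ≤ b ∧ P k
      · refine ⟨a * (1 + (k + 1) * m), fun x hx => ?_⟩
        rw [FinCode.mem_iff_dvd]
        rcases eq_or_ne x k with rfl | hxk
        · exact ⟨fun _ => ⟨lt_add_one _, hk.2⟩, fun _ => ⟨hx, Dvd.intro_left _ rfl⟩⟩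
        · have h1 : x < k + 1 ↔ x < k := by
            rw [lt_succ_iff hS.out, le_iff_lt_or_eq]
            simp [hxk]
          have h2 : (1 + (x + 1) * m) ∣ a * (1 + (k + 1) * m) ↔ (1 + (x + 1) * m) ∣ a := by
            refine ⟨fun h => ?_, fun h => h.mul_right _⟩
            obtain ⟨d, hd⟩ : ∃ d, k = x + d ∨ x = k + d := by
              rcases le_total x k with h | h
              · exact (exists_add_of_le h).imp fun _ => .inl
              · exact (exists_add_of_le h).imp fun _ => .inr
            have hd0 : d ≠ 0 := by
              rintro rfl
              rcases hd with rfl | rfl <;> simp at hxk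
            have hdb : d ≤ b := by
              rcases hd with rfl | rfl
              · exact le_add_self.trans hk.1
              · exact le_add_self.trans hx
            obtain ⟨e, _, he⟩ := hm d hdb hd0
            exact dvd_of_dvd_mul_factor hd he h
          have h3 := ha x hx
          rw [FinCode.mem_iff_dvd] at h3
          simp only [h1, h2]
          exact h3
      · refine ⟨a, fun x hx => (ha x hx).trans ?_⟩
        refine and_congr_left fun hPx => ?_
        rw [lt_succ_iff hS.out, le_iff_lt_or_eq]
        refine ⟨.inl, ?_⟩
        rintro (h | rfl)
        · exact h
        · exact absurd ⟨hx, hPx⟩ hk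
  obtain ⟨a, ha⟩ := key (b + 1)
  refine ⟨(a, m, b), rfl, fun x => ⟨fun h => ?_, fun h => ?_⟩⟩
  · exact ⟨h.1, ((ha x h.1).1 h).2⟩
  · exact (ha x h.1).2 ⟨(lt_succ_iff hS.out).2 h.1, h.2⟩

/-- Bounded comprehension, uniformly in a parameter. -/
theorem exists_finCode_fun {P : A × N → Prop} (hP : InS S P) (t : A → N) [FunS S t] :
    ∃ f : A → FinCode N, FunS S f ∧ ∀ a x, FinCode.Mem x (f a) ↔ x ≤ t a ∧ P (a, x) := by
  obtain ⟨f, hf, h⟩ := exists_selector (S := S) (A := A) (B := FinCode N)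
    (R := fun p => p.2.2.2 = t p.1 ∧ ∀ x, x ≤ t p.1 → (FinCode.Mem x p.2 ↔ P (p.1, x)))
    inferInstance fun a => by
      obtain ⟨s, h1, h2⟩ := exists_finCode (S := S) (P := fun x => P (a, x)) inferInstance (t a)
      exact ⟨s, h1, fun x hx => (h2 x).trans (and_iff_right hx)⟩
  refine ⟨f, hf, fun a x => ⟨fun hx => ?_, fun hx => ((h a).2 x hx.1).2 hx.2⟩⟩
  have : x ≤ t a := (h a).1 ▸ hx.1
  exact ⟨this, ((h a).2 x this).1 hx⟩

end FiniteSets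

end SOA

namespace SOA


/-! ### Primitive recursion -/

section Recursion

variable {N : Type u} [CommSemiring N] [LinearOrder N] [IsStrictOrderedRing N]
  [CanonicallyOrderedAdd N]
variable {S : Set (Set N)} [hS : Fact (ModelsRCA0 S)]
variable {A B C V : Type u} [Coded S A] [Coded S B] [Coded S C] [Coded S V]

variable (S) in
/-- `H` codes a partial history of the recursion with start `b₀` and step `h`. -/
def IsHistory (b₀ : B) (h : N → B → B) (H : FinCode N) : Prop :=
  ∀ p : N × B, Coded.enc S p ≤ H.2.2 → FinCode.Mem (Coded.enc S p) H →
    (p.1 = 0 ∧ p.2 = b₀) ∨ ∃ q : N × B, Coded.enc S q ≤ H.2.2 ∧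
      FinCode.Mem (Coded.enc S q) H ∧ p.1 = q.1 + 1 ∧ p.2 = h q.1 q.2

theorem IsHistory.unique {b₀ : B} {h : N → B → B} {H H' : FinCode N} (hH : IsHistory S b₀ h H)
    (hH' : IsHistory S b₀ h H') {n : N} : ∀ b b' : B, FinCode.Mem (Coded.enc S (n, b)) H →
    FinCode.Mem (Coded.enc S (n, b')) H' → b = b' := by
  have key : ∀ n : N, ∀ b : B, Coded.enc S b ≤ H.2.2 → ∀ b' : B, Coded.enc S b' ≤ H'.2.2 →
      FinCode.Mem (Coded.enc S (n, b)) H → FinCode.Mem (Coded.enc S (n, b')) H' → b = b' := by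
    intro n
    refine InS.induction (S := S) (P := fun n => ∀ b : B, Coded.enc S b ≤ H.2.2 → ∀ b' : B,
      Coded.enc S b' ≤ H'.2.2 →
      FinCode.Mem (Coded.enc S (n, b)) H → FinCode.Mem (Coded.enc S (n, b')) H' → b = b')
      inferInstance ?_ ?_ n
    · intro b _ b' _ hb hb'
      rcases hH _ hb.1 hb with ⟨_, h1⟩ | ⟨q, _, _, h1, _⟩
      · rcases hH' _ hb'.1 hb' with ⟨_, h2⟩ | ⟨q, _, _, h2, _⟩
        · exact h1.trans h2.symm
        · exact absurd h2.symm (by simp)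
      · exact absurd h1.symm (by simp)
    · intro n ih b _ b' _ hb hb'
      rcases hH _ hb.1 hb with ⟨h1, _⟩ | ⟨⟨k, d⟩, _, h2, h1, h3⟩
      · exact absurd h1 (by simp)
      · rcases hH' _ hb'.1 hb' with ⟨h1, _⟩ | ⟨⟨k', d'⟩, _, h2', h1', h3'⟩
        · exact absurd h1 (by simp)
        · obtain rfl : n = k := add_right_cancel h1
          obtain rfl : n = k' := add_right_cancel h1'
          obtain rfl := ih d ((right_le_pair hS.out _ _).trans h2.1) d'
            ((right_le_pair hS.out _ _).trans h2'.1) h2 h2'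
          exact h3.trans h3'.symm
  intro b b' hb hb'
  exact key n b ((right_le_pair hS.out _ _).trans hb.1) b'
    ((right_le_pair hS.out _ _).trans hb'.1) hb hb'

/-- Primitive recursion with a parameter. -/
theorem exists_recursion {g : A → B} {h : A × N × B → B} (hg : FunS S g) (hh : FunS S h) :
    ∃ f : A × N → B, FunS S f ∧ (∀ a, f (a, 0) = g a) ∧
      ∀ a n, f (a, n + 1) = h (a, n, f (a, n)) := by
  have hist_inS : InS S fun p : ((A × N) × B) × FinCode N =>
      IsHistory S (g p.1.1.1) (fun k b => h (p.1.1.1, k, b)) p.2 ∧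
        FinCode.Mem (Coded.enc S (p.1.1.2, p.1.2)) p.2 := by
    unfold IsHistory
    infer_instance
  -- That some history reaches `n` is a `Σ⁰₁` statement, the history being a finite code, and it is
  -- proved by induction on `n`.
  have ex : ∀ (a : A) (n : N), ∃ q : B × FinCode N, IsHistory S (g a) (fun k b => h (a, k, b)) q.2 ∧
      FinCode.Mem (Coded.enc S (n, q.1)) q.2 := by
    intro a n
    have hist_inS' : InS S fun p : N × (B × FinCode N) =>
        IsHistory S (g a) (fun k b => h (a, k, b)) p.2.2 ∧
          FinCode.Mem (Coded.enc S (p.1, p.2.1)) p.2.2 :=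
      hist_inS.comp (f := fun p : N × (B × FinCode N) => (((a, p.1), p.2.1), p.2.2)) inferInstance
    refine sigma_induction (S := S) _ hist_inS' (fun x => Iff.rfl) ?_ ?_ n
    · obtain ⟨s, hs, h1⟩ := exists_finCode (S := S) (P := fun x => x = Coded.enc S ((0 : N), g a))
        inferInstance (Coded.enc S ((0 : N), g a))
      refine ⟨(g a, s), fun p _ hp => ?_, (h1 _).2 ⟨le_rfl, rfl⟩⟩
      obtain rfl := Coded.enc_inj ((h1 _).1 hp).2
      exact .inl ⟨rfl, rfl⟩
    · rintro n ⟨⟨b, H⟩, hH, hb⟩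
      let x := Coded.enc S (n + 1, h (a, n, b))
      obtain ⟨s, hs, h1⟩ := exists_finCode (S := S) (P := fun z => FinCode.Mem z H ∨ z = x)
        inferInstance (max H.2.2 x)
      have hsub : ∀ z, FinCode.Mem z H → FinCode.Mem z s := fun z hz =>
        (h1 z).2 ⟨hz.1.trans (le_max_left _ _), .inl hz⟩
      refine ⟨(h (a, n, b), s), fun p _ hp => ?_, (h1 _).2 ⟨le_max_right _ _, .inr rfl⟩⟩
      rcases ((h1 _).1 hp).2 with hp | hp
      · refine (hH p hp.1 hp).imp id ?_
        rintro ⟨q, hq, hq', h2⟩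
        exact ⟨q, (hsub _ hq').1, hsub _ hq', h2⟩
      · obtain rfl := Coded.enc_inj hp
        exact .inr ⟨(n, b), (hsub _ hb).1, hsub _ hb, rfl, rfl⟩
  choose f hf using fun p : A × N => ex p.1 p.2
  have uniq : ∀ a n b H, IsHistory S (g a) (fun k b => h (a, k, b)) H →
      FinCode.Mem (Coded.enc S (n, b)) H → (f (a, n)).1 = b := fun a n b H h1 h2 =>
    IsHistory.unique (hf (a, n)).1 h1 _ _ (hf (a, n)).2 h2
  -- Any history reaching `n` computes the same value, so the graph is `Σ⁰₁` with the history as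
  -- witness.
  refine ⟨fun p => (f p).1, FunS.of_sigma (C := FinCode N) _ (hR := hist_inS) fun p b => ⟨?_, ?_⟩,
    fun a => ?_, fun a n => ?_⟩
  · rintro rfl
    exact ⟨(f p).2, hf p⟩
  · rintro ⟨H, h1, h2⟩
    exact uniq _ _ _ _ h1 h2
  · rcases (hf (a, 0)).1 _ (hf (a, 0)).2.1 (hf (a, 0)).2 with ⟨_, h1⟩ | ⟨q, _, _, h1, _⟩
    · exact h1
    · exact absurd h1.symm (by simp)
  · rcases (hf (a, n + 1)).1 _ (hf (a, n + 1)).2.1 (hf (a, n + 1)).2 with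
      ⟨h1, _⟩ | ⟨⟨k, b⟩, _, h2, h1, h3⟩
    · exact absurd h1 (by simp)
    · obtain rfl : n = k := add_right_cancel h1
      have := uniq a n b _ (hf (a, n + 1)).1 h2
      change (f (a, n + 1)).1 = h (a, n, (f (a, n)).1)
      rw [this]
      exact h3

end Recursion

/-! ### The pigeonhole principle inside the structure -/

section Pigeonhole

variable {N : Type u} [CommSemiring N] [LinearOrder N] [IsStrictOrderedRing N]
  [CanonicallyOrderedAdd N]
variable {S : Set (Set N)} [hS : Fact (ModelsRCA0 S)]

/-- Descent on the size: an injection of the numbers up to `m + 1` into those up to `m` loses the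
argument `m + 1` and the value `m`, and whatever was sent to `m` now receives the value of `m + 1`.
Stated as existence of a coded injection after `k` removals, the claim is `Σ⁰₁`. -/
theorem pigeonhole {R : N × N → Prop} (hR : InS S R) (n : N)
    (htot : ∀ i, i ≤ n → ∃ j, j < n ∧ R (i, j))
    (hinj : ∀ i i' j, i ≤ n → i' ≤ n → j < n → R (i, j) → R (i', j) → i = i') : False := by
  have swap : ∀ (m : N) (H : FinCode N), InS S fun z : N => ∃ i, i ≤ m ∧ ∃ j, j ≤ m ∧
      (z = pair i j ∧ ((FinCode.Mem (pair i j) H ∧ j ≠ m) ∨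
        (FinCode.Mem (pair i m) H ∧ FinCode.Mem (pair (m + 1) j) H))) :=
    fun m H => inferInstance
  let F : N → FinCode N → Prop := fun m H =>
    (∀ i, i ≤ m → ∃ j, j ≤ m ∧ (j < m ∧ FinCode.Mem (pair i j) H)) ∧
    ∀ i, i ≤ m → ∀ i', i' ≤ m → ∀ j, j ≤ m → j < m → FinCode.Mem (pair i j) H →
      FinCode.Mem (pair i' j) H → i = i'
  have key : ∀ k, k ≤ n → ∃ p : N × FinCode N, p.1 + k = n ∧ F p.1 p.2 := by
    intro k
    refine sigma_induction (S := S) (B := N × FinCode N)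
      (P := fun k => k ≤ n → ∃ p : N × FinCode N, p.1 + k = n ∧ F p.1 p.2)
      (fun p => p.1 ≤ n → p.2.1 + p.1 = n ∧ F p.2.1 p.2.2) ?_ ?_ ?_ ?_ k
    · simp only [F]
      infer_instance
    · intro x
      refine ⟨fun h => ?_, fun ⟨p, hp⟩ hx => ⟨p, hp hx⟩⟩
      by_cases hx : x ≤ n
      · obtain ⟨p, hp⟩ := h hx
        exact ⟨p, fun _ => hp⟩
      -- A dummy witness, which lets the premise `k ≤ n` move inside the existential quantifier.
      · exact ⟨(0, 0, 0, 0), fun h => absurd h hx⟩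
    · intro _
      obtain ⟨s, _, hs⟩ := exists_finCode (S := S)
        (P := fun z => ∃ i, i ≤ n ∧ ∃ j, j ≤ n ∧ (z = pair i j ∧ R (i, j))) inferInstance (pair n n)
      have hs' : ∀ i j, i ≤ n → j ≤ n → (FinCode.Mem (pair i j) s ↔ R (i, j)) := by
        intro i j hi hj
        rw [hs]
        refine ⟨?_, fun h => ⟨pair_mono hi hj, i, hi, j, hj, rfl, h⟩⟩
        rintro ⟨_, i', _, j', _, h1, h2⟩
        obtain ⟨rfl, rfl⟩ := pair_inj hS.out h1
        exact h2
      refine ⟨(n, s), add_zero _, fun i hi => ?_, fun i hi i' hi' j hj hj' h1 h2 => ?_⟩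
      · obtain ⟨j, hj, h⟩ := htot i hi
        exact ⟨j, hj.le, hj, (hs' i j hi hj.le).2 h⟩
      · exact hinj i i' j hi hi' hj' ((hs' _ _ hi hj).1 h1) ((hs' _ _ hi' hj).1 h2)
    · intro k ih hk
      obtain ⟨⟨m', H⟩, h1, htot, hinj⟩ := ih (le_self_add.trans hk)
      simp only at h1 htot hinj
      rcases eq_zero_or_succ hS.out m' with rfl | ⟨m, rfl⟩
      · obtain rfl : k = n := by simpa using h1
        exact absurd hk (not_le.2 (lt_add_one _))
      obtain ⟨s, _, hs⟩ := exists_finCode (S := S)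
        (swap m H) (pair m m)
      have hs' : ∀ i j, i ≤ m → j ≤ m → (FinCode.Mem (pair i j) s ↔
          ((FinCode.Mem (pair i j) H ∧ j ≠ m) ∨
          (FinCode.Mem (pair i m) H ∧ FinCode.Mem (pair (m + 1) j) H))) := by
        intro i j hi hj
        rw [hs]
        refine ⟨?_, fun h => ⟨pair_mono hi hj, i, hi, j, hj, rfl, h⟩⟩
        rintro ⟨_, i', _, j', _, h1, h2⟩
        obtain ⟨rfl, rfl⟩ := pair_inj hS.out h1
        exact h2
      have hm : m ≤ m + 1 := le_self_add
      have hlt : ∀ {j : N}, j < m + 1 ↔ j ≤ m := lt_succ_iff hS.out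
      refine ⟨(m, s), by rw [← h1]; ring, fun i hi => ?_, fun i hi i' hi' j hj hj' h2 h3 => ?_⟩
      · obtain ⟨j, _, hj, h2⟩ := htot i (hi.trans hm)
        rcases eq_or_ne j m with rfl | hjm
        · obtain ⟨j', _, hj', h3⟩ := htot (j + 1) le_rfl
          have : j' ≠ j := by
            rintro rfl
            have := hinj i (hi.trans hm) _ le_rfl j' hm hj h2 h3
            exact absurd (this ▸ hi) (not_le.2 (lt_add_one _))
          exact ⟨j', hlt.1 hj', lt_of_le_of_ne (hlt.1 hj') this,
            (hs' _ _ hi (hlt.1 hj')).2 (.inr ⟨h2, h3⟩)⟩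
        · exact ⟨j, hlt.1 hj, lt_of_le_of_ne (hlt.1 hj) hjm,
            (hs' _ _ hi (hlt.1 hj)).2 (.inl ⟨h2, hjm⟩)⟩
      · have aux : ∀ i, i ≤ m → FinCode.Mem (pair i j) H → ¬ FinCode.Mem (pair (m + 1) j) H := by
          intro i hi h4 h5
          have := hinj i (hi.trans hm) _ le_rfl j (hj.trans hm) (hlt.2 hj) h4 h5
          exact absurd (this ▸ hi) (not_le.2 (lt_add_one _))
        rcases (hs' _ _ hi hj).1 h2 with ⟨h4, _⟩ | ⟨h4, h5⟩
        · rcases (hs' _ _ hi' hj).1 h3 with ⟨h6, _⟩ | ⟨h6, h7⟩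
          · exact hinj i (hi.trans hm) i' (hi'.trans hm) j (hj.trans hm) (hlt.2 hj) h4 h6
          · exact absurd h7 (aux i hi h4)
        · rcases (hs' _ _ hi' hj).1 h3 with ⟨h6, _⟩ | ⟨h6, h7⟩
          · exact absurd h5 (aux i' hi' h6)
          · exact hinj i (hi.trans hm) i' (hi'.trans hm) m hm (lt_add_one _) h4 h6
  obtain ⟨⟨m, H⟩, h1, h2, h3⟩ := key n le_rfl
  obtain rfl : m = 0 := by simpa using h1
  obtain ⟨j, _, hj, _⟩ := h2 0 le_rfl
  exact absurd hj (not_lt.2 zero_le)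

end Pigeonhole

/-! ### `Σ⁰₂` induction and strong collection -/

section SigmaTwo

variable {N : Type u} [CommSemiring N] [LinearOrder N] [IsStrictOrderedRing N]
  [CanonicallyOrderedAdd N]
variable {S : Set (Set N)} [hS : Fact (ModelsRCA0 S)]
variable {A B C V : Type u} [Coded S A] [Coded S B] [Coded S C] [Coded S V]

theorem sigmaTwo_induction (hI : ModelsSigma02Ind S) {P : N → Prop} (R : N × B × C → Prop)
    (hR : InS S R) (hP : ∀ x, P x ↔ ∃ b, ∀ d, R (x, b, d)) (h0 : P 0)
    (hs : ∀ x, P x → P (x + 1)) (x : N) : P x := by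
  have key : ∀ x, P x ↔ (Formula.ex (.all (.and (.mem (.var 1) 1)
      (.or (.neg (.mem (.var 0) 2)) (.mem (Term.pr (.var 2) (Term.pr (.var 1) (.var 0))) 0))))).Realize
      (params (codeSet S R) (Set.range (Coded.enc S (A := B))) (Set.range (Coded.enc S (A := C))))
        (cons x fun _ => 0) := by
    intro x
    rw [hP]
    constructor
    · rintro ⟨b, hb⟩
      refine ⟨Coded.enc S b, fun z => ⟨⟨b, rfl⟩, ?_⟩⟩
      by_cases hz : z ∈ Set.range (Coded.enc S (A := C))
      · obtain ⟨d, rfl⟩ := hz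
        exact .inr ⟨(x, b, d), rfl, hb d⟩
      · exact .inl hz
    · rintro ⟨y, hy⟩
      obtain ⟨b, rfl⟩ := (hy 0).1
      refine ⟨b, fun d => ?_⟩
      rcases (hy (Coded.enc S d)).2 with h | ⟨⟨a', b', d'⟩, h1, h2⟩
      · exact absurd ⟨d, rfl⟩ h
      · obtain ⟨h3, h4⟩ := pair_inj hS.out h1
        obtain ⟨h5, h6⟩ := pair_inj hS.out h4
        obtain rfl : x = a' := h3
        obtain rfl := Coded.enc_inj h5
        obtain rfl := Coded.enc_inj h6
        exact h2
  rw [key]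
  exact hI _ (.ex (.pi (.all (.delta (by repeat constructor))))) _ _
    (params_mem hR.mem Coded.range_mem Coded.range_mem) ((key 0).1 h0)
    (fun x h => (key _).1 (hs x ((key x).2 h))) x

/-- Strong collection. -/
theorem exists_uniform_bound (hI : ModelsSigma02Ind S) {R : N × N → Prop} (hR : InS S R) (b : N) :
    ∃ u, ∀ i, i ≤ b → ∀ n, R (i, n) → ∃ n', n' ≤ u ∧ R (i, n') := by
  -- The unbounded `n` is placed in front of the bounded `i`, which brings the claim into the form
  -- `∃ ∀` over a predicate of the second-order part.
  have := sigmaTwo_induction (S := S) hI (B := N) (C := N)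
    (P := fun b => ∃ u, ∀ n, ∀ i, i ≤ b → R (i, n) → ∃ n', n' ≤ u ∧ R (i, n'))
    (fun p => ∀ i, i ≤ p.1 → R (i, p.2.2) → ∃ n', n' ≤ p.2.1 ∧ R (i, n')) inferInstance
    (fun x => Iff.rfl) ?_ ?_ b
  · obtain ⟨u, hu⟩ := this
    exact ⟨u, fun i hi n h => hu n i hi h⟩
  · by_cases h : ∃ n, R (0, n)
    · obtain ⟨n, hn⟩ := h
      refine ⟨n, fun _ i hi _ => ?_⟩
      obtain rfl : i = 0 := le_antisymm hi zero_le
      exact ⟨n, le_rfl, hn⟩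
    · refine ⟨0, fun n i hi hn => ?_⟩
      obtain rfl : i = 0 := le_antisymm hi zero_le
      exact absurd ⟨n, hn⟩ h
  · rintro b ⟨u, hu⟩
    by_cases h : ∃ n, R (b + 1, n)
    · obtain ⟨n, hn⟩ := h
      refine ⟨max u n, fun k i hi hk => ?_⟩
      rcases (le_succ_iff hS.out).1 hi with hi | rfl
      · obtain ⟨n', h1, h2⟩ := hu k i hi hk
        exact ⟨n', h1.trans (le_max_left _ _), h2⟩
      · exact ⟨n, le_max_right _ _, hn⟩
    · refine ⟨u, fun k i hi hk => ?_⟩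
      rcases (le_succ_iff hS.out).1 hi with hi | rfl
      · exact hu k i hi hk
      · exact absurd ⟨k, hk⟩ h

end SigmaTwo

/-! ### Translation between the coded relations and `InS` -/

section Bridge

variable {N : Type u} [CommSemiring N] [LinearOrder N] [IsStrictOrderedRing N]
  [CanonicallyOrderedAdd N]
variable {S : Set (Set N)} [hS : Fact (ModelsRCA0 S)]
variable {A : Type u} [Coded S A]

theorem inS_of_mem {X : Set N} (hX : X ∈ S) : InS S fun x : N => x ∈ X where
  mem := by
    convert hX
    ext z
    exact ⟨fun ⟨a, h, h'⟩ => h ▸ h', fun h => ⟨z, rfl, h⟩⟩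

theorem isRel₂_iff {R : N → N → Prop} : IsRel₂ S R ↔ InS S fun p : N × N => R p.1 p.2 := by
  have : {z | ∃ x y, z = pair x y ∧ R x y} = codeSet S fun p : N × N => R p.1 p.2 := by
    ext z
    exact ⟨fun ⟨x, y, h⟩ => ⟨(x, y), h⟩, fun ⟨p, h⟩ => ⟨p.1, p.2, h⟩⟩
  unfold IsRel₂
  rw [this]
  exact ⟨fun h => ⟨h⟩, fun h => h.mem⟩

theorem isRel₃_iff {R : N → N → N → Prop} :
    IsRel₃ S R ↔ InS S fun p : N × N × N => R p.1 p.2.1 p.2.2 := by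
  have : {z | ∃ x y w, z = pair x (pair y w) ∧ R x y w} =
      codeSet S fun p : N × N × N => R p.1 p.2.1 p.2.2 := by
    ext z
    exact ⟨fun ⟨x, y, w, h⟩ => ⟨(x, y, w), h⟩, fun ⟨p, h⟩ => ⟨p.1, p.2.1, p.2.2, h⟩⟩
  unfold IsRel₃
  rw [this]
  exact ⟨fun h => ⟨h⟩, fun h => h.mem⟩

theorem isFun₁_iff {f : N → N} : IsFun₁ S f ↔ FunS S f :=
  isRel₂_iff.trans ⟨fun h => ⟨h⟩, fun h => h.graph⟩

theorem IsRel₂.inS {R : N → N → Prop} (h : IsRel₂ S R) (f g : A → N) [FunS S f] [FunS S g] :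
    InS S fun a => R (f a) (g a) :=
  (isRel₂_iff.1 h).comp (f := fun a => (f a, g a)) inferInstance

end Bridge

end SOA

namespace QDag

open SOA

/-! ### Definable families of bounded trees -/

section Trees

variable {N : Type u} [CommSemiring N] [LinearOrder N] [IsStrictOrderedRing N]
  [CanonicallyOrderedAdd N]
variable {S : Set (Set N)} [hS : Fact (ModelsRCA0 S)]
variable {A B V : Type u} [Coded S A] [Coded S B] [Coded S V]

variable (S) in
/-- A family of finite trees that belongs to the second-order part. -/
class TreeFam (T : A → LTree N V) : Prop where
  node_inS : InS S fun p : A × V => (T p.1).node p.2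
  anc_inS : InS S fun p : A × V × V => (T p.1).anc p.2.1 p.2.2
  bdd : ∃ b : N, ∀ a v, (T a).node v → Coded.enc S v ≤ b
  anc_node : ∀ a v w, (T a).anc v w → (T a).node v ∧ (T a).node w

variable (S) in
/-- A finite tree of the second-order part. -/
structure FinTree (T : LTree N V) : Prop where
  fam : TreeFam S fun _ : N => T
  irrefl : ∀ v, ¬ T.anc v v
  trans : ∀ {u v w}, T.anc u v → T.anc v w → T.anc u w
  linear : ∀ {u v w}, T.anc u w → T.anc v w → u = v ∨ T.anc u v ∨ T.anc v u

instance (priority := low) TreeFam.subst {T : A → LTree N V} {f : B → A} [hT : TreeFam S T]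
    [hf : FunS S f] : TreeFam S fun b => T (f b) where
  node_inS := hT.node_inS.comp (f := fun p : B × V => (f p.1, p.2)) inferInstance
  anc_inS := hT.anc_inS.comp (f := fun p : B × V × V => (f p.1, p.2)) inferInstance
  bdd := hT.bdd.imp fun _ h b => h (f b)
  anc_node b := hT.anc_node (f b)

section Family

variable {T : A → LTree N V} [hT : TreeFam S T] {v w : A → V} [hv : FunS S v] [hw : FunS S w]

instance InS.node : InS S fun a => (T a).node (v a) :=
  hT.node_inS.comp (f := fun a => (a, v a)) inferInstance

instance InS.anc : InS S fun a => (T a).anc (v a) (w a) :=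
  hT.anc_inS.comp (f := fun a => (a, v a, w a)) inferInstance

/-- One bound serves the nodes of the whole family, so a quantifier over nodes is a bounded one. -/
theorem InS.exists_node {P : A → V → Prop} (hP : InS S fun p : A × V => P p.1 p.2) :
    InS S fun a => ∃ x, (T a).node x ∧ P a x := by
  obtain ⟨b, hb⟩ := hT.bdd
  exact InS.exists_of_bdd (fun _ => b) inferInstance fun a x h => hb a x h.1

theorem InS.forall_node {P : A → V → Prop} (hP : InS S fun p : A × V => P p.1 p.2) :
    InS S fun a => ∀ x, (T a).node x → P a x := by
  have := InS.exists_node (S := S) (T := T) (P := fun a x => ¬ P a x) inferInstance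
  exact InS.congr (P := fun a => ¬ ∃ x, (T a).node x ∧ ¬ P a x) fun a => by
    simp only [not_exists, not_and, not_not]

instance InS.exists_node' {P : A → V → Prop} [hP : InS S fun p : A × V => P p.1 p.2] :
    InS S fun a => ∃ x, (T a).node x ∧ P a x := InS.exists_node hP

instance InS.forall_node' {P : A → V → Prop} [hP : InS S fun p : A × V => P p.1 p.2] :
    InS S fun a => ∀ x, (T a).node x → P a x := InS.forall_node hP

instance InS.leaf : InS S fun a => (T a).Leaf (v a) := by
  unfold LTree.Leaf
  infer_instance

instance InS.child : InS S fun a => (T a).Child (v a) (w a) := by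
  unfold LTree.Child
  infer_instance

instance InS.unary : InS S fun a => (T a).Unary (v a) :=
  InS.congr (P := fun a => ∃ x, (T a).node x ∧ ((T a).Child (v a) x ∧
    ∀ y, (T a).node y → (T a).Child (v a) y → y = x)) fun a => by
    constructor
    · rintro ⟨x, h, h'⟩
      exact ⟨x, h.2.1, h, fun y _ hy => h' y hy⟩
    · rintro ⟨x, _, h, h'⟩
      exact ⟨x, h, fun y hy => h' y hy.2.1 hy⟩

instance InS.kept : InS S fun a => (T a).Kept (v a) := by
  unfold LTree.Kept
  infer_instance

instance InS.onPath : InS S fun a => (T a).OnPath (v a) (w a) := by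
  unfold LTree.OnPath
  infer_instance

instance InS.firstOnPath : InS S fun a => (T a).FirstOnPath (v a) (w a) :=
  InS.congr (P := fun a => (T a).OnPath (v a) (w a) ∧
    ∀ y, (T a).node y → (T a).OnPath (v a) y → ¬ (T a).anc y (w a)) fun _ =>
    and_congr_right fun _ => ⟨fun h y _ hy => h y hy, fun h y hy => h y hy.2.1 hy⟩

end Family

/-- Induction on a bound for the codes: the element with the next code replaces the current minimum
if it lies below it, and transitivity keeps it minimal. This supplies topmost and lowest nodes in
trees that are finite only in the sense of the structure. -/
theorem exists_minimal {P : V → Prop} (hP : InS S P) {R : V → V → Prop}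
    (hR : InS S fun p : V × V => R p.1 p.2) (irrefl : ∀ v, ¬ R v v)
    (trans : ∀ {u v w}, R u v → R v w → R u w) {b : N} (hb : ∀ v, P v → Coded.enc S v ≤ b)
    (hne : ∃ v, P v) : ∃ v, P v ∧ ∀ w, P w → ¬ R w v := by
  have hR' : ∀ {A : Type u} [Coded S A] (f g : A → V) [FunS S f] [FunS S g],
      InS S fun a => R (f a) (g a) := fun f g _ _ => hR.comp (f := fun a => (f a, g a)) inferInstance
  have key : ∀ k : N, (∃ v, Coded.enc S v ≤ k ∧ P v) →
      ∃ v, Coded.enc S v ≤ k ∧ (P v ∧ ∀ w, Coded.enc S w ≤ k → P w → ¬ R w v) := by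
    intro k
    refine InS.induction (S := S) (P := fun k : N => (∃ v, Coded.enc S v ≤ k ∧ P v) →
      ∃ v, Coded.enc S v ≤ k ∧ (P v ∧ ∀ w, Coded.enc S w ≤ k → P w → ¬ R w v))
      inferInstance ?_ ?_ k
    · rintro ⟨v, hv, hPv⟩
      refine ⟨v, hv, hPv, fun w hw _ => ?_⟩
      have : w = v := Coded.enc_inj
        ((le_antisymm hw zero_le).trans (le_antisymm hv zero_le).symm)
      exact this ▸ irrefl w
    · rintro k ih ⟨v, hv, hPv⟩
      by_cases hk : ∃ v, Coded.enc S v ≤ k ∧ P v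
      · obtain ⟨v, hv, hPv, hmin⟩ := ih hk
        by_cases hw : ∃ w, Coded.enc S w = k + 1 ∧ P w ∧ R w v
        · obtain ⟨w, hw, hPw, hRw⟩ := hw
          refine ⟨w, hw.le, hPw, fun x hx hPx hRx => ?_⟩
          rcases (le_succ_iff hS.out).1 hx with hx | hx
          · exact hmin x hx hPx (trans hRx hRw)
          · exact irrefl w (by rwa [Coded.enc_inj (hx.trans hw.symm)] at hRx)
        · refine ⟨v, hv.trans le_self_add, hPv, fun x hx hPx hRx => ?_⟩
          rcases (le_succ_iff hS.out).1 hx with hx | hx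
          · exact hmin x hx hPx hRx
          · exact hw ⟨x, hx, hPx, hRx⟩
      · refine ⟨v, hv, hPv, fun x hx hPx hRx => ?_⟩
        have aux : ∀ y, Coded.enc S y ≤ k + 1 → P y → Coded.enc S y = k + 1 := fun y hy hPy =>
          ((le_succ_iff hS.out).1 hy).resolve_left fun h => hk ⟨y, h, hPy⟩
        exact irrefl v (by rwa [Coded.enc_inj ((aux x hx hPx).trans (aux v hv hPv).symm)] at hRx)
  obtain ⟨v, hv⟩ := hne
  obtain ⟨w, _, hPw, hmin⟩ := key b ⟨v, hb v hv, hv⟩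
  exact ⟨w, hPw, fun x hx => hmin x (hb x hx) hx⟩

end Trees

end QDag

namespace QDag.LTree

/-- `v` is `w` or an ancestor of `w`. -/
def Le {N V : Type*} (T : LTree N V) (v w : V) : Prop := v = w ∨ T.anc v w

theorem OnPath.le {N V : Type*} {T : LTree N V} {v x : V} (h : T.OnPath v x) : T.Le x v :=
  h.2.2.imp id fun h => h.1

theorem Kept.onPath {N V : Type*} {T : LTree N V} {v : V} (h : T.Kept v) : T.OnPath v v :=
  ⟨h, h.1, .inl rfl⟩

theorem OnPath.eq_of_kept {N V : Type*} {T : LTree N V} {v x : V} (h : T.OnPath v x)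
    (hx : T.Kept x) : x = v :=
  h.2.2.resolve_right fun h => hx.2 h.2.1

end QDag.LTree

namespace QDag

open SOA

/-! ### Finite trees and the paths collapsed by eliminating unary nodes -/

section FinTrees

variable {N : Type u} [CommSemiring N] [LinearOrder N] [IsStrictOrderedRing N]
  [CanonicallyOrderedAdd N]
variable {S : Set (Set N)} [hS : Fact (ModelsRCA0 S)]
variable {A V : Type u} [Coded S A] [Coded S V] {T : LTree N V}

instance InS.treeLe {T : A → LTree N V} [hT : TreeFam S T] {v w : A → V} [hv : FunS S v]
    [hw : FunS S w] : InS S fun a => (T a).Le (v a) (w a) := by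
  unfold LTree.Le
  infer_instance

namespace FinTree

theorem famAt (h : FinTree S T) : TreeFam S fun _ : A => T :=
  TreeFam.subst (hT := h.fam) (f := fun _ : A => (0 : N))

theorem node_left (h : FinTree S T) {v w : V} (hvw : T.anc v w) : T.node v :=
  (h.fam.anc_node 0 v w hvw).1

theorem node_right (h : FinTree S T) {v w : V} (hvw : T.anc v w) : T.node w :=
  (h.fam.anc_node 0 v w hvw).2

theorem le_trans (h : FinTree S T) {u v w : V} (h1 : T.Le u v) (h2 : T.Le v w) : T.Le u w := by
  rcases h1 with rfl | h1
  · exact h2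
  · rcases h2 with rfl | h2
    · exact .inr h1
    · exact .inr (h.trans h1 h2)

theorem anc_of_anc_of_le (h : FinTree S T) {u v w : V} (h1 : T.anc u v) (h2 : T.Le v w) :
    T.anc u w := by
  rcases h2 with rfl | h2
  · exact h1
  · exact h.trans h1 h2

theorem anc_of_le_of_anc (h : FinTree S T) {u v w : V} (h1 : T.Le u v) (h2 : T.anc v w) :
    T.anc u w := by
  rcases h1 with rfl | h1
  · exact h2
  · exact h.trans h1 h2

theorem asymm (h : FinTree S T) {u v : V} (h1 : T.anc u v) (h2 : T.Le v u) : False :=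
  h.irrefl _ (h.anc_of_anc_of_le h1 h2)

theorem comparable (h : FinTree S T) {u v w : V} (h1 : T.Le u w) (h2 : T.Le v w) :
    T.Le u v ∨ T.anc v u := by
  rcases h1 with rfl | h1
  · rcases h2 with rfl | h2
    · exact .inl (.inl rfl)
    · exact .inr h2
  · rcases h2 with rfl | h2
    · exact .inl (.inr h1)
    · rcases h.linear h1 h2 with rfl | h3 | h3
      · exact .inl (.inl rfl)
      · exact .inl (.inr h3)
      · exact .inr h3

theorem exists_top (h : FinTree S T) {P : V → Prop} (hP : InS S P) (hn : ∀ v, P v → T.node v)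
    (hne : ∃ v, P v) : ∃ v, P v ∧ ∀ w, P w → ¬ T.anc w v := by
  obtain ⟨b, hb⟩ := h.fam.bdd
  have := h.famAt (A := V × V)
  exact exists_minimal hP (R := T.anc) inferInstance h.irrefl h.trans
    (fun v hv => hb 0 v (hn v hv)) hne

theorem exists_bottom (h : FinTree S T) {P : V → Prop} (hP : InS S P) (hn : ∀ v, P v → T.node v)
    (hne : ∃ v, P v) : ∃ v, P v ∧ ∀ w, P w → ¬ T.anc v w := by
  obtain ⟨b, hb⟩ := h.fam.bdd
  have := h.famAt (A := V × V)
  exact exists_minimal hP (R := fun v w => T.anc w v) inferInstance h.irrefl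
    (fun h1 h2 => h.trans h2 h1) (fun v hv => hb 0 v (hn v hv)) hne

theorem exists_child (h : FinTree S T) {x y : V} (hxy : T.anc x y) :
    ∃ w, T.Child x w ∧ T.Le w y := by
  have := h.famAt (A := V)
  obtain ⟨w, ⟨h1, h2⟩, hmin⟩ := h.exists_top (P := fun w => T.anc x w ∧ T.Le w y)
    (InS.and (hP := InS.anc (T := fun _ => T) (v := fun _ => x) (w := fun w => w)))
    (fun v hv => h.node_right hv.1) ⟨y, hxy, .inl rfl⟩
  exact ⟨w, ⟨h.node_left h1, h.node_right h1, h1, fun z _ hz =>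
    hmin z ⟨hz.1, h.le_trans (.inr hz.2) h2⟩ hz.2⟩, h2⟩

theorem child_unique (h : FinTree S T) {x y w w' : V} (h1 : T.Child x w) (h2 : T.Child x w')
    (h3 : T.Le w y) (h4 : T.Le w' y) : w = w' := by
  rcases h.comparable h3 h4 with (h5 | h5) | h5
  · exact h5
  · exact absurd ⟨h1.2.2.1, h5⟩ (h2.2.2.2 w h1.2.1)
  · exact absurd ⟨h2.2.2.1, h5⟩ (h1.2.2.2 w' h2.2.1)

theorem exists_leaf (h : FinTree S T) {x : V} (hx : T.node x) : ∃ l, T.Leaf l ∧ T.Le x l := by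
  have := h.famAt (A := V)
  obtain ⟨w, ⟨h1, h2⟩, hmax⟩ := h.exists_bottom (P := fun w => T.node w ∧ T.Le x w)
    (InS.and (hP := InS.node (T := fun _ => T) (v := fun w => w))
      (hP' := InS.treeLe (T := fun _ => T) (v := fun _ => x) (w := fun w => w)))
    (fun v hv => hv.1) ⟨x, hx, .inl rfl⟩
  exact ⟨w, ⟨h1, fun z hz hwz => hmax z ⟨hz, h.le_trans h2 (.inr hwz)⟩ hwz⟩, h2⟩

theorem kept_of_leaf {l : V} (hl : T.Leaf l) : T.Kept l :=
  ⟨hl.1, fun ⟨w, hw, _⟩ => hl.2 w hw.2.1 hw.2.2.1⟩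

/-- The path through `x` ends at the topmost kept node between `x` and `l`; the leaf itself is kept,
so there is one. -/
theorem exists_onPath_le (h : FinTree S T) {x l : V} (hx : T.node x) (hl : T.Leaf l)
    (hxl : T.Le x l) : ∃ v, T.OnPath v x ∧ T.Le v l := by
  have := h.famAt (A := V)
  obtain ⟨v, ⟨h1, h2, h3⟩, hmin⟩ := h.exists_top
    (P := fun y => T.Kept y ∧ T.Le x y ∧ T.Le y l)
    (InS.and (hP := InS.kept (T := fun _ => T) (v := fun w => w))
      (hP' := InS.and (hP := InS.treeLe (T := fun _ => T) (v := fun _ => x) (w := fun w => w))))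
    (fun v hv => hv.1.1) ⟨l, kept_of_leaf hl, hxl, .inl rfl⟩
  refine ⟨v, ⟨h1, hx, ?_⟩, h3⟩
  rcases h2 with rfl | h2
  · exact .inl rfl
  · refine .inr ⟨h2, ?_, fun y hy hxy hyv => ?_⟩
    · by_contra hu
      exact hmin x ⟨⟨hx, hu⟩, .inl rfl, hxl⟩ h2
    · by_contra hu
      exact hmin y ⟨⟨hy, hu⟩, .inr hxy, h.le_trans (.inr hyv) h3⟩ hyv

theorem exists_onPath (h : FinTree S T) {x : V} (hx : T.node x) : ∃ v, T.OnPath v x := by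
  obtain ⟨l, hl, hxl⟩ := h.exists_leaf hx
  exact (h.exists_onPath_le hx hl hxl).imp fun _ => And.left

/-- A collapsed path can be left only through its lower end. If `y` and `v` were incomparable, the
lowest node above both and not above `x` would be unary, and its only child would again lie above
both. -/
theorem onPath_or_anc (h : FinTree S T) {v x y : V} (hv : T.OnPath v x) (hy : T.node y)
    (hxy : T.Le x y) : T.OnPath v y ∨ T.anc v y := by
  have := h.famAt (A := V)
  rcases hxy with rfl | hxy
  · exact .inl hv
  rcases hv.2.2 with rfl | ⟨hxv, hxu, hu⟩
  · exact .inr hxy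
  by_cases hc : T.Le y v ∨ T.anc v y
  · rcases hc with (rfl | hc) | hc
    · exact .inl hv.1.onPath
    · exact .inl ⟨hv.1, hy, .inr ⟨hc, hu y hy hxy hc,
        fun z hz h1 h2 => hu z hz (h.trans hxy h1) h2⟩⟩
    · exact .inr hc
  exfalso
  obtain ⟨u, ⟨h1, h2, h3⟩, hmax⟩ := h.exists_bottom
    (P := fun u => T.Le x u ∧ T.anc u y ∧ T.anc u v)
    (InS.and (hP := InS.treeLe (T := fun _ => T) (v := fun _ => x) (w := fun w => w)))
    (fun v hv => h.node_left hv.2.1) ⟨x, .inl rfl, hxy, hxv⟩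
  have huu : T.Unary u := by
    rcases h1 with rfl | h1
    · exact hxu
    · exact hu u (h.node_left h2) h1 h3
  obtain ⟨w, hw, hwy⟩ := h.exists_child h2
  obtain ⟨w', hw', hwv⟩ := h.exists_child h3
  obtain rfl := huu.unique hw hw'
  rcases hwy with rfl | hwy
  · exact hc (.inl hwv)
  rcases hwv with rfl | hwv
  · exact hc (.inr hwy)
  exact hmax w ⟨h.le_trans h1 (.inr hw.2.2.1), hwy, hwv⟩ hw.2.2.1

theorem onPath_unique (h : FinTree S T) {v v' x : V} (h1 : T.OnPath v x) (h2 : T.OnPath v' x) :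
    v = v' := by
  rcases h.onPath_or_anc h1 h2.1.1 h2.le with h3 | h3
  · exact (h3.eq_of_kept h2.1).symm
  · rcases h.onPath_or_anc h2 h1.1.1 h1.le with h4 | h4
    · exact h4.eq_of_kept h1.1
    · exact absurd (.inr h4) (h.asymm h3)

theorem exists_first (h : FinTree S T) {v : V} (hv : T.Kept v) : ∃ x, T.FirstOnPath v x := by
  have := h.famAt (A := V)
  exact h.exists_top (P := fun x => T.OnPath v x)
    (InS.onPath (T := fun _ => T) (v := fun _ => v) (w := fun w => w)) (fun x hx => hx.2.1)
    ⟨v, hv.onPath⟩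

theorem first_le (h : FinTree S T) {v x y : V} (hx : T.FirstOnPath v x) (hy : T.OnPath v y) :
    T.Le x y :=
  (h.comparable hx.1.le hy.le).resolve_right (hx.2 y hy)

theorem first_unique (h : FinTree S T) {v x y : V} (hx : T.FirstOnPath v x)
    (hy : T.FirstOnPath v y) : x = y := by
  rcases h.first_le hx hy.1 with h1 | h1
  · exact h1
  · exact absurd h1 (hy.2 x hx.1)

/-- All edges of a collapsed path have the same leaves below them; this is why collapsing changes
nothing in what an identifier covers. -/
theorem le_leaf_iff (h : FinTree S T) {v x l : V} (hx : T.OnPath v x) (hl : T.Leaf l) :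
    T.Le x l ↔ T.Le v l := by
  refine ⟨fun hxl => ?_, fun hvl => h.le_trans hx.le hvl⟩
  rcases h.onPath_or_anc hx hl.1 hxl with h1 | h1
  · exact .inl (h1.eq_of_kept (kept_of_leaf hl)).symm
  · exact .inr h1

/-- A node that is the first of its path stays above the first node of every path below it. -/
theorem le_first_of_anc (h : FinTree S T) {u f v x j : V} (hf : T.FirstOnPath u f)
    (hx : T.FirstOnPath v x) (hj : T.OnPath v j) (hfj : T.anc f j) : T.Le f x := by
  refine (h.comparable (.inr hfj) (h.first_le hx hj)).resolve_right fun hxf => ?_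
  -- With `x` strictly above `f`, and `f` above `j`, the node `f` would lie inside the path that
  -- starts at `x`, so it could not be first.
  rcases h.onPath_or_anc hx.1 hf.1.2.1 (.inr hxf) with h1 | h1
  · obtain rfl := h.onPath_unique h1 hf.1
    exact hf.2 x hx.1 hxf
  · exact h.asymm (h.anc_of_anc_of_le h1 (.inr hfj)) hj.le

end FinTree

end FinTrees

end QDag

namespace QDag

open SOA

/-! ### Definability of the steps of a transition -/

section StepDefinability

variable {N : Type u} [CommSemiring N] [LinearOrder N] [IsStrictOrderedRing N]
  [CanonicallyOrderedAdd N]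
variable {S : Set (Set N)} [hS : Fact (ModelsRCA0 S)]
variable {A B V : Type u} [Coded S A] [Coded S B] [Coded S V]

variable (S) in
/-- A family of schemes and letters that belongs to the second-order part. -/
class StepFam (τ : A → Scheme N) (M : A → Letter N) : Prop where
  tree : TreeFam S τ
  edge_inS : InS S fun p : A × N × N => EdgeFrom (τ p.1) (M p.1) p.2.1 p.2.2
  edge_bdd : ∃ b : N, ∀ a p q, EdgeFrom (τ a) (M a) p q → q ≤ b
  acc_inS : InS S fun p : A × N => (τ p.1).node p.2 ∧ (τ p.1).acc p.2
  star_inS : InS S fun p : A × N => ∃ l, (τ p.1).Leaf l ∧ M p.1 ((τ p.1).label l) p.2 = Mark.star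

instance (priority := low) StepFam.subst {τ : A → Scheme N} {M : A → Letter N} {f : B → A}
    [h : StepFam S τ M] [hf : FunS S f] : StepFam S (fun b => τ (f b)) fun b => M (f b) where
  tree := TreeFam.subst (hT := h.tree)
  edge_inS := h.edge_inS.comp (f := fun p : B × N × N => (f p.1, p.2)) inferInstance
  edge_bdd := h.edge_bdd.imp fun _ h b => h (f b)
  acc_inS := h.acc_inS.comp (f := fun p : B × N => (f p.1, p.2)) inferInstance
  star_inS := h.star_inS.comp (f := fun p : B × N => (f p.1, p.2)) inferInstance

theorem TreeFam.restrict {T : A → LTree N V} (hT : TreeFam S T) {P : A → V → Prop}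
    (hP : InS S fun p : A × V => P p.1 p.2) : TreeFam S fun a => (T a).restrict (P a) := by
  have hP' : ∀ {B : Type u} [Coded S B] (f : B → A) (g : B → V) [FunS S f] [FunS S g],
      InS S fun a => P (f a) (g a) := fun f g _ _ => hP.comp (f := fun a => (f a, g a)) inferInstance
  refine ⟨?_, ?_, hT.bdd.imp fun b h a v hv => h a v hv.1, fun a v w h => ⟨h.1, h.2.1⟩⟩
  · unfold LTree.restrict
    infer_instance
  · unfold LTree.restrict
    infer_instance

variable {τ : A → Scheme N} {M : A → Letter N}

instance InS.edgeFrom [h : StepFam S τ M] {f g : A → N} [FunS S f] [FunS S g] :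
    InS S fun a => EdgeFrom (τ a) (M a) (f a) (g a) :=
  h.edge_inS.comp (f := fun a => (a, f a, g a)) inferInstance

theorem InS.exists_edge [h : StepFam S τ M] {P : A → N → Prop}
    (hP : InS S fun p : A × N => P p.1 p.2) {f : A → N} [FunS S f] :
    InS S fun a => ∃ p, EdgeFrom (τ a) (M a) p (f a) ∧ P a p := by
  have := h.tree
  exact InS.congr (P := fun a => ∃ p, (τ a).node p ∧ (EdgeFrom (τ a) (M a) p (f a) ∧ P a p))
    fun a => ⟨fun ⟨p, hp⟩ => ⟨p, hp.1.1.1, hp⟩, fun ⟨p, _, hp⟩ => ⟨p, hp⟩⟩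

instance InS.hasEdge [h : StepFam S τ M] {f : A → N} [FunS S f] :
    InS S fun a => ∃ p, EdgeFrom (τ a) (M a) p (f a) :=
  InS.congr (P := fun a => ∃ p, EdgeFrom (τ a) (M a) p (f a) ∧ True)
    (h := InS.exists_edge inferInstance) fun a => by simp

instance TreeFam.append [h : StepFam S τ M] : TreeFam S fun a => append (τ a) (M a) := by
  have ht := h.tree
  refine ⟨InS.sum (InS.node (T := fun p : A × N => τ p.1)) ?_, ?_, ?_, ?_⟩
  · exact InS.hasEdge (τ := fun p : A × N => τ p.1) (M := fun p => M p.1)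
  · have h1 : InS S fun p : (A × N) × (N ⊕ N) =>
        (QDag.append (τ p.1.1) (M p.1.1)).anc (.inl p.1.2) p.2 := by
      refine InS.sum (InS.anc (T := fun p : (A × N) × N => τ p.1.1)) ?_
      exact InS.exists_edge (τ := fun p : (A × N) × N => τ p.1.1) (M := fun p => M p.1.1)
        (P := fun p l => p.1.2 = l ∨ (τ p.1.1).anc p.1.2 l) inferInstance
    have h2 : InS S fun p : (A × N) × (N ⊕ N) =>
        (QDag.append (τ p.1.1) (M p.1.1)).anc (.inr p.1.2) p.2 := InS.const False
    have h3 : InS S fun p : (A × (N ⊕ N)) × (N ⊕ N) =>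
        (QDag.append (τ p.1.1) (M p.1.1)).anc p.2 p.1.2 :=
      InS.sum (h1.comp (f := fun p : (A × (N ⊕ N)) × N => ((p.1.1, p.2), p.1.2)) inferInstance)
        (h2.comp (f := fun p : (A × (N ⊕ N)) × N => ((p.1.1, p.2), p.1.2)) inferInstance)
    exact h3.comp (f := fun p : A × (N ⊕ N) × (N ⊕ N) => ((p.1, p.2.2), p.2.1)) inferInstance
  · obtain ⟨b, hb⟩ := ht.bdd
    obtain ⟨b', hb'⟩ := h.edge_bdd
    refine ⟨pair 0 b + pair 1 b', fun a v hv => ?_⟩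
    rcases v with i | q
    · exact le_trans (pair_mono le_rfl (hb a i hv)) le_self_add
    · obtain ⟨p, hp⟩ := hv
      exact le_trans (pair_mono le_rfl (hb' a p q hp)) le_add_self
  · intro a v w hvw
    rcases v with i | q
    · rcases w with j | q
      · exact ht.anc_node a i j hvw
      · obtain ⟨p, hp, h1⟩ := hvw
        refine ⟨?_, p, hp⟩
        rcases h1 with rfl | h1
        · exact hp.1.1
        · exact (ht.anc_node a i p h1).1
    · exact hvw.elim

instance TreeFam.prune [h : StepFam S τ M] : TreeFam S fun a => prune (τ a) (M a) := by
  obtain ⟨b, hb⟩ := h.edge_bdd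
  refine TreeFam.append.restrict (P := fun a v => ∃ q, (QDag.append (τ a) (M a)).node (.inr q) ∧
    (v = .inr q ∨ (QDag.append (τ a) (M a)).anc v (.inr q))) ?_
  refine InS.exists_of_bdd (fun _ => b) (P := fun (p : A × (N ⊕ N)) (q : N) =>
    (QDag.append (τ p.1) (M p.1)).node (.inr q) ∧
    (p.2 = .inr q ∨ (QDag.append (τ p.1) (M p.1)).anc p.2 (.inr q))) inferInstance ?_
  rintro ⟨a, v⟩ q ⟨⟨p, hp⟩, _⟩
  exact hb a p q hp

theorem InS.prune_acc [h : StepFam S τ M] {v : A → N ⊕ N} [FunS S v] :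
    InS S fun a => (prune (τ a) (M a)).node (v a) ∧ (prune (τ a) (M a)).acc (v a) := by
  have key : InS S fun p : A × (N ⊕ N) =>
      (prune (τ p.1) (M p.1)).node p.2 ∧ (prune (τ p.1) (M p.1)).acc p.2 := by
    refine InS.sum ?_ ?_
    · have := h.acc_inS
      refine InS.congr (P := fun p : A × N => (prune (τ p.1) (M p.1)).node (.inl p.2) ∧
        ((τ p.1).node p.2 ∧ (τ p.1).acc p.2)) fun p => ?_
      exact ⟨fun h => ⟨h.1, h.1.1, h.2⟩, fun h => ⟨h.1, h.2.2⟩⟩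
    · have := h.star_inS
      exact InS.and (A := A × N) (P := fun p => (prune (τ p.1) (M p.1)).node (.inr p.2))
        (P' := fun p => ∃ l, (τ p.1).Leaf l ∧ M p.1 ((τ p.1).label l) p.2 = Mark.star)
  exact key.comp (f := fun a => (a, v a)) inferInstance

instance InS.deleted [h : StepFam S τ M] {f : A → N} [FunS S f] :
    InS S fun a => Deleted (τ a) (M a) (f a) := by
  have := h.tree
  unfold Deleted
  refine InS.and (hP' := InS.or (hP' := ?_))
  exact InS.congr (P := fun a => ∃ v, (prune (τ a) (M a)).node v ∧
    ((prune (τ a) (M a)).OnPath v (.inl (f a)) ∧ ¬ (prune (τ a) (M a)).FirstOnPath v (.inl (f a))))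
    fun a => ⟨fun ⟨v, hv⟩ => ⟨v, hv.1.1.1, hv⟩, fun ⟨v, _, hv⟩ => ⟨v, hv⟩⟩

end StepDefinability

/-! ### The pruned tree of a single transition -/

section Prune

variable {N : Type u} {τ : Scheme N} {M : Letter N}

theorem prune_node_inr {q : N} :
    (prune τ M).node (.inr q) ↔ ∃ p, EdgeFrom τ M p q :=
  ⟨fun h => h.1, fun h => ⟨h, q, h, .inl rfl⟩⟩

theorem prune_node_inl {i : N} :
    (prune τ M).node (.inl i) ↔ τ.node i ∧ ∃ q p, EdgeFrom τ M p q ∧ τ.Le i p := by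
  constructor
  · rintro ⟨h, q, _, h2 | ⟨p, hp, h3⟩⟩
    · exact absurd h2 (by simp)
    · exact ⟨h, q, p, hp, h3⟩
  · rintro ⟨h, q, p, hp, h3⟩
    exact ⟨h, q, ⟨p, hp⟩, .inr ⟨p, hp, h3⟩⟩

theorem prune_anc_inl_inl {i j : N} : (prune τ M).anc (.inl i) (.inl j) ↔
    (prune τ M).node (.inl i) ∧ (prune τ M).node (.inl j) ∧ τ.anc i j := Iff.rfl

theorem prune_anc_inr {q : N} {v : N ⊕ N} : ¬ (prune τ M).anc (.inr q) v := fun h => h.2.2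

end Prune

/-- A state of a run: a finite tree of the second-order part with distinct labels of leaves. -/
structure IsState {N : Type u} [CommSemiring N] [LinearOrder N] [IsStrictOrderedRing N]
    [CanonicallyOrderedAdd N] (S : Set (Set N)) [Fact (ModelsRCA0 S)] (τ : Scheme N) : Prop where
  tree : FinTree S τ
  leaf_unique : ∀ i j, τ.Leaf i → τ.Leaf j → τ.label i = τ.label j → i = j

section Step

variable {N : Type u} [CommSemiring N] [LinearOrder N] [IsStrictOrderedRing N]
  [CanonicallyOrderedAdd N]
variable {S : Set (Set N)} [hS : Fact (ModelsRCA0 S)] {τ : Scheme N} {M : Letter N}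

theorem IsState.edge_unique (hτ : IsState S τ) (hM : M.TreeShaped) {p p' q : N}
    (h : EdgeFrom τ M p q) (h' : EdgeFrom τ M p' q) : p = p' :=
  hτ.leaf_unique p p' h.1 h'.1 (hM _ _ _ h.2 h'.2)

theorem IsState.prune_anc_inl_inr (hτ : IsState S τ) {i q : N} :
    (prune τ M).anc (.inl i) (.inr q) ↔ ∃ p, EdgeFrom τ M p q ∧ τ.Le i p := by
  constructor
  · rintro ⟨_, _, p, hp, h⟩
    exact ⟨p, hp, h⟩
  · rintro ⟨p, hp, h⟩
    refine ⟨prune_node_inl.2 ⟨?_, q, p, hp, h⟩, prune_node_inr.2 ⟨p, hp⟩, p, hp, h⟩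
    rcases h with rfl | h
    · exact hp.1.1
    · exact hτ.tree.node_left h

theorem IsState.prune_le_inr_iff (hτ : IsState S τ) (hM : M.TreeShaped) {i p q : N}
    (h : EdgeFrom τ M p q) : (prune τ M).Le (.inl i) (.inr q) ↔ τ.Le i p := by
  constructor
  · rintro (h1 | h1)
    · exact absurd h1 (by simp)
    · obtain ⟨p', hp', h2⟩ := hτ.prune_anc_inl_inr.1 h1
      rwa [hτ.edge_unique hM h hp']
  · exact fun h1 => .inr (hτ.prune_anc_inl_inr.2 ⟨p, h, h1⟩)

/-- Distinct leaf labels and the tree shape of the letter give each new leaf a single parent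
(`IsState.edge_unique`), which makes the ancestors of a new leaf comparable. -/
theorem IsState.prune_tree (hτ : IsState S τ) (hM : M.TreeShaped)
    (hf : StepFam S (fun _ : N => τ) fun _ => M) : FinTree S (prune τ M) := by
  refine ⟨TreeFam.prune, ?_, ?_, ?_⟩
  · rintro (i | q) h
    · exact hτ.tree.irrefl i (prune_anc_inl_inl.1 h).2.2
    · exact prune_anc_inr h
  · rintro (i | q) v w h1 h2
    · rcases v with j | q
      · rcases w with k | q
        · rw [prune_anc_inl_inl] at *
          exact ⟨h1.1, h2.2.1, hτ.tree.trans h1.2.2 h2.2.2⟩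
        · obtain ⟨p, hp, h3⟩ := hτ.prune_anc_inl_inr.1 h2
          exact hτ.prune_anc_inl_inr.2 ⟨p, hp, hτ.tree.le_trans (.inr h1.2.2) h3⟩
      · exact absurd h2 prune_anc_inr
    · exact absurd h1 prune_anc_inr
  · rintro (i | q) v w h1 h2
    · rcases v with j | q
      · rcases w with k | q
        · rw [prune_anc_inl_inl] at *
          rcases hτ.tree.linear h1.2.2 h2.2.2 with rfl | h3 | h3
          · exact .inl rfl
          · exact .inr (.inl ⟨h1.1, h2.1, h3⟩)
          · exact .inr (.inr ⟨h2.1, h1.1, h3⟩)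
        · obtain ⟨p, hp, h3⟩ := hτ.prune_anc_inl_inr.1 h1
          obtain ⟨p', hp', h4⟩ := hτ.prune_anc_inl_inr.1 h2
          obtain rfl := hτ.edge_unique hM hp hp'
          rcases hτ.tree.comparable h3 h4 with (rfl | h5) | h5
          · exact .inl rfl
          · exact .inr (.inl ⟨h1.1, h2.1, h5⟩)
          · exact .inr (.inr ⟨h2.1, h1.1, h5⟩)
      · exact absurd h2 prune_anc_inr
    · exact absurd h1 prune_anc_inr

end Step

end QDag

namespace QDag

open SOA

/-! ### The effect of a transition on the leaves below each edge -/

/-- The state `q` labels a leaf of `τ`. -/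
def Alive {N : Type u} (τ : Scheme N) (q : N) : Prop := ∃ l, τ.Leaf l ∧ τ.label l = q

/-- The edge `i` of `τ` lies on the branch that leads to the leaf labelled `q`. -/
def Above {N : Type u} (τ : Scheme N) (q i : N) : Prop :=
  ∃ l, τ.Leaf l ∧ τ.label l = q ∧ τ.Le i l

/-- `M` has an edge from the label `p` of a leaf of `τ` to `q`. -/
def Feeds {N : Type u} (τ : Scheme N) (M : Letter N) (p q : N) : Prop :=
  Alive τ p ∧ M p q ≠ Mark.zero

theorem feeds_iff {N : Type u} {τ : Scheme N} {M : Letter N} {p q : N} :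
    Feeds τ M p q ↔ ∃ l, τ.label l = p ∧ EdgeFrom τ M l q := by
  constructor
  · rintro ⟨⟨l, hl, rfl⟩, h⟩
    exact ⟨l, rfl, hl, h⟩
  · rintro ⟨l, rfl, hl, h⟩
    exact ⟨⟨l, hl, rfl⟩, h⟩

section Step

variable {N : Type u} [CommSemiring N] [LinearOrder N] [IsStrictOrderedRing N]
  [CanonicallyOrderedAdd N]
variable {S : Set (Set N)} [hS : Fact (ModelsRCA0 S)]

/-- Distinct collapsed paths do not overlap, so their lower ends and their first edges are ordered
alike. Hence inherited identifiers keep their mutual order. -/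
theorem FinTree.first_anc_iff {V : Type u} [Coded S V] {T : LTree N V} (h : FinTree S T)
    {u w x y : V} (hx : T.FirstOnPath u x) (hy : T.FirstOnPath w y) :
    T.anc u w ↔ T.anc x y := by
  constructor
  · intro huw
    rcases h.comparable (.inr (h.anc_of_le_of_anc hx.1.le huw)) hy.1.le with (rfl | h1) | h1
    · rw [h.onPath_unique hx.1 hy.1] at huw
      exact absurd huw (h.irrefl _)
    · exact h1
    · rcases h.onPath_or_anc hy.1 hx.1.2.1 (.inr h1) with h2 | h2
      · rw [h.onPath_unique hx.1 h2] at huw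
        exact absurd huw (h.irrefl _)
      · exact (h.asymm (h.anc_of_anc_of_le h2 hx.1.le) (.inr huw)).elim
  · intro hxy
    rcases h.onPath_or_anc hx.1 hy.1.2.1 (.inr hxy) with h1 | h1
    · obtain rfl := h.onPath_unique h1 hy.1
      rw [h.first_unique hx hy] at hxy
      exact absurd hxy (h.irrefl _)
    · exact h.anc_of_anc_of_le h1 hy.1.le

variable (S) in
/-- The setting of a transition inside the structure. -/
structure StepCtx (τ : Scheme N) (M : Letter N) : Prop where
  state : IsState S τ
  shaped : M.TreeShaped
  fam : StepFam S (fun _ : N => τ) fun _ => M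

variable {τ τ' : Scheme N} {M : Letter N} {ν : N → N} {c : N}

namespace StepCtx

theorem tree (h : StepCtx S τ M) : FinTree S (prune τ M) :=
  h.state.prune_tree h.shaped h.fam

theorem leaf_inr {q : N} (hq : (prune τ M).node (.inr q)) : (prune τ M).Leaf (.inr q) :=
  ⟨hq, fun _ _ => prune_anc_inr⟩

theorem leaf_edge {p q : N} (hq : EdgeFrom τ M p q) : (prune τ M).Leaf (.inr q) :=
  leaf_inr (prune_node_inr.2 ⟨p, hq⟩)

theorem leaf_iff (h : StepCtx S τ M) {v : N ⊕ N} :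
    (prune τ M).Leaf v ↔ ∃ q, v = .inr q ∧ ∃ p, EdgeFrom τ M p q := by
  constructor
  · rintro ⟨h1, h2⟩
    rcases v with i | q
    · obtain ⟨_, q, p, hp, hi⟩ := prune_node_inl.1 h1
      exact absurd (h.state.prune_anc_inl_inr.2 ⟨p, hp, hi⟩) (h2 _ (prune_node_inr.2 ⟨p, hp⟩))
    · exact ⟨q, rfl, prune_node_inr.1 h1⟩
  · rintro ⟨q, rfl, p, hp⟩
    exact leaf_edge hp

theorem eq_inr_of_le {q : N} {v : N ⊕ N} (h : (prune τ M).Le (.inr q) v) : v = .inr q :=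
  (h.resolve_right prune_anc_inr).symm

theorem kept_of_hasIdentifier {v : N ⊕ N} {i : N} (h : HasIdentifier τ M ν v i) :
    (prune τ M).Kept v := by
  rcases h with h | ⟨q, rfl, h, _⟩
  · exact h.1.1
  · exact h.1.1

theorem exists_hasIdentifier (h : StepCtx S τ M) {v : N ⊕ N} (hv : (prune τ M).Kept v) :
    ∃ i, HasIdentifier τ M ν v i := by
  obtain ⟨x, hx⟩ := h.tree.exists_first hv
  rcases x with i | q
  · exact ⟨i, .inl hx⟩
  · obtain rfl := eq_inr_of_le hx.1.le
    exact ⟨ν q, .inr ⟨q, rfl, hx, rfl⟩⟩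

theorem hasIdentifier_unique (h : StepCtx S τ M) {v : N ⊕ N} {i j : N}
    (hi : HasIdentifier τ M ν v i) (hj : HasIdentifier τ M ν v j) : i = j := by
  rcases hi with hi | ⟨q, rfl, hi, rfl⟩
  · rcases hj with hj | ⟨q, rfl, hj, rfl⟩
    · exact Sum.inl_injective (h.tree.first_unique hi hj)
    · exact absurd (h.tree.first_unique hi hj) (by simp)
  · rcases hj with hj | ⟨q', h1, hj, rfl⟩
    · exact absurd (h.tree.first_unique hi hj) (by simp)
    · rw [Sum.inr_injective h1]

theorem hasIdentifier_inj (h : StepCtx S τ M) (hu : ∀ q, Unnamed τ M q → ¬ Used τ M (ν q))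
    (hν : ∀ q q', Unnamed τ M q → Unnamed τ M q' → ν q = ν q' → q = q') {u v : N ⊕ N}
    {i : N} (hi : HasIdentifier τ M ν u i) (hj : HasIdentifier τ M ν v i) : u = v := by
  rcases hi with hi | ⟨q, rfl, hi, rfl⟩
  · rcases hj with hj | ⟨q, rfl, hj, rfl⟩
    · exact h.tree.onPath_unique hi.1 hj.1
    · exact absurd ⟨u, hi⟩ (hu q hj)
  · rcases hj with hj | ⟨q', rfl, hj, h1⟩
    · exact absurd ⟨v, hj⟩ (hu q hi)
    · rw [hν q q' hi hj h1]

theorem not_deleted_of_first (h : StepCtx S τ M) {v : N ⊕ N} {i : N}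
    (hi : (prune τ M).FirstOnPath v (.inl i)) : ¬ Deleted τ M i := by
  rintro ⟨_, h1 | ⟨v', h1, h2⟩⟩
  · exact h1 hi.1.2.1
  · rw [h.tree.onPath_unique h1 hi.1] at h2
    exact h2 hi

theorem exists_first_of_not_deleted (h : StepCtx S τ M) {i : N} (hi : τ.node i)
    (hd : ¬ Deleted τ M i) : ∃ v, (prune τ M).FirstOnPath v (.inl i) := by
  have h1 : (prune τ M).node (.inl i) := by
    by_contra hc
    exact hd ⟨hi, .inl hc⟩
  obtain ⟨v, hv⟩ := h.tree.exists_onPath h1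
  refine ⟨v, ?_⟩
  by_contra hc
  exact hd ⟨hi, .inr ⟨v, hv, hc⟩⟩

theorem above_iff (h : StepCtx S τ M) {l q i : N} (hl : EdgeFrom τ M l q) :
    Above τ (τ.label l) i ↔ (prune τ M).Le (.inl i) (.inr q) := by
  rw [h.state.prune_le_inr_iff h.shaped hl]
  constructor
  · rintro ⟨l', h1, h2, h3⟩
    rwa [← h.state.leaf_unique l' l h1 hl.1 h2]
  · exact fun h1 => ⟨l, hl.1, rfl, h1⟩

/-! #### The target of a transition -/

theorem node_iff (ht : IsTransition c τ M ν τ') {i : N} :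
    τ'.node i ↔ ∃ v, HasIdentifier τ M ν v i :=
  (ht.node_iff i).trans ⟨fun ⟨v, _, h⟩ => ⟨v, h⟩, fun ⟨v, h⟩ => ⟨v, kept_of_hasIdentifier h, h⟩⟩

theorem anc_iff (ht : IsTransition c τ M ν τ') {u v : N ⊕ N} {i j : N}
    (hi : HasIdentifier τ M ν u i) (hj : HasIdentifier τ M ν v j) :
    τ'.anc i j ↔ (prune τ M).anc u v :=
  (ht.anc_iff u v i j (kept_of_hasIdentifier hi) (kept_of_hasIdentifier hj) hi hj).trans
    ⟨fun h => h.2.2, fun h => ⟨kept_of_hasIdentifier hi, kept_of_hasIdentifier hj, h⟩⟩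

theorem le_iff (h : StepCtx S τ M) (ht : IsTransition c τ M ν τ') {u v : N ⊕ N} {i j : N}
    (hi : HasIdentifier τ M ν u i) (hj : HasIdentifier τ M ν v j) :
    τ'.Le i j ↔ (prune τ M).Le u v := by
  refine or_congr ⟨?_, ?_⟩ (anc_iff ht hi hj)
  · rintro rfl
    exact h.hasIdentifier_inj ht.fresh.not_used ht.fresh.inj hi hj
  · rintro rfl
    exact h.hasIdentifier_unique hi hj

theorem leaf_target_iff (h : StepCtx S τ M) (ht : IsTransition c τ M ν τ') {v : N ⊕ N} {i : N}
    (hi : HasIdentifier τ M ν v i) : τ'.Leaf i ↔ (prune τ M).Leaf v := by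
  constructor
  · rintro ⟨_, h2⟩
    refine ⟨(kept_of_hasIdentifier hi).1, fun w hw hvw => ?_⟩
    obtain ⟨l, hl, hwl⟩ := h.tree.exists_leaf hw
    obtain ⟨j, hj⟩ := h.exists_hasIdentifier (ν := ν) (FinTree.kept_of_leaf hl)
    exact h2 j ((node_iff ht).2 ⟨l, hj⟩)
      ((anc_iff ht hi hj).2 (h.tree.anc_of_anc_of_le hvw hwl))
  · rintro ⟨_, h2⟩
    refine ⟨(node_iff ht).2 ⟨v, hi⟩, fun j hj hij => ?_⟩
    obtain ⟨w, hw⟩ := (node_iff ht).1 hj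
    exact h2 w (kept_of_hasIdentifier hw).1 ((anc_iff ht hi hw).1 hij)

theorem exists_leaf_target (h : StepCtx S τ M) (ht : IsTransition c τ M ν τ') {p q : N}
    (hq : EdgeFrom τ M p q) :
    ∃ l, HasIdentifier τ M ν (.inr q) l ∧ τ'.Leaf l ∧ τ'.label l = q := by
  have hl := leaf_edge hq
  obtain ⟨l, h1⟩ := h.exists_hasIdentifier (ν := ν) (FinTree.kept_of_leaf hl)
  exact ⟨l, h1, (h.leaf_target_iff ht h1).2 hl, ht.label_eq _ _ (kept_of_hasIdentifier h1) h1⟩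

theorem leaf_target_eq (h : StepCtx S τ M) (ht : IsTransition c τ M ν τ') {l : N}
    (hl : τ'.Leaf l) : HasIdentifier τ M ν (.inr (τ'.label l)) l ∧
      ∃ p, EdgeFrom τ M p (τ'.label l) := by
  obtain ⟨v, hv⟩ := (node_iff ht).1 hl.1
  obtain ⟨q, rfl, hp⟩ := h.leaf_iff.1 ((h.leaf_target_iff ht hv).1 hl)
  have : τ'.label l = q := ht.label_eq _ _ (kept_of_hasIdentifier hv) hv
  rw [this]
  exact ⟨hv, hp⟩

theorem alive_target_iff (h : StepCtx S τ M) (ht : IsTransition c τ M ν τ') {q : N} :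
    Alive τ' q ↔ ∃ p, Feeds τ M p q := by
  simp only [feeds_iff]
  constructor
  · rintro ⟨l, hl, rfl⟩
    obtain ⟨_, p, hp⟩ := h.leaf_target_eq ht hl
    exact ⟨_, p, rfl, hp⟩
  · rintro ⟨_, p, rfl, hp⟩
    obtain ⟨l, _, hl, hq⟩ := h.exists_leaf_target ht hp
    exact ⟨l, hl, hq⟩

theorem above_target_iff (h : StepCtx S τ M) (ht : IsTransition c τ M ν τ') {v : N ⊕ N}
    {i p q : N} (hi : HasIdentifier τ M ν v i) (hq : EdgeFrom τ M p q) :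
    Above τ' q i ↔ (prune τ M).Le v (.inr q) := by
  constructor
  · rintro ⟨l, hl, rfl, h1⟩
    exact (h.le_iff ht hi (h.leaf_target_eq ht hl).1).1 h1
  · intro h1
    obtain ⟨l, h2, hl, h3⟩ := h.exists_leaf_target ht hq
    exact ⟨l, hl, h3, (h.le_iff ht hi h2).2 h1⟩

theorem above_target_iff_onPath (h : StepCtx S τ M) (ht : IsTransition c τ M ν τ')
    {v x : N ⊕ N} {i p q : N} (hi : HasIdentifier τ M ν v i) (hx : (prune τ M).OnPath v x)
    (hq : EdgeFrom τ M p q) : Above τ' q i ↔ (prune τ M).Le x (.inr q) := by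
  rw [h.above_target_iff ht hi hq, h.tree.le_leaf_iff hx (leaf_edge hq)]

/-- An undeleted `i` is the first edge of its collapsed path, and every edge of that path has the
same leaves below it. -/
theorem survives (h : StepCtx S τ M) (ht : IsTransition c τ M ν τ') {i : N} (hi : τ.node i)
    (hd : ¬ Deleted τ M i) :
    τ'.node i ∧ ∀ p q, Feeds τ M p q → (Above τ' q i ↔ Above τ p i) := by
  obtain ⟨v, hv⟩ := h.exists_first_of_not_deleted hi hd
  have hid : HasIdentifier τ M ν v i := .inl hv
  refine ⟨(node_iff ht).2 ⟨v, hid⟩, fun p q hpq => ?_⟩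
  obtain ⟨l, rfl, hl⟩ := feeds_iff.1 hpq
  rw [h.above_target_iff_onPath ht hid hv.1 hl, h.above_iff hl]

/-- An accepting edge `x` of a collapsed path is an old edge or an edge of the letter. -/
theorem accepting_cases (h : StepCtx S τ M) (ht : IsTransition c τ M ν τ') {v x : N ⊕ N} {i : N}
    (hi : HasIdentifier τ M ν v i) (hx : (prune τ M).OnPath v x) (ha : (prune τ M).acc x) :
    (∃ j, x = .inl j ∧ τ.node j ∧ τ.acc j ∧
        ∀ p q, Feeds τ M p q → (Above τ' q i ↔ Above τ p j)) ∨
      ∃ p₀ q₀, x = .inr q₀ ∧ Feeds τ M p₀ q₀ ∧ M p₀ q₀ = Mark.star ∧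
        ∀ p q, Feeds τ M p q → (Above τ' q i ↔ q = q₀) := by
  rcases x with j | q₀
  · refine .inl ⟨j, rfl, (prune_node_inl.1 hx.2.1).1, ha, fun p q hpq => ?_⟩
    obtain ⟨l, rfl, hl⟩ := feeds_iff.1 hpq
    rw [h.above_target_iff_onPath ht hi hx hl, h.above_iff hl]
  · obtain ⟨l₀, hl₀, hs⟩ := ha
    refine .inr ⟨τ.label l₀, q₀, rfl, ⟨⟨l₀, hl₀, rfl⟩, by rw [hs]; exact nofun⟩, hs, fun p q hpq => ?_⟩
    obtain ⟨l, rfl, hl⟩ := feeds_iff.1 hpq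
    rw [h.above_target_iff_onPath ht hi hx hl]
    exact ⟨fun h1 => Sum.inr_injective (eq_inr_of_le h1), fun h1 => .inl (congrArg _ h1.symm)⟩

theorem accepting_target (h : StepCtx S τ M) (ht : IsTransition c τ M ν τ') {i : N}
    (hi : τ'.node i) (ha : τ'.acc i) :
    (∃ j, τ.node j ∧ τ.acc j ∧ ∀ p q, Feeds τ M p q → (Above τ' q i ↔ Above τ p j)) ∨
      ∃ p₀ q₀, Feeds τ M p₀ q₀ ∧ M p₀ q₀ = Mark.star ∧
        ∀ p q, Feeds τ M p q → (Above τ' q i ↔ q = q₀) := by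
  obtain ⟨v, hv⟩ := (node_iff ht).1 hi
  obtain ⟨x, hx, hxa⟩ := (ht.acc_iff v i (kept_of_hasIdentifier hv) hv).1 ha
  rcases h.accepting_cases ht hv hx hxa with ⟨j, _, h1⟩ | ⟨p₀, q₀, _, h1⟩
  · exact .inl ⟨j, h1⟩
  · exact .inr ⟨p₀, q₀, h1⟩

/-- The accepting edge responsible for the refreshment is either an old edge strictly below `i` or a
new leaf edge. It shares its leaves with `i` after the collapse, so all leaves below `i` pass
through it. -/
theorem refreshed_target (h : StepCtx S τ M) (ht : IsTransition c τ M ν τ') {i : N}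
    (hi : Refreshed τ M i) : τ'.node i ∧
    ((∃ j, τ.anc i j ∧ τ.node j ∧ τ.acc j ∧
        ∀ p q, Feeds τ M p q → (Above τ' q i ↔ Above τ p j)) ∨
      ∃ p₀ q₀, Feeds τ M p₀ q₀ ∧ M p₀ q₀ = Mark.star ∧
        ∀ p q, Feeds τ M p q → (Above τ' q i ↔ q = q₀)) := by
  obtain ⟨v, hv, x, hx, hne, ha⟩ := hi
  have hid : HasIdentifier τ M ν v i := .inl hv
  refine ⟨(node_iff ht).2 ⟨v, hid⟩, ?_⟩
  rcases h.accepting_cases ht hid hx ha with ⟨j, rfl, h1⟩ | ⟨p₀, q₀, _, h1⟩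
  · refine .inl ⟨j, ?_, h1⟩
    rcases h.tree.first_le hv hx with h2 | h2
    · exact absurd h2.symm hne
    · exact h2.2.2
  · exact .inr ⟨p₀, q₀, h1⟩

/-! #### The branch that leads to a given leaf -/

theorem node_of_above (h : StepCtx S τ M) {p i : N} (hi : Above τ p i) : τ.node i := by
  obtain ⟨l, hl, _, rfl | h1⟩ := hi
  · exact hl.1
  · exact h.state.tree.node_left h1

/-- The path through `j` starts with an old edge, since nothing lies below a new leaf. Acceptance
moves up from `j` to this first edge `i`, but never past an undeleted edge, which is the first of
its own path (`FinTree.le_first_of_anc`). -/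
theorem branch_first (h : StepCtx S τ M) (ht : IsTransition c τ M ν τ') {p q j : N}
    (hpq : Feeds τ M p q) (hj : Above τ p j) :
    ∃ i, Above τ p i ∧ Above τ' q i ∧ ¬ Deleted τ M i ∧ τ.Le i j ∧
      (τ.acc j → τ'.acc i ∧ (i ≠ j → Refreshed τ M i)) ∧
      (∀ f, Above τ p f → ¬ Deleted τ M f → τ.anc f j → τ.Le f i) ∧
      (¬ Deleted τ M j → i = j) := by
  obtain ⟨l, rfl, hl⟩ := feeds_iff.1 hpq
  have hjq := (h.above_iff hl).1 hj
  have hjn : (prune τ M).node (.inl j) := by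
    rcases hjq with h1 | h1
    · exact absurd h1 (by simp)
    · exact h.tree.node_left h1
  obtain ⟨v, hv, hvq⟩ := h.tree.exists_onPath_le hjn (leaf_edge hl) hjq
  obtain ⟨x, hx⟩ := h.tree.exists_first hv.1
  have hxj := h.tree.first_le hx hv
  rcases x with i | q'
  · have hid : HasIdentifier τ M ν v i := .inl hx
    have hij : τ.Le i j := hxj.imp (fun h => Sum.inl_injective h) fun h => h.2.2
    refine ⟨i, (h.above_iff hl).2 (h.tree.le_trans hx.1.le hvq),
      (h.above_target_iff ht hid hl).2 hvq, h.not_deleted_of_first hx, hij, fun ha => ⟨?_, ?_⟩, ?_, ?_⟩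
    · exact (ht.acc_iff v i hv.1 hid).2 ⟨_, hv, ha⟩
    · exact fun hne => ⟨v, hx, _, hv, fun h => hne (Sum.inl_injective h).symm, ha⟩
    · intro f hf hd hfj
      obtain ⟨u, hu⟩ := h.exists_first_of_not_deleted (h.node_of_above hf) hd
      have hfj' : (prune τ M).anc (.inl f) (.inl j) := ⟨hu.1.2.1, hjn, hfj⟩
      exact (h.tree.le_first_of_anc hu hx hv hfj').imp (fun h => Sum.inl_injective h)
        fun h => h.2.2
    · intro hd
      obtain ⟨u, hu⟩ := h.exists_first_of_not_deleted (h.node_of_above hj) hd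
      obtain rfl := h.tree.onPath_unique hu.1 hv
      exact Sum.inl_injective (h.tree.first_unique hx hu)
  · exact absurd (eq_inr_of_le hxj) (by simp)

theorem branch_anc_iff (h : StepCtx S τ M) (ht : IsTransition c τ M ν τ') {f j : N}
    (hf : τ.node f) (hj : τ.node j) (hdf : ¬ Deleted τ M f) (hdj : ¬ Deleted τ M j) :
    τ'.anc f j ↔ τ.anc f j := by
  obtain ⟨u, hu⟩ := h.exists_first_of_not_deleted hf hdf
  obtain ⟨w, hw⟩ := h.exists_first_of_not_deleted hj hdj
  rw [anc_iff ht (.inl hu) (.inl hw), h.tree.first_anc_iff hu hw]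
  exact ⟨fun h => h.2.2, fun h => ⟨hu.1.2.1, hw.1.2.1, h⟩⟩

/-- Fresh identifiers are given to leaf edges only, so an inner edge of the new branch is an old
one. -/
theorem branch_old_or_leaf (h : StepCtx S τ M) (ht : IsTransition c τ M ν τ') {p q i : N}
    (hpq : Feeds τ M p q) (hn : τ'.node i) (hi : Above τ' q i) :
    (Above τ p i ∧ ¬ Deleted τ M i) ∨ τ'.Leaf i := by
  obtain ⟨l, rfl, hl⟩ := feeds_iff.1 hpq
  obtain ⟨v, hv | ⟨q', rfl, hq', rfl⟩⟩ := (node_iff ht).1 hn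
  · exact .inl ⟨(h.above_iff hl).2 ((h.above_target_iff_onPath ht (.inl hv) hv.1 hl).1 hi),
      h.not_deleted_of_first hv⟩
  · exact .inr ((h.leaf_target_iff ht (.inr ⟨q', rfl, hq', rfl⟩)).2 (leaf_inr hq'.1.2.1))

/-- The new accepting edge makes the path that ends at its leaf accepting. An undeleted edge of the
branch is strictly above that path unless it is its first edge, and then it is refreshed. -/
theorem branch_star (h : StepCtx S τ M) (ht : IsTransition c τ M ν τ') {p q : N}
    (hp : Alive τ p) (hs : M p q = Mark.star) :
    ∃ i, Above τ' q i ∧ τ'.acc i ∧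
      ∀ f, Above τ p f → ¬ Deleted τ M f → ¬ Refreshed τ M f → τ'.anc f i := by
  obtain ⟨l, hl', rfl⟩ := hp
  have hl : EdgeFrom τ M l q := ⟨hl', by rw [hs]; exact nofun⟩
  have hq := leaf_edge hl
  have hk := FinTree.kept_of_leaf hq
  obtain ⟨i, hi⟩ := h.exists_hasIdentifier (ν := ν) hk
  have ha : (prune τ M).acc (.inr q) := ⟨l, hl', hs⟩
  refine ⟨i, (h.above_target_iff ht hi hl).2 (.inl rfl), (ht.acc_iff _ i hk hi).2
    ⟨_, hk.onPath, ha⟩, fun f hf hd hr => ?_⟩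
  obtain ⟨u, hu⟩ := h.exists_first_of_not_deleted (h.node_of_above hf) hd
  rcases (h.tree.le_leaf_iff hu.1 hq).1 ((h.above_iff hl).1 hf) with rfl | h1
  · exact absurd ⟨_, hu, _, hk.onPath, by simp, ha⟩ hr
  · exact (anc_iff ht (.inl hu) hi).2 h1

end StepCtx

end Step

end QDag

namespace QDag

open SOA

/-! ### Definable labels and letters -/

section Families

variable {N : Type u} [CommSemiring N] [LinearOrder N] [IsStrictOrderedRing N]
  [CanonicallyOrderedAdd N]
variable {S : Set (Set N)} [hS : Fact (ModelsRCA0 S)]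
variable {A B : Type u} [Coded S A] [Coded S B]

variable (S) in
/-- The labels of a family of schemes belong to the second-order part. -/
class LabelFam (τ : A → Scheme N) : Prop where
  label_inS : InS S fun p : A × N × N => (τ p.1).node p.2.1 ∧ (τ p.1).label p.2.1 = p.2.2

variable (S) in
/-- A family of letters belongs to the second-order part. -/
class LetterFam (M : A → Letter N) : Prop where
  one_inS : InS S fun p : A × N × N => M p.1 p.2.1 p.2.2 = Mark.one
  star_inS : InS S fun p : A × N × N => M p.1 p.2.1 p.2.2 = Mark.star

instance (priority := low) LabelFam.subst {τ : A → Scheme N} {f : B → A} [hT : LabelFam S τ]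
    [hf : FunS S f] : LabelFam S fun b => τ (f b) where
  label_inS := hT.label_inS.comp (f := fun p : B × N × N => (f p.1, p.2)) inferInstance

instance (priority := low) LetterFam.subst {M : A → Letter N} {f : B → A} [hM : LetterFam S M]
    [hf : FunS S f] : LetterFam S fun b => M (f b) where
  one_inS := hM.one_inS.comp (f := fun p : B × N × N => (f p.1, p.2)) inferInstance
  star_inS := hM.star_inS.comp (f := fun p : B × N × N => (f p.1, p.2)) inferInstance

section

variable {τ : A → Scheme N} {M : A → Letter N} {f g : A → N} [hf : FunS S f] [hg : FunS S g]

instance InS.label [hL : LabelFam S τ] :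
    InS S fun a => (τ a).node (f a) ∧ (τ a).label (f a) = g a :=
  hL.label_inS.comp (f := fun a => (a, f a, g a)) inferInstance

instance InS.star [hM : LetterFam S M] : InS S fun a => M a (f a) (g a) = Mark.star :=
  hM.star_inS.comp (f := fun a => (a, f a, g a)) inferInstance

instance InS.ne_zero [hM : LetterFam S M] : InS S fun a => M a (f a) (g a) ≠ Mark.zero := by
  have : InS S fun a => M a (f a) (g a) = Mark.one :=
    hM.one_inS.comp (f := fun a => (a, f a, g a)) inferInstance
  refine InS.congr (P := fun a => M a (f a) (g a) = Mark.one ∨ M a (f a) (g a) = Mark.star)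
    fun a => ?_
  cases M a (f a) (g a) <;> simp

instance InS.alive [hT : TreeFam S τ] [hL : LabelFam S τ] : InS S fun a => Alive (τ a) (f a) :=
  InS.congr (P := fun a => ∃ l, (τ a).node l ∧ ((τ a).Leaf l ∧
    ((τ a).node l ∧ (τ a).label l = f a))) fun _ =>
    ⟨fun ⟨l, h1, h2⟩ => ⟨l, h1.1, h1, h1.1, h2⟩, fun ⟨l, _, h1, _, h2⟩ => ⟨l, h1, h2⟩⟩

instance InS.above [hT : TreeFam S τ] [hL : LabelFam S τ] :
    InS S fun a => Above (τ a) (f a) (g a) :=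
  InS.congr (P := fun a => ∃ l, (τ a).node l ∧ ((τ a).Leaf l ∧
    (((τ a).node l ∧ (τ a).label l = f a) ∧ (τ a).Le (g a) l))) fun _ =>
    ⟨fun ⟨l, h1, h2, h3⟩ => ⟨l, h1.1, h1, ⟨h1.1, h2⟩, h3⟩,
      fun ⟨l, _, h1, h2, h3⟩ => ⟨l, h1, h2.2, h3⟩⟩

end

/-- Labels are available only through their graph on nodes; the bound `b` makes the quantifier over
the value of a label harmless. -/
theorem StepFam.of_label {τ : A → Scheme N} {M : A → Letter N} (hT : TreeFam S τ)
    (hL : LabelFam S τ) (hM : LetterFam S M)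
    (ha : InS S fun p : A × N => (τ p.1).node p.2 ∧ (τ p.1).acc p.2) {b : N}
    (hl : ∀ a i, (τ a).node i → (τ a).label i ≤ b) (hb : ∀ a p q, M a p q ≠ Mark.zero → q ≤ b) :
    StepFam S τ M where
  tree := hT
  acc_inS := ha
  edge_bdd := ⟨b, fun a p q h => hb a _ q h.2⟩
  edge_inS := InS.congr (P := fun p : A × N × N => (τ p.1).Leaf p.2.1 ∧ ∃ r, r ≤ b ∧
      (((τ p.1).node p.2.1 ∧ (τ p.1).label p.2.1 = r) ∧ M p.1 r p.2.2 ≠ Mark.zero)) fun p => by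
    refine and_congr_right fun h => ⟨fun h' => ⟨_, hl _ _ h.1, ⟨h.1, rfl⟩, h'⟩, ?_⟩
    rintro ⟨r, _, ⟨_, rfl⟩, h'⟩
    exact h'
  star_inS := InS.congr (P := fun p : A × N => ∃ l, (τ p.1).node l ∧ ((τ p.1).Leaf l ∧ ∃ r, r ≤ b ∧
      (((τ p.1).node l ∧ (τ p.1).label l = r) ∧ M p.1 r p.2 = Mark.star))) fun p => by
    constructor
    · rintro ⟨l, h1, h2⟩
      exact ⟨l, h1.1, h1, _, hl _ _ h1.1, ⟨h1.1, rfl⟩, h2⟩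
    · rintro ⟨l, _, h1, r, _, ⟨_, rfl⟩, h2⟩
      exact ⟨l, h1, h2⟩

theorem LetterFam.of_isQDag {Q : Set N} {α : N → Letter N} (h : IsQDag S Q α) :
    LetterFam S α where
  one_inS := isRel₃_iff.1 h.coded_one
  star_inS := isRel₃_iff.1 h.coded_star

theorem exists_bound_of_isFiniteSet {Q : Set N} {c : N} (h : IsFiniteSet S Q c) :
    ∃ b, ∀ q ∈ Q, q ≤ b := by
  obtain ⟨_, f, hf, hb⟩ := h
  have hf' := isFun₁_iff.1 hf
  have key : ∀ k : N, ∃ b, ∀ i, i ≤ k → f i ≤ b := by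
    intro k
    refine sigma_induction (S := S) (B := N) (fun p => ∀ i, i ≤ p.1 → f i ≤ p.2) inferInstance
      (fun _ => Iff.rfl) ⟨f 0, fun i hi => (congrArg f (le_antisymm hi zero_le)).le⟩ ?_ k
    rintro k ⟨b, hb⟩
    refine ⟨max b (f (k + 1)), fun i hi => ?_⟩
    rcases (le_succ_iff hS.out).1 hi with hi | rfl
    · exact (hb i hi).trans (le_max_left _ _)
    · exact le_max_right _ _
  obtain ⟨b, hb'⟩ := key c
  refine ⟨b, fun q hq => ?_⟩
  obtain ⟨i, hi, rfl⟩ := hb.surjOn hq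
  exact hb' i (le_of_lt hi)

end Families

/-! ### The ancestor relation of the dag -/

section Ancestors

variable {N : Type u} [CommSemiring N] [LinearOrder N] [IsStrictOrderedRing N]
  [CanonicallyOrderedAdd N]
variable {S : Set (Set N)} [hS : Fact (ModelsRCA0 S)]

variable (S) in
/-- `D n q m p` says that the node `(p, m)` of the dag is an ancestor of the node `(q, n)`. -/
structure IsAncestry (α : N → Letter N) (b : N) (D : N → N → N → N → Prop) : Prop where
  inS : InS S fun x : N × N × N × N => D x.1 x.2.1 x.2.2.1 x.2.2.2
  refl_iff : ∀ n q p, D n q n p ↔ q = p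
  succ_iff : ∀ n q m p, m ≤ n → (D (n + 1) q m p ↔ ∃ r, D n r m p ∧ α n r q ≠ Mark.zero)

/-- Recursion on `k` produces, for each node `(p, m)`, a finite code `f ((m, p), k)` of its
descendants at level `m + k`. -/
theorem exists_isAncestry {α : N → Letter N} (hα : LetterFam S α) {b : N}
    (hb : ∀ n p q, α n p q ≠ Mark.zero → p ≤ b ∧ q ≤ b) : ∃ D, IsAncestry S α b D := by
  obtain ⟨g, hg, hg'⟩ := exists_finCode_fun (S := S) (A := N × N)
    (P := fun x => x.2 = x.1.2) inferInstance (fun x => x.2)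
  obtain ⟨h, hh, hh'⟩ := exists_finCode_fun (S := S) (A := (N × N) × N × FinCode N)
    (P := fun x => ∃ r, r ≤ b ∧ (FinCode.Mem r x.1.2.2 ∧
      α (x.1.1.1 + x.1.2.1) r x.2 ≠ Mark.zero)) inferInstance (fun _ => b)
  obtain ⟨f, hf, h0, h1⟩ := exists_recursion hg hh
  have huniq : ∀ {m k k' : N}, m + k = m + k' → k = k' := fun h => add_left_cancel h
  refine ⟨fun n q m p => ∃ k, k ≤ n ∧ (m + k = n ∧ FinCode.Mem q (f ((m, p), k))),
    inferInstance, fun n q p => ⟨?_, ?_⟩, fun n q m p hmn => ⟨?_, ?_⟩⟩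
  · rintro ⟨k, _, h2, h3⟩
    obtain rfl : k = 0 := by simpa using h2
    rw [h0] at h3
    exact ((hg' _ _).1 h3).2
  · rintro rfl
    refine ⟨0, zero_le, add_zero _, ?_⟩
    rw [h0]
    exact (hg' _ _).2 ⟨le_rfl, rfl⟩
  · rintro ⟨k, _, h2, h3⟩
    rcases eq_zero_or_succ hS.out k with rfl | ⟨k, rfl⟩
    · rw [add_zero] at h2
      exact absurd (h2 ▸ hmn) (not_le.2 (lt_add_one _))
    · obtain rfl : m + k = n := by
        rw [← add_assoc] at h2
        exact add_right_cancel h2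
      rw [h1] at h3
      obtain ⟨_, r, _, h4, h5⟩ := (hh' _ _).1 h3
      exact ⟨r, ⟨k, le_add_self, rfl, h4⟩, h5⟩
  · rintro ⟨r, ⟨k, _, rfl, h3⟩, h4⟩
    refine ⟨k + 1, by rw [add_assoc]; exact le_add_self, (add_assoc _ _ _).symm, ?_⟩
    rw [h1]
    exact (hh' _ _).2 ⟨(hb _ _ _ h4).2, r, (hb _ _ _ h4).1, h3, h4⟩

variable {α : N → Letter N} {b : N} {D : N → N → N → N → Prop}

namespace IsAncestry

theorem inS_comp (h : IsAncestry S α b D) {A : Type u} [Coded S A] (f g k l : A → N) [FunS S f]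
    [FunS S g] [FunS S k] [FunS S l] : InS S fun a => D (f a) (g a) (k a) (l a) :=
  h.inS.comp (f := fun a => (f a, g a, k a, l a)) inferInstance

/-- Tree shape makes the way back from a node unique, so the ancestor at the earlier level is
reached through the one at the later level. -/
theorem middle (h : IsAncestry S α b D) (hs : ∀ n, (α n).TreeShaped)
    (hb : ∀ n p q, α n p q ≠ Mark.zero → p ≤ b ∧ q ≤ b) {n q m p l r : N} (hlm : l ≤ m)
    (hmn : m ≤ n) (h1 : D n q m p) (h2 : D n q l r) : D m p l r := by
  have hD := @inS_comp _ _ _ _ _ _ _ _ _ _ h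
  -- The bound keeps the induction inside the second-order part; it covers `q` and every source of
  -- an edge.
  have key : ∀ x, x ≤ max b q → D n x m p → D n x l r → D m p l r := by
    refine InS.induction_from (S := S) (P := fun n => ∀ x, x ≤ max b q → D n x m p → D n x l r →
      D m p l r) inferInstance m ?_ ?_ hmn
    · intro x _ h3 h4
      rwa [(h.refl_iff _ _ _).1 h3] at h4
    · intro n hn ih x _ h3 h4
      obtain ⟨y, h5, h6⟩ := (h.succ_iff _ _ _ _ hn).1 h3
      obtain ⟨y', h7, h8⟩ := (h.succ_iff _ _ _ _ (hlm.trans hn)).1 h4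
      obtain rfl := hs n y y' x h6 h8
      exact ih y ((hb _ _ _ h6).1.trans (le_max_left _ _)) h5 h7
  exact key q (le_max_right _ _) h1 h2

theorem unique (h : IsAncestry S α b D) (hs : ∀ n, (α n).TreeShaped)
    (hb : ∀ n p q, α n p q ≠ Mark.zero → p ≤ b ∧ q ≤ b) {n q m p r : N}
    (hmn : m ≤ n) (h1 : D n q m p) (h2 : D n q m r) : p = r :=
  (h.refl_iff _ _ _).1 (h.middle hs hb le_rfl hmn h1 h2)

theorem trans (h : IsAncestry S α b D)
    (hb : ∀ n p q, α n p q ≠ Mark.zero → p ≤ b ∧ q ≤ b) {n q m p l r : N} (hlm : l ≤ m)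
    (hmn : m ≤ n) (h1 : D n q m p) (h2 : D m p l r) : D n q l r := by
  have hD := @inS_comp _ _ _ _ _ _ _ _ _ _ h
  have key : ∀ x, x ≤ max b q → D n x m p → D n x l r := by
    refine InS.induction_from (S := S) (P := fun n => ∀ x, x ≤ max b q → D n x m p → D n x l r)
      inferInstance m ?_ ?_ hmn
    · intro x _ h3
      rwa [(h.refl_iff _ _ _).1 h3]
    · intro n hn ih x _ h3
      obtain ⟨y, h5, h6⟩ := (h.succ_iff _ _ _ _ hn).1 h3
      exact (h.succ_iff _ _ _ _ (hlm.trans hn)).2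
        ⟨y, ih y ((hb _ _ _ h6).1.trans (le_max_left _ _)) h5, h6⟩
  exact key q (le_max_right _ _) h1

theorem edge (h : IsAncestry S α b D) (hs : ∀ n, (α n).TreeShaped)
    (hb : ∀ n p q, α n p q ≠ Mark.zero → p ≤ b ∧ q ≤ b) {n q m p r : N} (hmn : m + 1 ≤ n)
    (h1 : D n q m p) (h2 : D n q (m + 1) r) : α m p r ≠ Mark.zero := by
  obtain ⟨x, h3, h4⟩ := (h.succ_iff _ _ _ _ le_rfl).1 (h.middle hs hb le_self_add hmn h2 h1)
  rwa [(h.refl_iff _ _ _).1 h3] at h4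

end IsAncestry

end Ancestors

end QDag

namespace QDag

open SOA

/-! ### Runs, and accepting paths from infinitely many refreshments -/

section Runs

variable {N : Type u} [CommSemiring N] [LinearOrder N] [IsStrictOrderedRing N]
  [CanonicallyOrderedAdd N]
variable {S : Set (Set N)} [hS : Fact (ModelsRCA0 S)]

variable (S) in
/-- A run over a tree-shaped dag, with a bound `b` for the states. -/
structure RunCtx (Q : Set N) (c qI b : N) (α : N → Letter N) (ρ : N → Scheme N)
    (ν : N → N → N) : Prop where
  run : IsRun S Q c qI α ρ ν
  dag : IsQDag S Q α
  shaped : ∀ n, (α n).TreeShaped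
  bound : ∀ q ∈ Q, q ≤ b

variable {Q : Set N} {c qI b : N} {α : N → Letter N} {ρ : N → Scheme N} {ν : N → N → N}

namespace RunCtx

theorem node_le (h : RunCtx S Q c qI b α ρ ν) {n i : N} (hi : (ρ n).node i) : i ≤ 2 * c := by
  rcases h.run.state n with hs | hs
  · exact hs.identifier_le i hi
  · exact absurd hi (hs.1 i)

theorem label_mem (h : RunCtx S Q c qI b α ρ ν) {n i : N} (hi : (ρ n).node i) :
    (ρ n).label i ∈ Q := by
  rcases h.run.state n with hs | hs
  · exact hs.label_mem i hi
  · exact absurd hi (hs.1 i)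

theorem alive_le (h : RunCtx S Q c qI b α ρ ν) {n q : N} (hq : Alive (ρ n) q) : q ≤ b := by
  obtain ⟨l, hl, rfl⟩ := hq
  exact h.bound _ (h.label_mem hl.1)

theorem letter_le (h : RunCtx S Q c qI b α ρ ν) (n p q : N) (hpq : α n p q ≠ Mark.zero) :
    p ≤ b ∧ q ≤ b :=
  ⟨h.bound _ (h.dag.mem n p q hpq).1, h.bound _ (h.dag.mem n p q hpq).2⟩

theorem treeFam (h : RunCtx S Q c qI b α ρ ν) : TreeFam S ρ where
  node_inS := isRel₂_iff.1 h.run.coded_node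
  anc_inS := isRel₃_iff.1 h.run.coded_anc
  bdd := ⟨2 * c, fun _ _ => h.node_le⟩
  anc_node n i j hij := by
    rcases h.run.state n with hs | hs
    · exact hs.anc_node i j hij
    · exact absurd hij (hs.2.1 i j)

theorem labelFam (h : RunCtx S Q c qI b α ρ ν) : LabelFam S ρ where
  label_inS := isRel₃_iff.1 h.run.coded_label

theorem letterFam (h : RunCtx S Q c qI b α ρ ν) : LetterFam S α := .of_isQDag h.dag

theorem acc_inS (h : RunCtx S Q c qI b α ρ ν) {A : Type u} [Coded S A] (f g : A → N) [FunS S f]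
    [FunS S g] : InS S fun a => (ρ (f a)).node (g a) ∧ (ρ (f a)).acc (g a) :=
  h.run.coded_acc.inS f g

theorem stepFam (h : RunCtx S Q c qI b α ρ ν) : StepFam S ρ α :=
  .of_label h.treeFam h.labelFam h.letterFam (isRel₂_iff.1 h.run.coded_acc)
    (fun _ _ hi => h.bound _ (h.label_mem hi)) fun n p q hpq => (h.letter_le n p q hpq).2

theorem isState (h : RunCtx S Q c qI b α ρ ν) (n : N) : IsState S (ρ n) := by
  refine ⟨⟨TreeFam.subst (hT := h.treeFam) (f := fun _ : N => n), ?_, ?_, ?_⟩, ?_⟩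
  all_goals rcases h.run.state n with hs | hs
  · exact hs.anc_irrefl
  · exact fun v => hs.2.1 v v
  · exact @fun u v w => hs.anc_trans u v w
  · exact @fun u v w h1 => absurd h1 (hs.2.1 u v)
  · exact @fun u v w => hs.anc_linear u v w
  · exact @fun u v w h1 => absurd h1 (hs.2.1 u w)
  · exact hs.leaf_unique
  · exact fun i j h1 => absurd h1.1 (hs.1 i)

theorem stepCtx (h : RunCtx S Q c qI b α ρ ν) (n : N) : StepCtx S (ρ n) (α n) :=
  ⟨h.isState n, h.shaped n, StepFam.subst (h := h.stepFam) (f := fun _ : N => n)⟩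

theorem alive_succ_iff (h : RunCtx S Q c qI b α ρ ν) {n q : N} :
    Alive (ρ (n + 1)) q ↔ ∃ p, Feeds (ρ n) (α n) p q :=
  (h.stepCtx n).alive_target_iff (h.run.transition n)

theorem alive_zero (h : RunCtx S Q c qI b α ρ ν) {q : N} : Alive (ρ 0) q ↔ q = qI := by
  obtain ⟨h1, h2, h3, _⟩ := h.run.initial
  constructor
  · rintro ⟨l, hl, rfl⟩
    rw [(h1 l).1 hl.1, h3]
  · rintro rfl
    exact ⟨0, ⟨(h1 0).2 rfl, fun _ _ => h2 _ _⟩, h3⟩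

/-- Every edge of a scheme lies on the branch of some leaf. -/
theorem exists_above (h : RunCtx S Q c qI b α ρ ν) {n i : N} (hi : (ρ n).node i) :
    ∃ q, Above (ρ n) q i := by
  obtain ⟨l, hl, h1⟩ := (h.isState n).tree.exists_leaf hi
  exact ⟨_, l, hl, rfl, h1⟩

/-- Some leaf below `i` is not below a given strict descendant of `i`. -/
theorem exists_above_not_above (h : RunCtx S Q c qI b α ρ ν) {n i j : N} (hij : (ρ n).anc i j) :
    ∃ q, Above (ρ n) q i ∧ ¬ Above (ρ n) q j := by
  have ht := (h.isState n).tree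
  have hi := ht.node_left hij
  rcases h.run.state n with hs | hs
  swap
  · exact absurd hi (hs.1 i)
  obtain ⟨x, y, hxy, hx, hy⟩ := hs.branching i hi fun hl => hl.2 j (ht.node_right hij) hij
  obtain ⟨w, hw, hwj⟩ := ht.exists_child hij
  obtain ⟨z, hz, hzw⟩ : ∃ z, (ρ n).Child i z ∧ z ≠ w := by
    rcases eq_or_ne x w with rfl | hxw
    · exact ⟨y, hy, hxy.symm⟩
    · exact ⟨x, hx, hxw⟩
  obtain ⟨l, hl, hzl⟩ := ht.exists_leaf hz.2.1
  refine ⟨_, ⟨l, hl, rfl, .inr (ht.anc_of_anc_of_le hz.2.2.1 hzl)⟩, ?_⟩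
  rintro ⟨l', hl', h1, h2⟩
  obtain rfl := hs.leaf_unique _ _ hl' hl h1
  exact hzw (ht.child_unique hz hw hzl (ht.le_trans hwj h2))

variable {D : N → N → N → N → Prop}

theorem root_ancestor (h : RunCtx S Q c qI b α ρ ν) (hD : IsAncestry S α b D) {n q : N}
    (hq : Alive (ρ n) q) : D n q 0 qI := by
  have hD' := @hD.inS_comp
  have := h.treeFam
  have := h.labelFam
  have key : ∀ q, q ≤ b → Alive (ρ n) q → D n q 0 qI := by
    refine InS.induction (S := S) (P := fun n => ∀ q, q ≤ b → Alive (ρ n) q → D n q 0 qI)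
      inferInstance ?_ ?_ n
    · intro q _ hq
      exact (hD.refl_iff _ _ _).2 (h.alive_zero.1 hq)
    · intro n ih q _ hq
      obtain ⟨p, hp, hpq⟩ := h.alive_succ_iff.1 hq
      exact (hD.succ_iff _ _ _ _ zero_le).2 ⟨p, ih p (h.alive_le hp) hp, hpq⟩
  exact key q (h.alive_le hq) hq

theorem exists_ancestor (h : RunCtx S Q c qI b α ρ ν) (hD : IsAncestry S α b D) {n q m : N}
    (hmn : m ≤ n) (hq : Alive (ρ n) q) : ∃ p, D n q m p := by
  have hD' := @hD.inS_comp
  have := h.treeFam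
  have := h.labelFam
  have key : ∀ q, q ≤ b → Alive (ρ n) q → ∃ p, p ≤ b ∧ D n q m p := by
    refine InS.induction_from (S := S) (P := fun n => ∀ q, q ≤ b → Alive (ρ n) q →
      ∃ p, p ≤ b ∧ D n q m p) inferInstance m ?_ ?_ hmn
    · intro q hb _
      exact ⟨q, hb, (hD.refl_iff _ _ _).2 rfl⟩
    · intro n hn ih q _ hq
      obtain ⟨p, hp, hpq⟩ := h.alive_succ_iff.1 hq
      obtain ⟨r, hr, h1⟩ := ih p (h.alive_le hp) hp
      exact ⟨r, hr, (hD.succ_iff _ _ _ _ hn).2 ⟨p, h1, hpq⟩⟩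
  obtain ⟨p, _, hp⟩ := key q (h.alive_le hq) hq
  exact ⟨p, hp⟩

theorem ancestor_succ_iff (h : RunCtx S Q c qI b α ρ ν) (hD : IsAncestry S α b D) {n p q m r : N}
    (hmn : m ≤ n) (hpq : Feeds (ρ n) (α n) p q) : D (n + 1) q m r ↔ D n p m r := by
  rw [hD.succ_iff _ _ _ _ hmn]
  constructor
  · rintro ⟨p', h1, h2⟩
    rwa [h.shaped n p p' q hpq.2 h2]
  · exact fun h1 => ⟨p, h1, hpq.2⟩

/-- An accepting edge of a scheme comes from an accepting edge of the dag, and the leaves below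
the former are exactly the leaves below the latter. -/
theorem accepting_spec (h : RunCtx S Q c qI b α ρ ν) (hD : IsAncestry S α b D) {n j : N}
    (hj : (ρ n).node j) (ha : (ρ n).acc j) : ∃ m p r, m < n ∧ α m p r = Mark.star ∧
      ∀ q, Alive (ρ n) q → (D n q (m + 1) r ↔ Above (ρ n) q j) := by
  have hD' := @hD.inS_comp
  have := h.treeFam
  have := h.labelFam
  have := h.letterFam
  have hacc := @h.acc_inS
  have hleaves : ∀ {A : Type u} [Coded S A] (f g k l : A → N) [FunS S f] [FunS S g] [FunS S k]
      [FunS S l], InS S fun a => ∀ q, q ≤ b → Alive (ρ (f a)) q →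
        (D (f a) q (g a) (k a) ↔ Above (ρ (f a)) q (l a)) := by
    intro A _ f g k l _ _ _ _
    infer_instance
  have hstar : ∀ {A : Type u} [Coded S A] (f g k : A → N) [FunS S f] [FunS S g] [FunS S k],
      InS S fun a => α (f a) (g a) (k a) = Mark.star := by
    intro A _ f g k _ _ _
    infer_instance
  have hbody : InS S fun y : ((((N × N) × N) × N) × N) =>
      y.1.1.2 < y.1.1.1.1 ∧ α y.1.1.2 y.1.2 y.2 = Mark.star ∧ ∀ q, q ≤ b → Alive (ρ y.1.1.1.1) q →
        (D y.1.1.1.1 q (y.1.1.2 + 1) y.2 ↔ Above (ρ y.1.1.1.1) q y.1.1.1.2) := by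
    infer_instance
  -- All witnesses are bounded, so that the induction on `n` concerns a predicate of the
  -- second-order part.
  have key : ∀ j, j ≤ 2 * c → ((ρ n).node j ∧ (ρ n).acc j) → ∃ m, m ≤ n ∧ ∃ p, p ≤ b ∧ ∃ r, r ≤ b ∧
      (m < n ∧ α m p r = Mark.star ∧ ∀ q, q ≤ b → Alive (ρ n) q →
        (D n q (m + 1) r ↔ Above (ρ n) q j)) := by
    refine InS.induction (S := S) (P := fun n => ∀ j, j ≤ 2 * c → ((ρ n).node j ∧ (ρ n).acc j) →
      ∃ m, m ≤ n ∧ ∃ p, p ≤ b ∧ ∃ r, r ≤ b ∧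
      (m < n ∧ α m p r = Mark.star ∧ ∀ q, q ≤ b → Alive (ρ n) q →
        (D n q (m + 1) r ↔ Above (ρ n) q j))) inferInstance ?_ ?_ n
    · rintro j _ ⟨hj, ha⟩
      obtain ⟨h1, _, _, h4, _⟩ := h.run.initial
      rw [(h1 j).1 hj] at ha
      exact absurd ha h4
    · rintro n ih j _ ⟨hj, ha⟩
      rcases (h.stepCtx n).accepting_target (h.run.transition n) hj ha with
        ⟨j₀, hj₀, ha₀, h1⟩ | ⟨p₀, q₀, h1, h2, h3⟩
      · obtain ⟨m, _, p, hp, r, hr, hmn, hs, h2⟩ := ih j₀ (h.node_le hj₀) ⟨hj₀, ha₀⟩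
        refine ⟨m, (hmn.trans (lt_add_one _)).le, p, hp, r, hr, hmn.trans (lt_add_one _), hs, ?_⟩
        intro q _ hq
        obtain ⟨p', hp'⟩ := h.alive_succ_iff.1 hq
        rw [h.ancestor_succ_iff hD (succ_le_of_lt hS.out hmn) hp', h1 p' q hp',
          h2 p' (h.alive_le hp'.1) hp'.1]
      · refine ⟨n, le_self_add, p₀, h.alive_le h1.1, q₀, (h.letter_le _ _ _ h1.2).2, lt_add_one _,
          h2, ?_⟩
        intro q _ hq
        obtain ⟨p', hp'⟩ := h.alive_succ_iff.1 hq
        rw [hD.refl_iff, h3 p' q hp']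
  obtain ⟨m, _, p, _, r, _, hmn, hs, h1⟩ := key j (h.node_le hj) ⟨hj, ha⟩
  exact ⟨m, p, r, hmn, hs, fun q hq => h1 q (h.alive_le hq) hq⟩

/-- Refreshments of the permanent edge `i` exhibit accepting dag edges at unbounded levels that lie
above all leaves below `i`; the common ancestors of these leaves are the path. -/
theorem hasAcceptingPath_of_refreshed (h : RunCtx S Q c qI b α ρ ν) {i : N}
    (hd : FinitelyOften fun n => Deleted (ρ n) (α n) i)
    (hr : InfinitelyOften fun n => Refreshed (ρ n) (α n) i) : HasAcceptingPath S qI α := by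
  have hfT := h.treeFam
  have hfL := h.labelFam
  have hfM := h.letterFam
  obtain ⟨D, hD⟩ := exists_isAncestry h.letterFam h.letter_le
  have hD' := @hD.inS_comp
  obtain ⟨t₀, ht₀⟩ := hd
  obtain ⟨t₁, ht₁, hrt⟩ := hr t₀
  -- A refreshment at `t₁` ensures that the identifier `i` is present from `t` on.
  let t := t₁ + 1
  have htt : t₀ ≤ t := ht₁.trans le_self_add
  have hnode : ∀ n, t ≤ n → (ρ n).node i := by
    intro n hn
    refine InS.induction_from (S := S) (P := fun n => (ρ n).node i) inferInstance t ?_ ?_ hn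
    · exact ((h.stepCtx t₁).refreshed_target (h.run.transition t₁) hrt).1
    · intro n hn h1
      exact ((h.stepCtx n).survives (h.run.transition n) h1 (ht₀ n (htt.trans hn))).1
  have hback : ∀ n, t ≤ n → ∀ q, Above (ρ (n + 1)) q i →
      ∃ p, Feeds (ρ n) (α n) p q ∧ Above (ρ n) p i := by
    intro n hn q hq
    obtain ⟨l, hl, h1, h2⟩ := id hq
    obtain ⟨p, hp⟩ := h.alive_succ_iff.1 ⟨l, hl, h1⟩
    exact ⟨p, hp, (((h.stepCtx n).survives (h.run.transition n) (hnode n hn)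
      (ht₀ n (htt.trans hn))).2 p q hp).1 hq⟩
  have halive : ∀ {n q j}, Above (ρ n) q j → Alive (ρ n) q := fun ⟨l, hl, h1, _⟩ => ⟨l, hl, h1⟩
  -- `G n m r`: an accepting edge enters `(r, m + 1)`, and all leaves below `i` at time `n` descend
  -- from this node.
  let G : N → N → N → Prop := fun n m r => m < n ∧ (∃ p, p ≤ b ∧ α m p r = Mark.star) ∧
    ∀ q, q ≤ b → Above (ρ n) q i → D n q (m + 1) r
  have hG : ∀ {A : Type u} [Coded S A] (f g k : A → N) [FunS S f] [FunS S g] [FunS S k],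
      InS S fun a => G (f a) (g a) (k a) := by
    intro A _ f g k _ _ _
    simp only [G]
    infer_instance
  have hGD : ∀ {n m r q}, G n m r → Above (ρ n) q i → D n q (m + 1) r := fun hg hq =>
    hg.2.2 _ (h.alive_le (halive hq)) hq
  have hpersist : ∀ {n m r n'}, t ≤ n → n ≤ n' → G n m r → G n' m r := by
    intro n m r n' hn hn' hg
    refine InS.induction_from (S := S) (P := fun n => G n m r)
      (hG (fun n => n) (fun _ => m) fun _ => r) n hg ?_ hn'
    intro x hx hg
    refine ⟨hg.1.trans (lt_add_one _), hg.2.1, fun q _ hq => ?_⟩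
    obtain ⟨p, hp, hpi⟩ := hback x (hn.trans hx) q hq
    exact (h.ancestor_succ_iff hD (succ_le_of_lt hS.out hg.1) hp).2 (hGD hg hpi)
  have hrefresh : ∀ n, t ≤ n → Refreshed (ρ n) (α n) i →
      ∃ m r, G (n + 1) m r ∧ ∀ m₀ r₀, G n m₀ r₀ → m₀ < m := by
    intro n hn hrn
    rcases ((h.stepCtx n).refreshed_target (h.run.transition n) hrn).2 with
      ⟨j, hij, hj, ha, h1⟩ | ⟨p₀, q₀, h1, h2, h3⟩
    · obtain ⟨m, p, r, hmn, hs, h2⟩ := h.accepting_spec hD hj ha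
      refine ⟨m, r, ⟨hmn.trans (lt_add_one _), ⟨p, (h.letter_le m p r (by rw [hs]; exact nofun)).1,
        hs⟩, fun q _ hq => ?_⟩, fun m₀ r₀ hg => ?_⟩
      · obtain ⟨p', hp', _⟩ := hback n hn q hq
        exact (h.ancestor_succ_iff hD (succ_le_of_lt hS.out hmn) hp').2
          ((h2 p' hp'.1).2 ((h1 p' q hp').1 hq))
      -- If `m ≤ m₀`, then `(r₀, m₀ + 1)` descends from `(r, m + 1)`, as a leaf below `j` shows. All
      -- leaves below `i` would then lie below `j`, whereas branching at `i` gives one that does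
      -- not.
      · by_contra hc
        obtain ⟨q₁, hq₁, hq₁'⟩ := h.exists_above_not_above hij
        obtain ⟨q₂, hq₂⟩ := h.exists_above hj
        have hq₂' : Above (ρ n) q₂ i := by
          obtain ⟨l, hl, h3, h4⟩ := hq₂
          exact ⟨l, hl, h3, (h.isState n).tree.le_trans (.inr hij) h4⟩
        have hle : m + 1 ≤ m₀ + 1 := add_le_add_left (not_lt.1 hc) 1
        have hle' := succ_le_of_lt hS.out hg.1
        have h5 := hD.middle h.shaped h.letter_le hle hle' (hGD hg hq₂')
          ((h2 q₂ (halive hq₂)).2 hq₂)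
        exact hq₁' ((h2 q₁ (halive hq₁)).1 (hD.trans h.letter_le hle hle' (hGD hg hq₁) h5))
    · refine ⟨n, q₀, ⟨lt_add_one _, ⟨p₀, h.alive_le h1.1, h2⟩, fun q _ hq => ?_⟩,
        fun m₀ r₀ hg => hg.1⟩
      obtain ⟨p', hp', _⟩ := hback n hn q hq
      exact (hD.refl_iff _ _ _).2 ((h3 p' q hp').1 hq)
  -- A `Σ⁰₁` induction: the last edge found persists until the next refreshment, which yields one at
  -- a greater level.
  have hunbdd : ∀ k, ∃ x : N × N × N, t ≤ x.1 ∧ k ≤ x.2.1 ∧ G x.1 x.2.1 x.2.2 := by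
    intro k
    refine sigma_induction (S := S) (B := N × N × N)
      (fun y => t ≤ y.2.1 ∧ y.1 ≤ y.2.2.1 ∧ G y.2.1 y.2.2.1 y.2.2.2) inferInstance
      (fun _ => Iff.rfl) ?_ ?_ k
    · obtain ⟨n, hn, hrn⟩ := hr t
      obtain ⟨m, r, hg, _⟩ := hrefresh n hn hrn
      exact ⟨(n + 1, m, r), hn.trans le_self_add, zero_le, hg⟩
    · rintro k ⟨⟨n, m, r⟩, hn, hk, hg⟩
      obtain ⟨n', hn', hrn⟩ := hr n
      obtain ⟨m', r', hg', hlt⟩ := hrefresh n' (hn.trans hn') hrn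
      exact ⟨(n' + 1, m', r'), (hn.trans hn').trans le_self_add,
        succ_le_of_lt hS.out (hk.trans_lt (hlt m r (hpersist hn hn' hg))), hg'⟩
  have hg' : InS S fun y : N × (N × N × N) × N => G y.2.1.1 y.2.1.2.1 y.2.1.2.2 := hG _ _ _
  have hd' : InS S fun y : N × (N × N × N) × N => D (y.2.1.2.1 + 1) y.2.1.2.2 y.1 y.2.2 :=
    hD' _ _ _ _
  -- `F l` contains an edge as in `G` at level at least `l`, together with the ancestor of its
  -- target at level `l`; that ancestor is the `l`-th state of the path.
  obtain ⟨F, hF, hFs⟩ := exists_selector (S := S) (A := N) (B := (N × N × N) × N)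
    (R := fun y => t ≤ y.2.1.1 ∧ y.1 ≤ y.2.1.2.1 ∧ G y.2.1.1 y.2.1.2.1 y.2.1.2.2 ∧
      D (y.2.1.2.1 + 1) y.2.1.2.2 y.1 y.2.2)
    (.and (hP' := .and (hP' := .and (hP := hg') (hP' := hd')))) fun l => by
    obtain ⟨⟨n, m, r⟩, hn, hl, hg⟩ := hunbdd l
    obtain ⟨q, hq⟩ := h.exists_above (hnode n hn)
    have hmn := succ_le_of_lt hS.out hg.1
    have hlm : l ≤ m + 1 := le_trans hl le_self_add
    obtain ⟨p, hp⟩ := h.exists_ancestor hD (hlm.trans hmn) (halive hq)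
    exact ⟨((n, m, r), p), hn, hl, hg, hD.middle h.shaped h.letter_le hlm hmn (hGD hg hq) hp⟩
  have hpath : ∀ l, ∃ n₀, t ≤ n₀ ∧ l < n₀ ∧ ∀ n, n₀ ≤ n → ∀ q, Above (ρ n) q i →
      D n q l (F l).2 := by
    intro l
    obtain ⟨h1, h2, h3, h4⟩ := hFs l
    refine ⟨_, h1, lt_of_le_of_lt h2 h3.1, fun n hn q hq => ?_⟩
    have hg := hpersist h1 hn h3
    exact hD.trans h.letter_le (le_trans h2 le_self_add) (succ_le_of_lt hS.out hg.1) (hGD hg hq) h4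
  have hedge : ∀ l, α l (F l).2 (F (l + 1)).2 ≠ Mark.zero := by
    intro l
    obtain ⟨n₀, h1, h2, h3⟩ := hpath l
    obtain ⟨n₁, h4, h5, h6⟩ := hpath (l + 1)
    obtain ⟨q, hq⟩ := h.exists_above (hnode (max n₀ n₁) (h1.trans (le_max_left _ _)))
    exact hD.edge h.shaped h.letter_le (h5.le.trans (le_max_right _ _))
      (h3 _ (le_max_left _ _) q hq) (h6 _ (le_max_right _ _) q hq)
  refine ⟨fun l => (F l).2, isFun₁_iff.2 inferInstance, ?_, hedge, fun k => ?_⟩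
  · obtain ⟨n₀, h1, h2, h3⟩ := hpath 0
    obtain ⟨q, hq⟩ := h.exists_above (hnode n₀ h1)
    exact hD.unique h.shaped h.letter_le zero_le (h3 n₀ le_rfl q hq)
      (h.root_ancestor hD (halive hq))
  · obtain ⟨⟨n, m, r⟩, hn, hk, hg⟩ := hunbdd k
    obtain ⟨n₀, h1, h2, h3⟩ := hpath (m + 1)
    obtain ⟨q, hq⟩ := h.exists_above (hnode (max n₀ n) (h1.trans (le_max_left _ _)))
    -- The path goes through the target of the accepting edge: both states are ancestors of one late
    -- leaf at the same level. Tree shape then identifies the source as well.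
    have h4 : (F (m + 1)).2 = r := hD.unique h.shaped h.letter_le
      (h2.le.trans (le_max_left _ _)) (h3 _ (le_max_left _ _) q hq)
      (hGD (hpersist hn (le_max_right _ _) hg) hq)
    obtain ⟨p, _, hp⟩ := hg.2.1
    refine ⟨m, hk, ?_⟩
    have h5 : (F m).2 = p := h.shaped m _ _ r (h4 ▸ hedge m)
      (by rw [show α m p r = Mark.star from hp]; exact nofun)
    change α m (F m).2 (F (m + 1)).2 = Mark.star
    rw [h4, h5]
    exact hp

end RunCtx

end Runs

end QDag

namespace QDag

open SOA

/-! ### The branch followed by an accepting path -/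

section Branches

variable {N : Type u} [CommSemiring N] [LinearOrder N] [IsStrictOrderedRing N]
  [CanonicallyOrderedAdd N]
variable {S : Set (Set N)} [hS : Fact (ModelsRCA0 S)]

variable (S) in
/-- The evolution of the branch of a run that follows an accepting path: `B n` is the set of the
edges of the branch at time `n`, of which `A n` are accepting, `anc n` is the order of the branch,
`D n` and `R n` are the edges that are deleted and refreshed in the `n`-th transition. -/
structure IsBranch (K : N) (B A D R : N → N → Prop) (anc : N → N → N → Prop) : Prop where
  branch_inS : InS S fun x : N × N => B x.1 x.2
  acc_inS : InS S fun x : N × N => A x.1 x.2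
  deleted_inS : InS S fun x : N × N => D x.1 x.2
  anc_inS : InS S fun x : N × N × N => anc x.1 x.2.1 x.2.2
  le : ∀ {n i}, B n i → i ≤ K
  acc : ∀ {n i}, A n i → B n i
  irrefl : ∀ n i, ¬ anc n i i
  trans : ∀ {n i j k}, anc n i j → anc n j k → anc n i k
  anc_left : ∀ {n i j}, anc n i j → B n j → B n i
  first : ∀ {n j}, A n j → ∃ i, B n i ∧ A (n + 1) i ∧ ¬ D n i ∧ (i = j ∨ anc n i j) ∧
    (i ≠ j → R n i) ∧ ∀ f, B n f → ¬ D n f → anc n f j → f = i ∨ anc n f i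
  anc_iff : ∀ {n i j}, B n i → B n j → ¬ D n i → ¬ D n j → (anc (n + 1) i j ↔ anc n i j)
  old : ∀ {n i j}, anc (n + 1) i j → B (n + 1) j → B n i ∧ ¬ D n i
  star : InfinitelyOften fun n => ∃ i, A (n + 1) i ∧
    ∀ f, B n f → ¬ D n f → ¬ R n f → anc (n + 1) f i

namespace IsBranch

variable {K : N} {B A D R : N → N → Prop} {anc : N → N → N → Prop}

/-- Given some permanent edges `F` that are not refreshed any more, there is a permanent edge below
them. -/
theorem exists_permanent (hb : IsBranch S K B A D R anc) (hI : ModelsSigma02Ind S) {F : N → Prop}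
    (hF : InS S F) {t : N} (hFt : ∀ f, F f → ∀ n, t ≤ n → B n f ∧ ¬ D n f ∧ ¬ R n f) :
    ∃ e t', t ≤ t' ∧ ∀ n, t' ≤ n → B n e ∧ ¬ D n e ∧ ∀ f, F f → anc n f e := by
  have hB : ∀ {V : Type u} [Coded S V] (f g : V → N) [FunS S f] [FunS S g],
      InS S fun a => B (f a) (g a) := fun f g _ _ =>
    hb.branch_inS.comp (f := fun a => (f a, g a)) inferInstance
  have hA : ∀ {V : Type u} [Coded S V] (f g : V → N) [FunS S f] [FunS S g],
      InS S fun a => A (f a) (g a) := fun f g _ _ =>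
    hb.acc_inS.comp (f := fun a => (f a, g a)) inferInstance
  have hD : ∀ {V : Type u} [Coded S V] (f g : V → N) [FunS S f] [FunS S g],
      InS S fun a => D (f a) (g a) := fun f g _ _ =>
    hb.deleted_inS.comp (f := fun a => (f a, g a)) inferInstance
  have hN : ∀ {V : Type u} [Coded S V] (f g k : V → N) [FunS S f] [FunS S g] [FunS S k],
      InS S fun a => anc (f a) (g a) (k a) := fun f g k _ _ _ =>
    hb.anc_inS.comp (f := fun a => (f a, g a, k a)) inferInstance
  have hFK : ∀ f, F f → f ≤ K := fun f hf => hb.le (hFt f hf t le_rfl).1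
  -- The path supplies an accepting edge `e₀` strictly below all of `F`; it serves as the starting
  -- point at time `n₁`.
  obtain ⟨n₀, hn₀, e₀, he₀, he₀'⟩ := hb.star t
  obtain ⟨n₁, hn₁⟩ : ∃ n₁, n₁ = n₀ + 1 := ⟨_, rfl⟩
  have htn : t ≤ n₁ := hn₁ ▸ hn₀.trans le_self_add
  let W : N → N → Prop := fun n j => A n j ∧ ∀ f, f ≤ K → F f → anc n f j
  have hW : ∀ {V : Type u} [Coded S V] (f g : V → N) [FunS S f] [FunS S g],
      InS S fun a => W (f a) (g a) := by
    intro V _ f g _ _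
    simp only [W]
    infer_instance
  -- Accepting edges below `F` stay below `F`: acceptance moves up to the first edge `i` of a path,
  -- and `i` in `F` would mean a refreshment of a member of `F`.
  have hstep : ∀ n j, t ≤ n → W n j → ∃ i, B n i ∧ ¬ D n i ∧ W (n + 1) i ∧
      (i = j ∨ anc n i j) := by
    intro n j hn hj
    obtain ⟨i, h1, h2, h3, h4, h5, h6⟩ := hb.first hj.1
    refine ⟨i, h1, h3, ⟨h2, fun f _ hf => ?_⟩, h4⟩
    obtain ⟨h7, h8, h9⟩ := hFt f hf n hn
    refine (hb.anc_iff h7 h1 h8 h3).2 ((h6 f h7 h8 (hj.2 f (hFK f hf) hf)).resolve_left ?_)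
    rintro rfl
    refine h9 (h5 ?_)
    rintro rfl
    exact hb.irrefl _ _ (hj.2 f (hFK f hf) hf)
  -- `Z (j, n)`: the edge `j` has survived without deletion from `n₁` to `n` and is accepting below
  -- `F` at time `n`.
  let Z : N × N → Prop := fun x => n₁ ≤ x.2 ∧ W x.2 x.1 ∧
    ∀ m, m ≤ x.2 → n₁ ≤ m → m < x.2 → B m x.1 ∧ ¬ D m x.1
  have hZ : InS S Z := by
    simp only [Z]
    infer_instance
  -- The edges that ever satisfy `Z` form only a `Σ⁰₁` set; strong collection bounds the time and so
  -- puts this set into the structure.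
  obtain ⟨u, hu⟩ := exists_uniform_bound hI hZ K
  have hZB : ∀ {j n}, Z (j, n) → B n₁ j := by
    rintro j n ⟨h1, h2, h3⟩
    rcases eq_or_lt_of_le h1 with rfl | h4
    · exact hb.acc h2.1
    · exact (h3 n₁ h1 le_rfl h4).1
  have hZ' : InS S fun j : N => ∃ n, n ≤ u ∧ Z (j, n) := by
    have : InS S fun p : N × N => Z (p.1, p.2) := hZ
    infer_instance
  have hN₁ : InS S fun p : N × N => anc n₁ p.1 p.2 := hN _ _ _
  -- The topmost such edge, in the order at time `n₁`; `e₀` shows that there is one.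
  obtain ⟨e, ⟨n, _, hn, he, he'⟩, hmin⟩ := exists_minimal (S := S) (P := fun j => ∃ n, n ≤ u ∧ Z (j, n))
    hZ' hN₁ (hb.irrefl n₁) hb.trans (b := K) (fun j ⟨n, _, h⟩ => hb.le (hZB h)) ⟨e₀, hu e₀
      (hb.le (hb.acc he₀)) n₁ ⟨le_rfl, hn₁ ▸ ⟨he₀, fun f _ hf => by
        obtain ⟨h1, h2, h3⟩ := hFt f hf n₀ hn₀
        exact he₀' f h1 h2 h3⟩, fun m _ h1 h2 => absurd h1 (not_le.2 h2)⟩⟩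
  have hBe : ∀ {x}, W x e → B x e := fun h => hb.acc h.1
  -- New edges appear only at the bottom of the branch, so whatever is above the surviving `e` at a
  -- later time has been above it since `n₁`.
  have hback : ∀ x, n₁ ≤ x → W x e → (∀ m, m ≤ x → n₁ ≤ m → m < x → B m e ∧ ¬ D m e) →
      ∀ i, anc x i e → anc n₁ i e ∧ ∀ m, m ≤ x → n₁ ≤ m → m < x → B m i ∧ ¬ D m i := by
    intro x hx hW hp
    have : ∀ y, n₁ ≤ y → y ≤ x → ∀ i, i ≤ K → anc y i e →
        anc n₁ i e ∧ ∀ m, m ≤ y → n₁ ≤ m → m < y → B m i ∧ ¬ D m i := by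
      intro y hy
      refine InS.induction_from (S := S) (P := fun y => y ≤ x → ∀ i, i ≤ K → anc y i e →
        anc n₁ i e ∧ ∀ m, m ≤ y → n₁ ≤ m → m < y → B m i ∧ ¬ D m i) inferInstance n₁ ?_ ?_ hy
      · exact fun _ i _ h => ⟨h, fun m _ h1 h2 => absurd h1 (not_le.2 h2)⟩
      · intro y hy ih hyx i hi h1
        have hyx' : y < x := (lt_add_one y).trans_le hyx
        have hye : B (y + 1) e := by
          rcases eq_or_lt_of_le hyx with h2 | h2
          · exact h2 ▸ hBe hW
          · exact (hp _ h2.le (hy.trans le_self_add) h2).1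
        obtain ⟨h2, h3⟩ := hb.old h1 hye
        obtain ⟨h4, h5⟩ := hp y hyx'.le hy hyx'
        obtain ⟨h6, h7⟩ := ih hyx'.le i hi ((hb.anc_iff h2 h4 h3 h5).1 h1)
        refine ⟨h6, fun m _ h8 h9 => ?_⟩
        rcases eq_or_lt_of_le ((lt_succ_iff hS.out).1 h9) with rfl | h10
        · exact ⟨h2, h3⟩
        · exact h7 m h10.le h8 h10
    exact fun i hi => this x hx le_rfl i (hb.le (hb.anc_left hi (hBe hW))) hi
  have hsucc : ∀ x, n₁ ≤ x → W x e → (∀ m, m ≤ x → n₁ ≤ m → m < x → B m e ∧ ¬ D m e) →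
      ¬ D x e ∧ W (x + 1) e := by
    intro x hx h1 h2
    obtain ⟨i, h3, h4, h5, rfl | h6⟩ := hstep x e (htn.trans hx) h1
    · exact ⟨h4, h5⟩
    -- If acceptance moved to an edge strictly above `e`, that edge would also satisfy `Z`, against
    -- the choice of `e`.
    · obtain ⟨h7, h8⟩ := hback x hx h1 h2 i h6
      refine absurd h7 (hmin i (hu i (hb.le h3) (x + 1) ⟨hx.trans le_self_add, h5, fun m _ h9 h10 => ?_⟩))
      rcases eq_or_lt_of_le ((lt_succ_iff hS.out).1 h10) with rfl | h11
      · exact ⟨h3, h4⟩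
      · exact h8 m h11.le h9 h11
  have hall : ∀ x, n ≤ x → W x e ∧ ∀ m, m ≤ x → n₁ ≤ m → m < x → B m e ∧ ¬ D m e := by
    intro x hx
    refine InS.induction_from (S := S) (P := fun x => W x e ∧
      ∀ m, m ≤ x → n₁ ≤ m → m < x → B m e ∧ ¬ D m e) (.and (hP := hW _ _)) n ⟨he, he'⟩ ?_ hx
    intro x hx h
    obtain ⟨h1, h2⟩ := hsucc x (le_trans hn hx) h.1 h.2
    refine ⟨h2, fun m _ h9 h10 => ?_⟩
    rcases eq_or_lt_of_le ((lt_succ_iff hS.out).1 h10) with rfl | h11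
    · exact ⟨hBe h.1, h1⟩
    · exact h.2 m h11.le h9 h11
  refine ⟨e, n, htn.trans hn, fun x hx => ?_⟩
  obtain ⟨h1, h2⟩ := hall x hx
  exact ⟨hBe h1, (hsucc x (le_trans hn hx) h1 h2).1, fun f hf => h1.2 f (hFK f hf) hf⟩

/-- Some edge of the branch is permanent and refreshed infinitely often. -/
theorem exists_refreshed (hb : IsBranch S K B A D R anc) (hI : ModelsSigma02Ind S) :
    ∃ i t, (∀ n, t ≤ n → B n i ∧ ¬ D n i) ∧ InfinitelyOften fun n => R n i := by
  by_contra! hc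
  have hB : ∀ {V : Type u} [Coded S V] (f g : V → N) [FunS S f] [FunS S g],
      InS S fun a => B (f a) (g a) := fun f g _ _ =>
    hb.branch_inS.comp (f := fun a => (f a, g a)) inferInstance
  have hD : ∀ {V : Type u} [Coded S V] (f g : V → N) [FunS S f] [FunS S g],
      InS S fun a => D (f a) (g a) := fun f g _ _ =>
    hb.deleted_inS.comp (f := fun a => (f a, g a)) inferInstance
  have hN : ∀ {V : Type u} [Coded S V] (f g k : V → N) [FunS S f] [FunS S g] [FunS S k],
      InS S fun a => anc (f a) (g a) (k a) := fun f g k _ _ _ =>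
    hb.anc_inS.comp (f := fun a => (f a, g a, k a)) inferInstance
  -- `H` codes a function on the numbers below `k` whose values are undeleted edges of the branch at
  -- time `n`, each strictly above the later ones.
  let G : N → FinCode N → N → Prop := fun k H n =>
    (∀ j, j ≤ k → j < k → ∃ i, i ≤ K ∧ FinCode.Mem (pair j i) H) ∧
    (∀ j, j ≤ k → j < k → ∀ i, i ≤ K → FinCode.Mem (pair j i) H → B n i ∧ ¬ D n i) ∧
    (∀ j, j ≤ k → j < k → ∀ i, i ≤ K → ∀ i', i' ≤ K → FinCode.Mem (pair j i) H →
      FinCode.Mem (pair j i') H → i = i') ∧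
    ∀ j', j' ≤ k → j' < k → ∀ j, j ≤ k → j < j' → ∀ i, i ≤ K → ∀ i', i' ≤ K →
      FinCode.Mem (pair j i) H → FinCode.Mem (pair j' i') H → anc n i i'
  have hG : InS S fun x : N × (N × FinCode N) × N => x.2.1.1 ≤ x.2.2 → G x.1 x.2.1.2 x.2.2 := by
    refine InS.imp (hP' := ?_)
    refine .and (hP := ?_) (hP' := .and (hP := ?_) (hP' := .and (hP := ?_) (hP' := ?_)))
    all_goals infer_instance
  -- The statement `∃ (t, H) ∀ n ≥ t` is `Σ⁰₂`, so chains of every length `k` are obtained by one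
  -- induction.
  have key : ∀ k : N, ∃ s : N × FinCode N, ∀ n, s.1 ≤ n → G k s.2 n := by
    intro k
    refine sigmaTwo_induction (S := S) hI (P := fun k => ∃ s : N × FinCode N, ∀ n, s.1 ≤ n → G k s.2 n)
      _ hG (fun _ => Iff.rfl) ?_ ?_ k
    · refine ⟨(0, 0, 0, 0), fun n _ => ?_⟩
      have h0 : ∀ {j : N} {P : Prop}, j < 0 → P := fun h => absurd h (not_lt.2 zero_le)
      exact ⟨fun _ _ => h0, fun _ _ => h0, fun _ _ => h0, fun _ _ => h0⟩
    · rintro k ⟨⟨t, H⟩, ht⟩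
      simp only at ht
      have hext : ∃ e t', t ≤ t' ∧ ∀ n, t' ≤ n → B n e ∧ ¬ D n e ∧
          ∀ j i, j < k → i ≤ K → FinCode.Mem (pair j i) H → anc n i e := by
        rcases eq_zero_or_succ hS.out k with rfl | ⟨k, rfl⟩
        · obtain ⟨e, t', h1, h2⟩ := hb.exists_permanent hI (F := fun _ => False) inferInstance
            (t := t) fun _ h => h.elim
          exact ⟨e, t', h1, fun n hn => ⟨(h2 n hn).1, (h2 n hn).2.1, fun j _ hj =>
            absurd hj (not_lt.2 zero_le)⟩⟩
        · have hk := lt_add_one k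
          obtain ⟨f, hf, hfH⟩ := (ht t le_rfl).1 k hk.le hk
          have hft : ∀ n, t ≤ n → B n f ∧ ¬ D n f := fun n hn =>
            (ht n hn).2.1 k hk.le hk f hf hfH
          -- The last edge of the chain is permanent, hence by assumption refreshed only up to some
          -- time; a further permanent edge then exists below it, and below the others by
          -- transitivity.
          have := hc f t hft
          simp only [InfinitelyOften] at this
          push Not at this
          obtain ⟨t₁, ht₁⟩ := this
          obtain ⟨e, t', h1, h2⟩ := hb.exists_permanent hI (F := fun x => x = f) inferInstance
            (t := max t t₁) fun x hx n hn => by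
              subst hx
              have h1 := hft n ((le_max_left _ _).trans hn)
              exact ⟨h1.1, h1.2, ht₁ n ((le_max_right _ _).trans hn)⟩
          refine ⟨e, t', (le_max_left _ _).trans h1, fun n hn => ⟨(h2 n hn).1, (h2 n hn).2.1,
            fun j i hj hi hji => ?_⟩⟩
          have hG := ht n ((le_max_left _ _).trans (h1.trans hn))
          have hfe := (h2 n hn).2.2 f rfl
          rcases eq_or_lt_of_le ((lt_succ_iff hS.out).1 hj) with rfl | hjk
          · rwa [hG.2.2.1 j hj.le hj i hi f hf hji hfH]
          · exact hb.trans (hG.2.2.2 k hk.le hk j hj.le hjk i hi f hf hji hfH) hfe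
      obtain ⟨e, t', htt, he⟩ := hext
      have heK : e ≤ K := hb.le (he t' le_rfl).1
      obtain ⟨H', _, hH⟩ := exists_finCode (S := S) (P := fun z => ∃ j, j ≤ k ∧ ∃ i, i ≤ K ∧
        (z = pair j i ∧ ((j < k ∧ FinCode.Mem (pair j i) H) ∨ (j = k ∧ i = e)))) inferInstance
        (pair k K)
      have hH' : ∀ {j i}, j ≤ k → i ≤ K → (FinCode.Mem (pair j i) H' ↔
          ((j < k ∧ FinCode.Mem (pair j i) H) ∨ (j = k ∧ i = e))) := by
        intro j i hj hi
        rw [hH]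
        refine ⟨?_, fun h => ⟨pair_mono hj hi, j, hj, i, hi, rfl, h⟩⟩
        rintro ⟨_, j', _, i', _, h1, h2⟩
        obtain ⟨rfl, rfl⟩ := pair_inj hS.out h1
        exact h2
      have hlt : ∀ {j : N}, j < k + 1 ↔ j ≤ k := lt_succ_iff hS.out
      refine ⟨(t', H'), fun n hn => ⟨fun j _ hj => ?_, fun j _ hj i hi h1 => ?_,
        fun j _ hj i hi i' hi' h1 h2 => ?_, fun j' _ hj' j _ hj i hi i' hi' h1 h2 => ?_⟩⟩
      all_goals have hG := ht n (htt.trans hn)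
      · rcases eq_or_lt_of_le (hlt.1 hj) with rfl | hjk
        · exact ⟨e, heK, (hH' le_rfl heK).2 (.inr ⟨rfl, rfl⟩)⟩
        · obtain ⟨i, hi, h1⟩ := hG.1 j hjk.le hjk
          exact ⟨i, hi, (hH' hjk.le hi).2 (.inl ⟨hjk, h1⟩)⟩
      · rcases (hH' (hlt.1 hj) hi).1 h1 with ⟨h2, h3⟩ | ⟨_, rfl⟩
        · exact hG.2.1 j h2.le h2 i hi h3
        · exact ⟨(he n hn).1, (he n hn).2.1⟩
      · rcases (hH' (hlt.1 hj) hi).1 h1 with ⟨h3, h4⟩ | ⟨h3, h4⟩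
        · rcases (hH' (hlt.1 hj) hi').1 h2 with ⟨h5, h6⟩ | ⟨h5, h6⟩
          · exact hG.2.2.1 j h3.le h3 i hi i' hi' h4 h6
          · exact absurd h5 h3.ne
        · rcases (hH' (hlt.1 hj) hi').1 h2 with ⟨h5, h6⟩ | ⟨h5, h6⟩
          · exact absurd h3 h5.ne
          · rw [h4, h6]
      · rcases (hH' ((hlt.1 (hj.trans hj'))) hi).1 h1 with ⟨h3, h4⟩ | ⟨h3, h4⟩
        · rcases (hH' (hlt.1 hj') hi').1 h2 with ⟨h5, h6⟩ | ⟨h5, rfl⟩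
          · exact hG.2.2.2 j' h5.le h5 j h3.le hj i hi i' hi' h4 h6
          · exact (he n hn).2.2 j i h3 hi h4
        · exact absurd (hlt.1 hj') (not_le.2 (h3 ▸ hj))
  -- A chain of `K + 2` distinct edges cannot have all its identifiers among the `K + 1` numbers up
  -- to `K`.
  obtain ⟨⟨t, H⟩, ht⟩ := key (K + 1 + 1)
  obtain ⟨h1, _, _, h4⟩ := ht t le_rfl
  have hlt : ∀ {j : N}, j ≤ K + 1 → j < K + 1 + 1 := (lt_succ_iff hS.out).2
  refine pigeonhole (S := S) (R := fun x => FinCode.Mem (pair x.1 x.2) H) inferInstance (K + 1)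
    (fun j hj => ?_) fun j j' i hj hj' hi h5 h6 => ?_
  · obtain ⟨i, hi, h5⟩ := h1 j (hlt hj).le (hlt hj)
    exact ⟨i, (lt_succ_iff hS.out).2 hi, h5⟩
  · have hi' := (lt_succ_iff hS.out).1 hi
    rcases lt_trichotomy j j' with h7 | h7 | h7
    · exact absurd (h4 j' (hlt hj').le (hlt hj') j (hlt hj).le h7 i hi' i hi' h5 h6) (hb.irrefl _ _)
    · exact h7
    · exact absurd (h4 j (hlt hj).le (hlt hj) j' (hlt hj').le h7 i hi' i hi' h6 h5) (hb.irrefl _ _)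

end IsBranch

variable {Q : Set N} {c qI b : N} {α : N → Letter N} {ρ : N → Scheme N} {ν : N → N → N}

namespace RunCtx

/-- Extracts all that the passage from a path to the Rabin condition uses about the automaton. -/
theorem isBranch (h : RunCtx S Q c qI b α ρ ν) {π : N → N} (hπ : IsFun₁ S π) (hπ₀ : π 0 = qI)
    (he : ∀ n, α n (π n) (π (n + 1)) ≠ Mark.zero)
    (hs : InfinitelyOften fun n => α n (π n) (π (n + 1)) = Mark.star) :
    IsBranch S (2 * c) (fun n i => Above (ρ n) (π n) i)
      (fun n i => Above (ρ n) (π n) i ∧ (ρ n).acc i) (fun n i => Deleted (ρ n) (α n) i)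
      (fun n i => Refreshed (ρ n) (α n) i) fun n i j => (ρ n).anc i j := by
  have hT := h.treeFam
  have hL := h.labelFam
  have hM := h.stepFam
  have hπ' := isFun₁_iff.1 hπ
  have halive : ∀ n, Alive (ρ n) (π n) := by
    intro n
    refine InS.induction (S := S) (P := fun n => Alive (ρ n) (π n)) inferInstance
      (h.alive_zero.2 hπ₀) (fun n ih => h.alive_succ_iff.2 ⟨_, ih, he n⟩) n
  have hf : ∀ n, Feeds (ρ n) (α n) (π n) (π (n + 1)) := fun n => ⟨halive n, he n⟩
  have hB : InS S fun x : N × N => Above (ρ x.1) (π x.1) x.2 := inferInstance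
  have hA : InS S fun x : N × N => (ρ x.1).node x.2 ∧ (ρ x.1).acc x.2 := h.acc_inS _ _
  have hA' : InS S fun x : N × N => Above (ρ x.1) (π x.1) x.2 ∧ (ρ x.1).node x.2 ∧ (ρ x.1).acc x.2 :=
    .and
  exact
  { branch_inS := hB
    acc_inS := hA'.congr fun x =>
      ⟨fun h1 => ⟨h1.1, (h.stepCtx _).node_of_above h1.1, h1.2⟩, fun h1 => ⟨h1.1, h1.2.2⟩⟩
    deleted_inS := inferInstance
    anc_inS := inferInstance
    le := fun h1 => h.node_le ((h.stepCtx _).node_of_above h1)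
    acc := fun h1 => h1.1
    irrefl := fun n => (h.isState n).tree.irrefl
    trans := fun {n _ _ _} h1 h2 => (h.isState n).tree.trans h1 h2
    anc_left := fun {n _ _} h1 ⟨l, hl, h2, h3⟩ =>
      ⟨l, hl, h2, .inr ((h.isState n).tree.anc_of_anc_of_le h1 h3)⟩
    first := fun {n j} ⟨h1, ha⟩ => by
      obtain ⟨i, h2, h3, h4, h5, h6, h7, _⟩ :=
        (h.stepCtx n).branch_first (h.run.transition n) (hf n) h1
      exact ⟨i, h2, ⟨h3, (h6 ha).1⟩, h4, h5, (h6 ha).2, h7⟩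
    anc_iff := fun {n _ _} h1 h2 => (h.stepCtx n).branch_anc_iff (h.run.transition n)
      ((h.stepCtx n).node_of_above h1) ((h.stepCtx n).node_of_above h2)
    old := fun {n i j} h1 ⟨l, hl, h2, h3⟩ => by
      have ht := (h.isState (n + 1)).tree
      exact ((h.stepCtx n).branch_old_or_leaf (h.run.transition n) (hf n) (ht.node_left h1)
        ⟨l, hl, h2, .inr (ht.anc_of_anc_of_le h1 h3)⟩).resolve_right fun h4 =>
          h4.2 j (ht.node_right h1) h1
    star := fun m => by
      obtain ⟨n, hn, h1⟩ := hs m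
      obtain ⟨i, h2, h3, h4⟩ := (h.stepCtx n).branch_star (h.run.transition n) (halive n) h1
      exact ⟨n, hn, i, ⟨h2, h3⟩, h4⟩ }

/-- The Rabin condition characterizes the existence of accepting paths. -/
theorem hasAcceptingPath_iff (h : RunCtx S Q c qI b α ρ ν) (hI : ModelsSigma02Ind S) :
    HasAcceptingPath S qI α ↔ ∃ i, i ≤ 2 * c ∧
      FinitelyOften (fun n => Deleted (ρ n) (α n) i) ∧
      InfinitelyOften (fun n => Refreshed (ρ n) (α n) i) := by
  constructor
  · rintro ⟨π, hπ, h0, he, hs⟩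
    have hb := h.isBranch hπ h0 he hs
    obtain ⟨i, t, h1, h2⟩ := hb.exists_refreshed hI
    exact ⟨i, hb.le (h1 t le_rfl).1, ⟨t, fun n hn => (h1 n hn).2⟩, h2⟩
  · rintro ⟨i, _, hd, hr⟩
    exact h.hasAcceptingPath_of_refreshed hd hr

end RunCtx

end Branches

end QDag

namespace QDag

open SOA

/-! ### The least choice of new identifiers, and why `2c + 1` identifiers suffice -/

section Naming

variable {N : Type u} [CommSemiring N] [LinearOrder N] [IsStrictOrderedRing N]
  [CanonicallyOrderedAdd N]
variable {S : Set (Set N)} [hS : Fact (ModelsRCA0 S)]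
variable {A B : Type u} [Coded S A] [Coded S B]
variable {τ : A → Scheme N} {M : A → Letter N}

instance InS.inherits [StepFam S τ M] {v : A → N ⊕ N} {i : A → N} [FunS S v] [FunS S i] :
    InS S fun a => Inherits (τ a) (M a) (v a) (i a) := by
  unfold Inherits
  infer_instance

instance InS.unnamed [StepFam S τ M] {q : A → N} [FunS S q] :
    InS S fun a => Unnamed (τ a) (M a) (q a) := by
  unfold Unnamed
  infer_instance

instance InS.used [StepFam S τ M] {i : A → N} [FunS S i] :
    InS S fun a => Used (τ a) (M a) (i a) :=
  InS.congr (P := fun a => ∃ v, (prune (τ a) (M a)).node v ∧ Inherits (τ a) (M a) v (i a)) fun _ =>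
    ⟨fun ⟨v, hv⟩ => ⟨v, hv.1.1.1, hv⟩, fun ⟨v, _, hv⟩ => ⟨v, hv⟩⟩

theorem InS.hasIdentifier [h : StepFam S τ M] {ν : A × N → N} [FunS S ν] {v : A → N ⊕ N}
    {i : A → N} [FunS S v] [FunS S i] :
    InS S fun a => HasIdentifier (τ a) (M a) (fun q => ν (a, q)) (v a) (i a) := by
  obtain ⟨b, hb⟩ := h.edge_bdd
  refine InS.or (hP' := InS.exists_of_bdd (fun _ => b) (P := fun a q => v a = .inr q ∧
    Unnamed (τ a) (M a) q ∧ i a = ν (a, q)) ?_ ?_)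
  · infer_instance
  · rintro a q ⟨_, h1, _⟩
    obtain ⟨p, hp⟩ := prune_node_inr.1 h1.1.1.1
    exact hb a p q hp

/-- The bound stored in a code provides a number outside the coded set, uniformly in the code. -/
theorem exists_least_not_mem (S : Set (Set N)) [hS : Fact (ModelsRCA0 S)] :
    ∃ f : FinCode N → N, FunS S f ∧
    ∀ s, ¬ FinCode.Mem (f s) s ∧ (∀ j, j < f s → FinCode.Mem j s) ∧ f s ≤ s.2.2 + 1 := by
  have hlast : ∀ s : FinCode N, ¬ FinCode.Mem (s.2.2 + 1) s := fun s h =>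
    absurd h.1 (not_le.2 (lt_add_one _))
  obtain ⟨f, hf, h⟩ := exists_selector (S := S) (A := FinCode N) (B := N)
    (R := fun p => ¬ FinCode.Mem p.2 p.1 ∧ ∀ j, j ≤ p.2 → j < p.2 → FinCode.Mem j p.1)
    inferInstance fun s => by
      obtain ⟨x, h1, h2⟩ := InS.exists_least (S := S) (P := fun x => ¬ FinCode.Mem x s)
        inferInstance ⟨_, hlast s⟩
      exact ⟨x, h1, fun j _ hj => by
        by_contra hc
        exact absurd (h2 j hc) (not_le.2 hj)⟩
  refine ⟨f, hf, fun s => ⟨(h s).1, fun j hj => (h s).2 j hj.le hj, ?_⟩⟩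
  by_contra hc
  exact hlast s ((h s).2 _ (not_le.1 hc).le (not_le.1 hc))

/-- The deterministic choice of the new identifiers, uniformly in a family of transitions. -/
theorem exists_leastNaming (h : StepFam S τ M) :
    ∃ ν : A × N → N, FunS S ν ∧ ∀ a,
      (∀ q, Unnamed (τ a) (M a) q → ¬ Used (τ a) (M a) (ν (a, q))) ∧
      (∀ q q', Unnamed (τ a) (M a) q → Unnamed (τ a) (M a) q' → ν (a, q) = ν (a, q') → q = q') ∧
      IsLeastNaming (τ a) (M a) fun q => ν (a, q) := by
  obtain ⟨K, hK⟩ := h.tree.bdd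
  have hK' : ∀ a i, Used (τ a) (M a) i → i ≤ K := by
    rintro a i ⟨v, hv⟩
    exact hK a i (prune_node_inl.1 hv.1.2.1).1
  obtain ⟨l, hl, hl'⟩ := exists_least_not_mem S
  obtain ⟨g, hg, hg'⟩ := exists_finCode_fun (S := S) (A := A)
    (P := fun x => Used (τ x.1) (M x.1) x.2) inferInstance fun _ => K
  have ht : FunS S fun x : A × N × N × N × N => x.2.2.2.2 + 1 := by
    have h1 : FunS S fun x : A × N × N × N × N => x.2.2.2.2 := by
      have h1 : FunS S fun x : A × N × N × N × N => x.2.2.2 := inferInstance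
      exact h1.snd
    infer_instance
  -- The bound of the code grows by one at each stage, enough room for the identifier just chosen.
  obtain ⟨k, hk, hk'⟩ := exists_finCode_fun (S := S) (A := A × N × FinCode N)
    (P := fun x => FinCode.Mem x.2 x.1.2.2 ∨ (Unnamed (τ x.1.1) (M x.1.1) x.1.2.1 ∧ x.2 = l x.1.2.2))
    inferInstance (fun x : A × N × FinCode N => x.2.2.2.2 + 1)
  -- `H (a, q)` codes the identifiers that are taken when `q` is served: those in use and those
  -- given to smaller new leaves.
  obtain ⟨H, hH, hH0, hHs⟩ := exists_recursion hg hk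
  have key : ∀ a x q, FinCode.Mem x (H (a, q)) ↔
      (Used (τ a) (M a) x ∨ ∃ q', q' ≤ q ∧ (q' < q ∧ Unnamed (τ a) (M a) q' ∧ l (H (a, q')) = x)) := by
    intro a x q
    have hS₁ : StepFam S (fun _ : N × N => τ a) fun _ => M a := StepFam.subst (f := fun _ => a)
    have hS₂ : StepFam S (fun _ : N => τ a) fun _ => M a := StepFam.subst (f := fun _ => a)
    have hex : InS S fun q : N => ∃ q', q' ≤ q ∧ (q' < q ∧ Unnamed (τ a) (M a) q' ∧
        l (H (a, q')) = x) := by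
      have : InS S fun p : N × N => Unnamed (τ a) (M a) p.2 :=
        InS.unnamed (τ := fun _ => τ a) (M := fun _ => M a)
      infer_instance
    refine InS.induction (S := S) (P := fun q => FinCode.Mem x (H (a, q)) ↔
      (Used (τ a) (M a) x ∨ ∃ q', q' ≤ q ∧ (q' < q ∧ Unnamed (τ a) (M a) q' ∧ l (H (a, q')) = x)))
      inferInstance ?_ ?_ q
    · rw [hH0, hg']
      exact ⟨fun h1 => .inl h1.2, fun h1 => h1.elim (fun h2 => ⟨hK' a x h2, h2⟩)
        fun ⟨q', _, h2, _⟩ => absurd h2 (not_lt.2 zero_le)⟩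
    · intro q ih
      rw [hHs, hk']
      simp only [ih]
      constructor
      · rintro ⟨_, (h1 | ⟨q', _, h1, h2⟩) | ⟨h1, h2⟩⟩
        · exact .inl h1
        · have h3 := h1.trans (lt_add_one q)
          exact .inr ⟨q', h3.le, h3, h2⟩
        · exact .inr ⟨q, le_self_add, lt_add_one q, h1, h2.symm⟩
      · have hb : ∀ {x}, FinCode.Mem x (H (a, q)) → x ≤ (H (a, q)).2.2 + 1 := fun h1 =>
          h1.1.trans le_self_add
        rintro (h1 | ⟨q', _, h1, h2, h3⟩)
        · exact ⟨hb (ih.2 (.inl h1)), .inl (.inl h1)⟩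
        · rcases eq_or_lt_of_le ((lt_succ_iff hS.out).1 h1) with rfl | h4
          · exact ⟨h3 ▸ (hl' _).2.2, .inr ⟨h2, h3.symm⟩⟩
          · have h5 := ih.2 (.inr ⟨q', h4.le, h4, h2, h3⟩)
            exact ⟨hb h5, .inl (ih.1 h5)⟩
  refine ⟨fun x => l (H x), inferInstance, fun a => ⟨fun q _ hu => ?_, fun q q' hq hq' hqq => ?_,
    fun q _ j hj => ?_⟩⟩
  · exact (hl' (H (a, q))).1 ((key a _ q).2 (.inl hu))
  · have : ∀ {q q'}, Unnamed (τ a) (M a) q → q < q' → l (H (a, q)) ≠ l (H (a, q')) :=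
      fun {q q'} h1 h2 h3 => (hl' (H (a, q'))).1 ((key a _ q').2 (.inr ⟨q, h2.le, h2, h1, h3⟩))
    rcases lt_trichotomy q q' with h1 | h1 | h1
    · exact absurd hqq (this hq h1)
    · exact h1
    · exact absurd hqq.symm (this hq' h1)
  · rcases (key a j q).1 ((hl' _).2.1 j hj) with h1 | ⟨q', _, h1, h2, h3⟩
    · exact .inl h1
    · exact .inr ⟨q', h1, h2, h3⟩

/-! #### Schemes have few edges -/

namespace StepCtx

variable {τ τ' : Scheme N} {M : Letter N} {ν : N → N} {c : N}

theorem exists_children (h : StepCtx S τ M) {v : N ⊕ N} (hv : (prune τ M).Kept v)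
    (hl : ¬ (prune τ M).Leaf v) :
    ∃ w w', w ≠ w' ∧ (prune τ M).Child v w ∧ (prune τ M).Child v w' := by
  obtain ⟨x, hx⟩ : ∃ x, (prune τ M).anc v x := by
    by_contra! hc
    exact hl ⟨hv.1, fun w _ => hc w⟩
  obtain ⟨w, hw, _⟩ := h.tree.exists_child hx
  by_contra! hc
  exact hv.2 ⟨w, hw, fun y hy => by_contra fun hne => hc w y (fun h => hne h.symm) hw hy⟩

theorem exists_least_leaf (h : StepCtx S τ M) {w : N ⊕ N} (hw : (prune τ M).node w) :
    ∃ q, (∃ p, EdgeFrom τ M p q) ∧ (prune τ M).Le w (.inr q) ∧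
      ∀ q', (prune τ M).Le w (.inr q') → q ≤ q' := by
  have := h.fam
  have ht := h.tree.famAt (A := N)
  obtain ⟨l, hl, hwl⟩ := h.tree.exists_leaf hw
  obtain ⟨q₀, rfl, _⟩ := h.leaf_iff.1 hl
  obtain ⟨q, h1, h2⟩ := InS.exists_least (S := S) (P := fun q => (prune τ M).Le w (.inr q))
    (InS.treeLe (T := fun _ : N => prune τ M) (v := fun _ => w) (w := fun q => .inr q)) ⟨q₀, hwl⟩
  refine ⟨q, ?_, h1, h2⟩
  rcases h1 with rfl | h1
  · exact prune_node_inr.1 hw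
  · exact prune_node_inr.1 (h.tree.node_right h1)

/-- `v` is the lowest ancestor of the leaf `q` that has a smaller leaf below it. -/
def Splits (τ : Scheme N) (M : Letter N) (v : N ⊕ N) (q : N) : Prop :=
  (prune τ M).anc v (.inr q) ∧ (∃ q', q' ≤ q ∧ (q' < q ∧ (prune τ M).Le v (.inr q'))) ∧
    ∀ y, (prune τ M).node y → (prune τ M).anc v y → (prune τ M).Le y (.inr q) →
      ∀ q', q' ≤ q → q' < q → ¬ (prune τ M).Le y (.inr q')

theorem Splits.unique (h : StepCtx S τ M) {v v' : N ⊕ N} {q : N} (h1 : Splits τ M v q)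
    (h2 : Splits τ M v' q) : v = v' := by
  have : ∀ {v v'}, Splits τ M v q → Splits τ M v' q → ¬ (prune τ M).anc v v' := by
    rintro v v' ⟨_, _, h1⟩ ⟨h2, ⟨q', h3, h4, h5⟩, _⟩ h6
    exact h1 v' (h.tree.node_right h6) h6 (.inr h2) q' h3 h4 h5
  rcases h.tree.linear h1.1 h2.1 with h3 | h3 | h3
  · exact h3
  · exact absurd h3 (this h1 h2)
  · exact absurd h3 (this h2 h1)

/-- Among the least leaves below two children of `v`, the larger one is a leaf that `v` splits. With
`Splits.unique`, the kept inner nodes inject into the leaves. -/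
theorem exists_splits (h : StepCtx S τ M) {v : N ⊕ N} (hv : (prune τ M).Kept v)
    (hl : ¬ (prune τ M).Leaf v) : ∃ q, (∃ p, EdgeFrom τ M p q) ∧ Splits τ M v q := by
  obtain ⟨w, w', hne, hw, hw'⟩ := h.exists_children hv hl
  obtain ⟨q, hq, h1, h2⟩ := h.exists_least_leaf hw.2.1
  obtain ⟨q', hq', h1', h2'⟩ := h.exists_least_leaf hw'.2.1
  have key : ∀ {w q q'}, (prune τ M).Child v w → (prune τ M).Le w (.inr q) →
      (∀ q', (prune τ M).Le w (.inr q') → q ≤ q') → q' < q → (prune τ M).Le v (.inr q') →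
      Splits τ M v q := by
    intro w q q' hw h1 h2 hlt h3
    refine ⟨h.tree.anc_of_anc_of_le hw.2.2.1 h1, ⟨q', hlt.le, hlt, h3⟩,
      fun y _ hvy hyq x _ hx hyx => ?_⟩
    obtain ⟨z, hz, hzy⟩ := h.tree.exists_child hvy
    obtain rfl := h.tree.child_unique hz hw (h.tree.le_trans hzy hyq) h1
    exact absurd (h2 x (h.tree.le_trans hzy hyx)) (not_le.2 hx)
  have hvq : (prune τ M).Le v (.inr q) := Or.inr (h.tree.anc_of_anc_of_le hw.2.2.1 h1)
  have hvq' : (prune τ M).Le v (.inr q') := Or.inr (h.tree.anc_of_anc_of_le hw'.2.2.1 h1')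
  rcases lt_trichotomy q q' with h3 | rfl | h3
  · exact ⟨q', hq', key hw' h1' h2' h3 hvq⟩
  · exact absurd (h.tree.child_unique hw hw' h1 h1') hne
  · exact ⟨q, hq, key hw h1 h2 h3 hvq'⟩

theorem two_mul_ne (S : Set (Set N)) [hS : Fact (ModelsRCA0 S)] (d d' : N) :
    2 * d ≠ 2 * d' + 1 := by
  intro h
  rcases le_or_gt d d' with h1 | h1
  · have : 2 * d ≤ 2 * d' := mul_le_mul_right h1 2
    exact absurd (h ▸ this) (not_le.2 (lt_add_one _))
  · have h2 := succ_le_of_lt hS.out h1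
    have : 2 * (d' + 1) ≤ 2 * d := mul_le_mul_right h2 2
    rw [h, mul_add, mul_one] at this
    exact absurd this (not_le.2 (add_lt_add_right one_lt_two _))

/-- Code the leaf `f d` by `2d` and a node that splits `f d` by `2d + 1`; as `d < c`, fewer than `2c
+ 1` codes occur. A least identifier beyond `2c` would require all of `0, …, 2c` to be taken by kept
nodes, too many for these codes. -/
theorem naming_le (h : StepCtx S τ M) [hν : FunS S ν] {Q : Set N} (hQ : IsFiniteSet S Q c)
    (hM : ∀ p q, M p q ≠ Mark.zero → q ∈ Q)
    (hleast : IsLeastNaming τ M ν) {q₀ : N}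
    (hq₀ : Unnamed τ M q₀) : ν q₀ ≤ 2 * c := by
  by_contra hc
  obtain ⟨_, f, hf, hbij⟩ := hQ
  have hf' := isFun₁_iff.1 hf
  have hfam := h.fam
  have hfam' : ∀ {A : Type u} [Coded S A], StepFam S (fun _ : A => τ) fun _ => M := fun {A _} =>
    StepFam.subst (τ := fun _ : N => τ) (M := fun _ => M) (f := fun _ : A => 0)
  have hcode : InS S fun x : (N ⊕ N) × N => ∃ d, d ≤ c ∧ (d < c ∧
      ((x.1 = .inr (f d) ∧ x.2 = 2 * d) ∨ (Splits τ M x.1 (f d) ∧ x.2 = 2 * d + 1))) := by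
    have : InS S fun x : (N ⊕ N) × N => Splits τ M x.1 x.2 := by
      have := @hfam'
      unfold Splits
      refine .and (hP := InS.anc (T := fun _ => prune τ M)) (hP' := .and (hP := ?_) (hP' := ?_))
      · have : InS S fun x : ((N ⊕ N) × N) × N => (prune τ M).Le x.1.1 (.inr x.2) :=
          InS.treeLe (T := fun _ => prune τ M)
        infer_instance
      · have h1 : InS S fun x : (((N ⊕ N) × N) × (N ⊕ N)) × N => (prune τ M).Le x.1.2 (.inr x.2) :=
          InS.treeLe (T := fun _ => prune τ M)
        have h2 : InS S fun x : ((N ⊕ N) × N) × (N ⊕ N) => (prune τ M).Le x.2 (.inr x.1.2) :=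
          InS.treeLe (T := fun _ => prune τ M)
        have h3 : InS S fun x : ((N ⊕ N) × N) × (N ⊕ N) => (prune τ M).anc x.1.1 x.2 :=
          InS.anc (T := fun _ => prune τ M)
        exact InS.forall_node (T := fun _ => prune τ M) inferInstance
    have h1 : InS S fun x : ((N ⊕ N) × N) × N => Splits τ M x.1.1 (f x.2) :=
      this.comp (f := fun x : ((N ⊕ N) × N) × N => (x.1.1, f x.2)) inferInstance
    infer_instance
  have hid : InS S fun x : (N ⊕ N) × N => HasIdentifier τ M ν x.1 x.2 :=
    InS.hasIdentifier (τ := fun _ => τ) (M := fun _ => M)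
      (ν := fun x : ((N ⊕ N) × N) × N => ν x.2)
  -- The additional index `2c + 1` represents the leaf `q₀`, whose own identifier is assumed to
  -- exceed `2c`.
  have hR : InS S fun x : N × N => ∃ v, (prune τ M).node v ∧
      (((HasIdentifier τ M ν v x.1 ∧ x.1 ≤ 2 * c) ∨ (x.1 = 2 * c + 1 ∧ v = .inr q₀)) ∧
        ∃ d, d ≤ c ∧ (d < c ∧
      ((v = .inr (f d) ∧ x.2 = 2 * d) ∨ (Splits τ M v (f d) ∧ x.2 = 2 * d + 1)))) := by
    have h1 : InS S fun x : (N × N) × (N ⊕ N) => HasIdentifier τ M ν x.2 x.1.1 :=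
      hid.comp (f := fun x : (N × N) × (N ⊕ N) => (x.2, x.1.1)) inferInstance
    have h2 := hcode.comp (f := fun x : (N × N) × (N ⊕ N) => (x.2, x.1.2)) inferInstance
    have h3 : InS S fun x : (N × N) × (N ⊕ N) => (HasIdentifier τ M ν x.2 x.1.1 ∧ x.1.1 ≤ 2 * c) ∨
        (x.1.1 = 2 * c + 1 ∧ x.2 = .inr q₀) := inferInstance
    have := @hfam'
    exact InS.exists_node (T := fun _ => prune τ M) (.and (hP := h3) (hP' := h2))
  have hsurj : ∀ {q}, (∃ p, EdgeFrom τ M p q) → ∃ d, d < c ∧ f d = q := fun ⟨p, hp⟩ =>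
    hbij.surjOn (hM _ _ hp.2)
  have hkept : (prune τ M).Kept (.inr q₀) := hq₀.1.1
  have hlast : HasIdentifier τ M ν (.inr q₀) (ν q₀) := .inr ⟨q₀, rfl, hq₀, rfl⟩
  refine pigeonhole hR (2 * c + 1) (fun j hj => ?_) fun j j' k hj hj' hk ⟨v, _, h1, d, _, hd, h2⟩
    ⟨v', _, h1', d', _, hd', h2'⟩ => ?_
  · obtain ⟨v, hv, hvj⟩ : ∃ v, (prune τ M).Kept v ∧ ((HasIdentifier τ M ν v j ∧ j ≤ 2 * c) ∨
        (j = 2 * c + 1 ∧ v = .inr q₀)) := by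
      rcases (le_succ_iff hS.out).1 hj with hj | rfl
      · rcases hleast q₀ hq₀ j (hj.trans_lt (not_le.1 hc)) with ⟨v, hv⟩ | ⟨q, _, hq, rfl⟩
        · exact ⟨v, hv.1.1, .inl ⟨.inl hv, hj⟩⟩
        · exact ⟨.inr q, hq.1.1, .inl ⟨.inr ⟨q, rfl, hq, rfl⟩, hj⟩⟩
      · exact ⟨_, hkept, .inr ⟨rfl, rfl⟩⟩
    by_cases hl : (prune τ M).Leaf v
    · obtain ⟨q, rfl, hq⟩ := h.leaf_iff.1 hl
      obtain ⟨d, hd, rfl⟩ := hsurj hq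
      exact ⟨2 * d, (lt_succ_iff hS.out).2 (mul_le_mul_right hd.le 2), _, hv.1, hvj, d, hd.le, hd,
        .inl ⟨rfl, rfl⟩⟩
    · obtain ⟨q, hq, hs⟩ := h.exists_splits hv hl
      obtain ⟨d, hd, rfl⟩ := hsurj hq
      have : 2 * d < 2 * c := mul_lt_mul_of_pos_left hd two_pos
      exact ⟨2 * d + 1, add_lt_add_left this 1, _, hv.1, hvj, d, hd.le, hd, .inr ⟨hs, rfl⟩⟩
  · have hvv : v = v' := by
      rcases h2 with ⟨h2, h3⟩ | ⟨h2, h3⟩ <;> rcases h2' with ⟨h2', h3'⟩ | ⟨h2', h3'⟩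
      · obtain rfl : d = d' := mul_left_cancel₀ two_ne_zero (h3.symm.trans h3')
        rw [h2, h2']
      · exact absurd (h3.symm.trans h3') (two_mul_ne S d d')
      · exact absurd (h3'.symm.trans h3) (two_mul_ne S d' d)
      · obtain rfl : d = d' :=
          mul_left_cancel₀ two_ne_zero (add_right_cancel (h3.symm.trans h3'))
        exact Splits.unique h h2 h2'
    subst hvv
    rcases h1 with ⟨h1, h3⟩ | ⟨rfl, rfl⟩ <;> rcases h1' with ⟨h1', h3'⟩ | ⟨rfl, h3'⟩
    · exact h.hasIdentifier_unique h1 h1'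
    · rw [h3'] at h1
      exact absurd (h.hasIdentifier_unique h1 hlast ▸ h3) hc
    · exact absurd (h.hasIdentifier_unique h1' hlast ▸ h3') hc
    · rfl

end StepCtx

end Naming

end QDag

namespace QDag

open SOA

/-! ### Existence of a run -/

section Construction

variable {N : Type u} [CommSemiring N] [LinearOrder N] [IsStrictOrderedRing N]
  [CanonicallyOrderedAdd N]
variable {S : Set (Set N)} [hS : Fact (ModelsRCA0 S)]
variable {A B : Type u} [Coded S A] [Coded S B]

/-- A transition leads to a scheme or to the dead state. -/
theorem StepCtx.target_state {τ τ' : Scheme N} {M : Letter N} {ν : N → N} {c : N} {Q : Set N}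
    (h : StepCtx S τ M) (ht : IsTransition c τ M ν τ')
    (hanc : ∀ i j, τ'.anc i j → τ'.node i ∧ τ'.node j) (hle : ∀ i, τ.node i → i ≤ 2 * c)
    (hlab : ∀ i, τ.node i → τ.label i ∈ Q) (hM : ∀ p q, M p q ≠ Mark.zero → q ∈ Q)
    (hroot : τ.rootLabel ∈ Q) : IsQScheme Q c τ' ∨ IsDead Q τ' := by
  have hroot' : τ'.rootLabel ∈ Q := ht.rootLabel_eq ▸ hroot
  by_cases hne : ∃ i, τ'.node i
  swap
  · push Not at hne
    exact .inr ⟨hne, fun i j hij => hne i (hanc i j hij).1, hroot'⟩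
  have hid : ∀ {i}, τ'.node i → ∃ v, HasIdentifier τ M ν v i := (node_iff ht).1
  refine .inl ⟨fun i hi => ?_, fun i hi => ?_, hroot', hanc, fun i hi => ?_, fun i j k hij hjk => ?_,
    fun i j k hik hjk => ?_, fun i j hi hj hij => ?_, fun i hi hl => ?_, hne⟩
  · obtain ⟨v, hv | ⟨q, _, hq, rfl⟩⟩ := hid hi
    · exact hle i (prune_node_inl.1 hv.1.2.1).1
    · exact ht.fresh.le q hq
  · obtain ⟨v, hv⟩ := hid hi
    have hk := kept_of_hasIdentifier hv
    rw [ht.label_eq v i hk hv]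
    rcases v with j | q
    · exact hlab j (prune_node_inl.1 hk.1).1
    · obtain ⟨p, hp⟩ := prune_node_inr.1 hk.1
      exact hM _ _ hp.2
  · obtain ⟨v, hv⟩ := hid (hanc i i hi).1
    exact h.tree.irrefl v ((anc_iff ht hv hv).1 hi)
  · obtain ⟨u, hu⟩ := hid (hanc i j hij).1
    obtain ⟨v, hv⟩ := hid (hanc i j hij).2
    obtain ⟨w, hw⟩ := hid (hanc j k hjk).2
    exact (anc_iff ht hu hw).2 (h.tree.trans ((anc_iff ht hu hv).1 hij) ((anc_iff ht hv hw).1 hjk))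
  · obtain ⟨u, hu⟩ := hid (hanc i k hik).1
    obtain ⟨v, hv⟩ := hid (hanc j k hjk).1
    obtain ⟨w, hw⟩ := hid (hanc j k hjk).2
    rcases h.tree.linear ((anc_iff ht hu hw).1 hik) ((anc_iff ht hv hw).1 hjk) with rfl | h1 | h1
    · exact .inl (h.hasIdentifier_unique hu hv)
    · exact .inr (.inl ((anc_iff ht hu hv).2 h1))
    · exact .inr (.inr ((anc_iff ht hv hu).2 h1))
  · have hi' := (h.leaf_target_eq ht hi).1
    rw [hij] at hi'
    exact h.hasIdentifier_unique hi' (h.leaf_target_eq ht hj).1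
  · obtain ⟨v, hv⟩ := hid hi
    obtain ⟨w, w', hne, hw, hw'⟩ := h.exists_children (kept_of_hasIdentifier hv)
      fun h1 => hl ((h.leaf_target_iff ht hv).2 h1)
    -- Each child in the pruned tree is followed down to the kept end of its path; this end is a
    -- child in the target, and different children have different ends.
    have key : ∀ {w}, (prune τ M).Child v w → ∃ u j, (prune τ M).Le w u ∧
        HasIdentifier τ M ν u j ∧ τ'.Child i j := by
      intro w hw
      obtain ⟨u, hu⟩ := h.tree.exists_onPath hw.2.1
      obtain ⟨j, hj⟩ := h.exists_hasIdentifier (ν := ν) hu.1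
      refine ⟨u, j, hu.le, hj, hi, (node_iff ht).2 ⟨u, hj⟩,
        (anc_iff ht hv hj).2 (h.tree.anc_of_anc_of_le hw.2.2.1 hu.le), fun k hk ⟨h1, h2⟩ => ?_⟩
      obtain ⟨x, hx⟩ := hid hk
      replace h1 := (anc_iff ht hv hx).1 h1
      replace h2 := (anc_iff ht hx hj).1 h2
      obtain ⟨z, hz, hzx⟩ := h.tree.exists_child h1
      obtain rfl := h.tree.child_unique hz hw (h.tree.le_trans hzx (.inr h2)) hu.le
      have hkx := kept_of_hasIdentifier hx
      rcases h.tree.onPath_or_anc hu hkx.1 hzx with h3 | h3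
      · rw [h3.eq_of_kept hkx] at h2
        exact h.tree.irrefl _ h2
      · exact h.tree.asymm h2 (.inr h3)
    obtain ⟨u, j, hu, hj, hc⟩ := key hw
    obtain ⟨u', j', hu', hj', hc'⟩ := key hw'
    refine ⟨j, j', ?_, hc, hc'⟩
    rintro rfl
    obtain rfl := h.hasIdentifier_inj ht.fresh.not_used ht.fresh.inj hj hj'
    exact hne (h.tree.child_unique hw hw' hu hu')

theorem exists_finCode_fun_pair {P : A × N × N → Prop} (hP : InS S P) (K L : N) :
    ∃ f : A → FinCode N, FunS S f ∧
      ∀ a i j, FinCode.Mem (pair i j) (f a) ↔ i ≤ K ∧ j ≤ L ∧ P (a, i, j) := by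
  obtain ⟨f, hf, h⟩ := exists_finCode_fun (S := S) (A := A) (P := fun x => ∃ i, i ≤ K ∧ ∃ j, j ≤ L ∧
    (x.2 = pair i j ∧ P (x.1, i, j))) inferInstance fun _ => pair K L
  refine ⟨f, hf, fun a i j => ?_⟩
  rw [h]
  constructor
  · rintro ⟨_, i', hi, j', hj, h1, h2⟩
    obtain ⟨rfl, rfl⟩ := pair_inj hS.out h1
    exact ⟨hi, hj, h2⟩
  · rintro ⟨hi, hj, h1⟩
    exact ⟨pair_mono hi hj, i, hi, j, hj, rfl, h1⟩

/-- The code of a scheme: its nodes, its ancestor relation, the graph of its labelling and its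
accepting edges. -/
abbrev Config (N : Type u) := FinCode N × FinCode N × FinCode N × FinCode N

/-- The scheme with the given code, where `lab` reads the labels off the code. -/
def Config.scheme (c qI : N) (lab : Config N × N → N) (s : Config N) : Scheme N where
  node i := i ≤ 2 * c ∧ FinCode.Mem i s.1
  anc i j := (i ≤ 2 * c ∧ FinCode.Mem i s.1) ∧ (j ≤ 2 * c ∧ FinCode.Mem j s.1) ∧
    FinCode.Mem (pair i j) s.2.1
  label i := lab (s, i)
  acc i := FinCode.Mem i s.2.2.2
  rootLabel := qI

/-- Reading labels must be a total function with values in `Q`: where a code offers no label in `Q`,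
any default from `Q` will do, and `qI` shows that one exists. -/
theorem exists_labelling {Q : Set N} (hQ : Q ∈ S) {qI : N} (hqI : qI ∈ Q) (b : N)
    (hb : ∀ q ∈ Q, q ≤ b) : ∃ lab : Config N × N → N, FunS S lab ∧ (∀ x, lab x ∈ Q) ∧
      ∀ s i q, q ∈ Q → FinCode.Mem (pair i q) s.2.2.1 →
        FinCode.Mem (pair i (lab (s, i))) s.2.2.1 := by
  have hQ' := inS_of_mem hQ
  have hQ₁ : InS S fun p : (Config N × N) × N => p.2 ∈ Q := hQ'.comp (f := Prod.snd) inferInstance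
  have hQ₂ : InS S fun p : ((Config N × N) × N) × N => p.2 ∈ Q :=
    hQ'.comp (f := Prod.snd) inferInstance
  obtain ⟨lab, hlab, h⟩ := exists_selector (S := S) (A := Config N × N) (B := N)
    (R := fun p => p.2 ∈ Q ∧ (FinCode.Mem (pair p.1.2 p.2) p.1.1.2.2.1 ∨
      ∀ q, q ≤ b → q ∈ Q → ¬ FinCode.Mem (pair p.1.2 q) p.1.1.2.2.1)) inferInstance fun x => by
      by_cases hx : ∃ q, q ∈ Q ∧ FinCode.Mem (pair x.2 q) x.1.2.2.1
      · obtain ⟨q, h1, h2⟩ := hx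
        exact ⟨q, h1, .inl h2⟩
      · push Not at hx
        exact ⟨qI, hqI, .inr fun q _ => hx q⟩
  refine ⟨lab, hlab, fun x => (h x).1, fun s i q hq h1 => ?_⟩
  exact (h (s, i)).2.resolve_right fun h2 => h2 q (hb q hq) hq h1

variable {c qI : N} {lab : Config N × N → N}

theorem Config.treeFam : TreeFam S (Config.scheme c qI lab) where
  node_inS := by
    simp only [Config.scheme]
    infer_instance
  anc_inS := by
    simp only [Config.scheme]
    infer_instance
  bdd := ⟨2 * c, fun _ _ h => h.1⟩
  anc_node _ _ _ h := ⟨h.1, h.2.1⟩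

theorem Config.labelFam (hlab : FunS S lab) : LabelFam S (Config.scheme c qI lab) where
  label_inS := by
    simp only [Config.scheme]
    infer_instance

theorem Config.acc_inS : InS S fun p : Config N × N =>
    (Config.scheme c qI lab p.1).node p.2 ∧ (Config.scheme c qI lab p.1).acc p.2 := by
  simp only [Config.scheme]
  infer_instance

/-- The invariant of the run is to be proved by induction inside the structure. Its quantifiers
range over nodes, hence up to `2 * c`, and its definability clauses hold for every code. -/
theorem Config.isState_inS (hlab : FunS S lab) :
    InS S fun s : Config N => IsState S (Config.scheme c qI lab s) := by
  have := Config.treeFam (S := S) (c := c) (qI := qI) (lab := lab)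
  have h1 : InS S fun s : Config N => ∀ i, i ≤ 2 * c → ¬ (Config.scheme c qI lab s).anc i i :=
    inferInstance
  have h2 : InS S fun s : Config N => ∀ i, i ≤ 2 * c → ∀ j, j ≤ 2 * c → ∀ k, k ≤ 2 * c →
      (Config.scheme c qI lab s).anc i j → (Config.scheme c qI lab s).anc j k →
      (Config.scheme c qI lab s).anc i k := inferInstance
  have h3 : InS S fun s : Config N => ∀ i, i ≤ 2 * c → ∀ j, j ≤ 2 * c → ∀ k, k ≤ 2 * c →
      (Config.scheme c qI lab s).anc i k → (Config.scheme c qI lab s).anc j k →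
      (i = j ∨ (Config.scheme c qI lab s).anc i j ∨ (Config.scheme c qI lab s).anc j i) :=
    inferInstance
  have h4 : InS S fun s : Config N => ∀ i, i ≤ 2 * c → ∀ j, j ≤ 2 * c →
      (Config.scheme c qI lab s).Leaf i → (Config.scheme c qI lab s).Leaf j →
      lab (s, i) = lab (s, j) → i = j := inferInstance
  refine (InS.and (hP := h1) (hP' := .and (hP := h2) (hP' := .and (hP := h3) (hP' := h4)))).congr
    fun s => ⟨fun h => ?_, fun h => ?_⟩
  · exact ⟨fun i _ => h.tree.irrefl i, fun i _ j _ k _ => h.tree.trans,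
      fun i _ j _ k _ => h.tree.linear, fun i _ j _ => h.leaf_unique i j⟩
  · refine ⟨⟨TreeFam.subst (f := fun _ : N => s), fun i hi => ?_, fun {i j k} hij hjk => ?_,
      fun {i j k} hik hjk => ?_⟩, fun i j hi hj => ?_⟩
    · exact h.1 i hi.1.1 hi
    · exact h.2.1 i hij.1.1 j hjk.1.1 k hjk.2.1.1 hij hjk
    · exact h.2.2.1 i hik.1.1 j hjk.1.1 k hjk.2.1.1 hik hjk
    · exact h.2.2.2 i hi.1.1 j hj.1.1 hi hj

theorem Config.exists_initial (S : Set (Set N)) [hS : Fact (ModelsRCA0 S)] {Q : Set N}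
    (hqI : qI ∈ Q)
    (hl : ∀ s i q, q ∈ Q → FinCode.Mem (pair i q) s.2.2.1 →
      FinCode.Mem (pair i (lab (s, i))) s.2.2.1) :
    ∃ s : Config N, IsInitial qI (Config.scheme c qI lab s) := by
  obtain ⟨s₁, _, h₁⟩ := exists_finCode (S := S) (P := fun x => x = 0) inferInstance 0
  obtain ⟨s₂, _, h₂⟩ := exists_finCode (S := S) (P := fun _ => False) inferInstance 0
  obtain ⟨s₃, _, h₃⟩ := exists_finCode (S := S) (P := fun x => x = pair 0 qI) inferInstance
    (pair 0 qI)
  refine ⟨(s₁, s₂, s₃, s₂), fun i => ?_, fun i j h => ((h₂ _).1 h.2.2).2, ?_,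
    fun h => ((h₂ _).1 h).2, rfl⟩
  · change i ≤ 2 * c ∧ FinCode.Mem i s₁ ↔ i = 0
    rw [h₁]
    exact ⟨fun h => h.2.2, by rintro rfl; exact ⟨zero_le, le_rfl, rfl⟩⟩
  · exact (pair_inj hS.out ((h₃ _).1 (hl (s₁, s₂, s₃, s₂) 0 qI hqI ((h₃ _).2 ⟨le_rfl, rfl⟩))).2).2

variable {τ : A → Scheme N} {M : A → Letter N}

theorem InS.prune_label [h : StepFam S τ M] [hL : LabelFam S τ] {v : A → N ⊕ N} {q : A → N}
    [FunS S v] [FunS S q] : InS S fun a => (prune (τ a) (M a)).node (v a) ∧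
      (prune (τ a) (M a)).label (v a) = q a := by
  have key : InS S fun p : (A × N) × (N ⊕ N) => (prune (τ p.1.1) (M p.1.1)).node p.2 ∧
      (prune (τ p.1.1) (M p.1.1)).label p.2 = p.1.2 := by
    refine InS.sum ?_ ?_
    · have h1 : InS S fun p : (A × N) × N => (τ p.1.1).node p.2 ∧ (τ p.1.1).label p.2 = p.1.2 :=
        InS.label (τ := fun p : (A × N) × N => τ p.1.1)
      have h2 : InS S fun p : (A × N) × N => (prune (τ p.1.1) (M p.1.1)).node (.inl p.2) :=
        inferInstance
      exact (InS.and (hP := h2) (hP' := h1)).congr fun p =>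
        ⟨fun h => ⟨h.1, (prune_node_inl.1 h.1).1, h.2⟩, fun h => ⟨h.1, h.2.2⟩⟩
    · exact InS.and (A := (A × N) × N) (P := fun p => (prune (τ p.1.1) (M p.1.1)).node (.inr p.2))
        (P' := fun p => p.2 = p.1.2)
  exact key.comp (f := fun a => ((a, q a), v a)) inferInstance

/-- The step function on codes of schemes, for a given choice of new identifiers. -/
theorem Config.exists_step [h : StepFam S τ M] [hL : LabelFam S τ] {ν : A × N → N} [hν : FunS S ν]
    {Q : Set N} {b : N} (hb : ∀ q ∈ Q, q ≤ b)
    (hl : ∀ s i q, q ∈ Q → FinCode.Mem (pair i q) s.2.2.1 →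
      FinCode.Mem (pair i (lab (s, i))) s.2.2.1)
    (hτ : ∀ a i, (τ a).node i → i ≤ 2 * c) (hlab : ∀ a i, (τ a).node i → (τ a).label i ∈ Q)
    (hM : ∀ a p q, M a p q ≠ Mark.zero → q ∈ Q) (hroot : ∀ a, (τ a).rootLabel = qI) :
    ∃ f : A → Config N, FunS S f ∧ ∀ a, StepCtx S (τ a) (M a) →
      IsFreshNaming c (τ a) (M a) (fun q => ν (a, q)) →
      IsTransition c (τ a) (M a) (fun q => ν (a, q)) (Config.scheme c qI lab (f a)) := by
  have hbd : FunS S fun _ : A => 2 * c := FunS.const _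
  have hid : ∀ {B : Type u} [Coded S B] (f : B → A) (v : B → N ⊕ N) (i : B → N) [FunS S f] [FunS S v]
      [FunS S i], InS S fun x => HasIdentifier (τ (f x)) (M (f x)) (fun q => ν (f x, q)) (v x) (i x) :=
    fun f v i _ _ _ => InS.hasIdentifier (τ := fun x => τ (f x)) (M := fun x => M (f x))
      (ν := fun x => ν (f x.1, x.2))
  obtain ⟨f₁, hf₁, h₁⟩ := exists_finCode_fun (S := S) (A := A) (P := fun x =>
    ∃ v, (prune (τ x.1) (M x.1)).node v ∧
      HasIdentifier (τ x.1) (M x.1) (fun q => ν (x.1, q)) v x.2)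
    (InS.exists_node (T := fun x : A × N => prune (τ x.1) (M x.1)) (hid _ _ _)) fun _ => 2 * c
  obtain ⟨f₂, hf₂, h₂⟩ := exists_finCode_fun_pair (S := S) (A := A) (P := fun x =>
    ∃ u, (prune (τ x.1) (M x.1)).node u ∧ ∃ v, (prune (τ x.1) (M x.1)).node v ∧
      (HasIdentifier (τ x.1) (M x.1) (fun q => ν (x.1, q)) u x.2.1 ∧
      HasIdentifier (τ x.1) (M x.1) (fun q => ν (x.1, q)) v x.2.2 ∧
      (prune (τ x.1) (M x.1)).anc u v))
    (InS.exists_node (T := fun x : A × N × N => prune (τ x.1) (M x.1))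
      (InS.exists_node (T := fun x : (A × N × N) × (N ⊕ N) => prune (τ x.1.1) (M x.1.1))
        (.and (hP := hid _ _ _) (hP' := .and (hP := hid _ _ _) (hP' :=
          InS.anc (T := fun x : ((A × N × N) × (N ⊕ N)) × (N ⊕ N) =>
            prune (τ x.1.1.1) (M x.1.1.1))))))) (2 * c) (2 * c)
  obtain ⟨f₃, hf₃, h₃⟩ := exists_finCode_fun_pair (S := S) (A := A) (P := fun x =>
    ∃ v, (prune (τ x.1) (M x.1)).node v ∧
      (HasIdentifier (τ x.1) (M x.1) (fun q => ν (x.1, q)) v x.2.1 ∧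
      ((prune (τ x.1) (M x.1)).node v ∧ (prune (τ x.1) (M x.1)).label v = x.2.2)))
    (InS.exists_node (T := fun x : A × N × N => prune (τ x.1) (M x.1))
      (.and (hP := hid _ _ _) (hP' :=
        InS.prune_label (τ := fun x : (A × N × N) × (N ⊕ N) => τ x.1.1)
          (M := fun x => M x.1.1)))) (2 * c) b
  obtain ⟨f₄, hf₄, h₄⟩ := exists_finCode_fun (S := S) (A := A) (P := fun x =>
    ∃ v, (prune (τ x.1) (M x.1)).node v ∧
      (HasIdentifier (τ x.1) (M x.1) (fun q => ν (x.1, q)) v x.2 ∧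
      ∃ y, (prune (τ x.1) (M x.1)).node y ∧ ((prune (τ x.1) (M x.1)).OnPath v y ∧
        ((prune (τ x.1) (M x.1)).node y ∧ (prune (τ x.1) (M x.1)).acc y))))
    (InS.exists_node (T := fun x : A × N => prune (τ x.1) (M x.1))
      (.and (hP := hid _ _ _) (hP' := InS.exists_node (T := fun x : (A × N) × (N ⊕ N) =>
        prune (τ x.1.1) (M x.1.1)) (.and (hP := InS.onPath (T := fun x : ((A × N) × (N ⊕ N)) × (N ⊕ N) =>
          prune (τ x.1.1.1) (M x.1.1.1))) (hP' := InS.prune_acc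
            (τ := fun x : ((A × N) × (N ⊕ N)) × (N ⊕ N) => τ x.1.1.1)
            (M := fun x => M x.1.1.1)))))) fun _ => 2 * c
  -- The step is defined on all codes and is a transition only under these hypotheses, so the
  -- recursion can precede the proof of the invariant.
  refine ⟨fun a => (f₁ a, f₂ a, f₃ a, f₄ a), inferInstance, fun a hc hν => ?_⟩
  have hle : ∀ {v i}, HasIdentifier (τ a) (M a) (fun q => ν (a, q)) v i → i ≤ 2 * c := by
    rintro v i (hv | ⟨q, _, hq, rfl⟩)
    · exact hτ a i (prune_node_inl.1 hv.1.2.1).1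
    · exact hν.le q hq
  have hnode : ∀ {v i}, HasIdentifier (τ a) (M a) (fun q => ν (a, q)) v i →
      i ≤ 2 * c ∧ FinCode.Mem i (f₁ a) := fun {v i} hv =>
    ⟨hle hv, (h₁ a i).2 ⟨hle hv, v, (StepCtx.kept_of_hasIdentifier hv).1, hv⟩⟩
  have hinj : ∀ {u v i}, HasIdentifier (τ a) (M a) (fun q => ν (a, q)) u i →
      HasIdentifier (τ a) (M a) (fun q => ν (a, q)) v i → u = v :=
    hc.hasIdentifier_inj hν.not_used hν.inj
  refine ⟨hν, fun i => ?_, fun u v i j _ _ hu hv => ?_, fun v i hk hv => ?_, fun v i _ hv => ?_,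
    (hroot a).symm⟩
  · constructor
    · rintro ⟨_, hi⟩
      obtain ⟨_, v, _, hv⟩ := (h₁ a i).1 hi
      exact ⟨v, StepCtx.kept_of_hasIdentifier hv, hv⟩
    · rintro ⟨v, _, hv⟩
      exact hnode hv
  · constructor
    · rintro ⟨_, _, h3⟩
      obtain ⟨_, _, u', _, v', _, hu', hv', h4⟩ := (h₂ a i j).1 h3
      rw [hinj hu hu', hinj hv hv']
      exact ⟨StepCtx.kept_of_hasIdentifier hu', StepCtx.kept_of_hasIdentifier hv', h4⟩
    · rintro ⟨h1, h2, h3⟩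
      exact ⟨hnode hu, hnode hv, (h₂ a i j).2 ⟨hle hu, hle hv, u, h1.1, v, h2.1, hu, hv, h3⟩⟩
  · have hq : (prune (τ a) (M a)).label v ∈ Q := by
      rcases v with j | q
      · exact hlab a j (prune_node_inl.1 hk.1).1
      · obtain ⟨p, hp⟩ := prune_node_inr.1 hk.1
        exact hM a _ _ hp.2
    have := hl (f₁ a, f₂ a, f₃ a, f₄ a) i _ hq
      ((h₃ a i _).2 ⟨hle hv, hb _ hq, v, hk.1, hv, hk.1, rfl⟩)
    obtain ⟨_, _, v', _, hv', _, h1⟩ := (h₃ a i _).1 this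
    rw [hinj hv hv']
    exact h1.symm
  · constructor
    · intro h1
      obtain ⟨_, v', _, hv', y, _, hy, _, h2⟩ := (h₄ a i).1 h1
      rw [hinj hv hv']
      exact ⟨y, hy, h2⟩
    · rintro ⟨y, hy, h2⟩
      exact (h₄ a i).2 ⟨hle hv, v, hy.1.1, hv, y, hy.2.1, hy, hy.2.1, h2⟩

/-- The automaton has a run in which the choices of identifiers are the least possible ones. -/
theorem exists_run {Q : Set N} (hQ : IsFiniteSet S Q c) (hqI : qI ∈ Q) {α : N → Letter N}
    (hα : IsQDag S Q α) (hs : ∀ n, (α n).TreeShaped) :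
    ∃ ρ ν, IsRun S Q c qI α ρ ν ∧ ∀ n, IsLeastNaming (ρ n) (α n) (ν n) := by
  obtain ⟨b, hb⟩ := exists_bound_of_isFiniteSet hQ
  obtain ⟨lab, hlabS, hlab, hl⟩ := exists_labelling hQ.1 hqI b hb
  let σ : Config N → Scheme N := Config.scheme c qI lab
  have hT : TreeFam S σ := Config.treeFam
  have hL : LabelFam S σ := Config.labelFam hlabS
  have hA : LetterFam S α := .of_isQDag hα
  have hT' : TreeFam S fun x : N × Config N => σ x.2 := TreeFam.subst
  have hL' : LabelFam S fun x : N × Config N => σ x.2 := LabelFam.subst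
  have hA' : LetterFam S fun x : N × Config N => α x.1 := LetterFam.subst
  have hacc : InS S fun p : Config N × N => (σ p.1).node p.2 ∧ (σ p.1).acc p.2 := Config.acc_inS
  have hF : StepFam S (fun x : N × Config N => σ x.2) fun x => α x.1 :=
    .of_label hT' hL' hA' (hacc.comp (f := fun p : (N × Config N) × N => (p.1.2, p.2)) inferInstance)
      (b := b) (fun x i _ => hb _ (hlab _)) fun x p q hpq => hb _ (hα.mem _ _ _ hpq).2
  -- The naming is uniform in all pairs of a time and a code, not only those met by the run, since
  -- it enters the step function of the recursion.
  obtain ⟨ν, hν, hν'⟩ := exists_leastNaming hF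
  have hM : ∀ n p q, α n p q ≠ Mark.zero → q ∈ Q := fun n p q h => (hα.mem n p q h).2
  obtain ⟨step, hstep, hstep'⟩ := Config.exists_step (S := S) (c := c) (qI := qI)
    (τ := fun x : N × Config N => σ x.2) (M := fun x => α x.1) (ν := ν) hb hl
    (fun x i h => h.1) (fun x i _ => hlab _) (fun x => hM x.1) fun _ => rfl
  obtain ⟨s₀, hs₀⟩ := Config.exists_initial S (c := c) hqI hl
  have hstep₁ : FunS S fun x : N × N × Config N => step x.2 := inferInstance
  have hconst : FunS S fun _ : N => s₀ := inferInstance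
  obtain ⟨F, hFS, hF0, hFs⟩ := exists_recursion (A := N) hconst hstep₁
  have hctx : ∀ n s, IsState S (σ s) → StepCtx S (σ s) (α n) := fun n s h =>
    ⟨h, hs n, StepFam.subst (h := hF) (f := fun _ : N => (n, s))⟩
  have htrans : ∀ n s, IsState S (σ s) →
      IsTransition c (σ s) (α n) (fun q => ν ((n, s), q)) (σ (step (n, s))) := by
    intro n s h
    obtain ⟨h1, h2, h3⟩ := hν' (n, s)
    refine hstep' (n, s) (hctx n s h) ⟨fun q hq => ?_, h1, h2⟩
    have : FunS S fun q => ν ((n, s), q) := inferInstance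
    exact (hctx n s h).naming_le hQ (hM n) h3 hq
  have hnext : ∀ n s, IsState S (σ s) →
      IsQScheme Q c (σ (step (n, s))) ∨ IsDead Q (σ (step (n, s))) := fun n s h =>
    (hctx n s h).target_state (htrans n s h) (fun i j h => ⟨h.1, h.2.1⟩) (fun i h => h.1)
      (fun i _ => hlab _) (hM n) hqI
  have hstate : ∀ s, IsQScheme Q c (σ s) ∨ IsDead Q (σ s) → IsState S (σ s) := by
    intro s h
    refine ⟨⟨TreeFam.subst (hT := hT) (f := fun _ : N => s), ?_, ?_, ?_⟩, ?_⟩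
    all_goals rcases h with h | h
    · exact h.anc_irrefl
    · exact fun v => h.2.1 v v
    · exact @fun u v w => h.anc_trans u v w
    · exact @fun u v w h1 => absurd h1 (h.2.1 u v)
    · exact @fun u v w => h.anc_linear u v w
    · exact @fun u v w h1 => absurd h1 (h.2.1 u w)
    · exact h.leaf_unique
    · exact fun i j h1 => absurd h1.1 (h.1 i)
  have hinit : IsInitial qI (σ (F (0, 0))) := hF0 0 ▸ hs₀
  have hscheme₀ : IsQScheme Q c (σ (F (0, 0))) := by
    obtain ⟨h1, h2, h3, _⟩ := hinit
    exact ⟨fun i h => h.1, fun i _ => hlab _, hqI, fun i j h => absurd h (h2 i j), fun i => h2 i i,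
      fun i j k h => absurd h (h2 i j), fun i j k h => absurd h (h2 i k),
      fun i j hi hj _ => ((h1 i).1 hi.1).trans ((h1 j).1 hj.1).symm,
      fun i hi hl => absurd ⟨hi, fun j _ => h2 i j⟩ hl, ⟨0, (h1 0).2 rfl⟩⟩
  -- The induction carries `IsState`, whose definability is known; being a scheme or dead follows
  -- from it one step later.
  have hall : ∀ n, IsState S (σ (F (0, n))) := by
    intro n
    have := (Config.isState_inS (S := S) (c := c) (qI := qI) hlabS).comp
      (f := fun n : N => F (0, n)) inferInstance
    refine InS.induction (S := S) (P := fun n => IsState S (σ (F (0, n)))) this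
      (hstate _ (.inl hscheme₀)) (fun n ih => ?_) n
    rw [hFs]
    exact hstate _ (hnext n _ ih)
  refine ⟨fun n => σ (F (0, n)), fun n q => ν ((n, F (0, n)), q), ⟨?_, ?_, ?_, ?_, ?_, ?_, ?_, hinit, ?_⟩,
    fun n => (hν' (n, F (0, n))).2.2⟩
  · exact isRel₂_iff.2 (InS.node (T := fun x : N × N => σ (F (0, x.1))))
  · exact isRel₃_iff.2 (InS.anc (T := fun x : N × N × N => σ (F (0, x.1))))
  · exact isRel₃_iff.2 (InS.label (τ := fun x : N × N × N => σ (F (0, x.1))))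
  · exact isRel₂_iff.2 (hacc.comp (f := fun x : N × N => (F (0, x.1), x.2)) inferInstance)
  · exact isFun₁_iff.2 (inferInstance : FunS S fun _ : N => qI)
  · exact isRel₃_iff.2 inferInstance
  · intro n
    rcases eq_zero_or_succ hS.out n with rfl | ⟨n, rfl⟩
    · exact .inl hscheme₀
    · simp only [hFs]
      exact hnext n _ (hall n)
  · intro n
    simp only [hFs]
    exact htrans n _ (hall n)

end Construction

end QDag

theorem mainTheorem7 {N : Type*} [CommSemiring N] [LinearOrder N] [IsStrictOrderedRing N]
    [CanonicallyOrderedAdd N] (S : Set (Set N))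
    (hRCA : SOA.ModelsRCA0 S) (hInd : SOA.ModelsSigma02Ind S)
    (Q : Set N) (c : N) (hQ : SOA.IsFiniteSet S Q c) (qI : N) (hqI : qI ∈ Q)
    (α : N → QDag.Letter N) (hα : QDag.IsQDag S Q α) (htree : ∀ n, (α n).TreeShaped) :
    (∃ ρ ν, QDag.IsRun S Q c qI α ρ ν ∧ ∀ n, QDag.IsLeastNaming (ρ n) (α n) (ν n)) ∧
    ∀ ρ ν, QDag.IsRun S Q c qI α ρ ν →
      (QDag.HasAcceptingPath S qI α ↔
        ∃ i, i ≤ 2 * c ∧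
          SOA.FinitelyOften (fun n => QDag.Deleted (ρ n) (α n) i) ∧
          SOA.InfinitelyOften (fun n => QDag.Refreshed (ρ n) (α n) i)) := by
  have : Fact (SOA.ModelsRCA0 S) := ⟨hRCA⟩
  obtain ⟨b, hb⟩ := QDag.exists_bound_of_isFiniteSet hQ
  exact ⟨QDag.exists_run hQ hqI hα htree, fun ρ ν hρ =>
    (⟨hρ, hα, htree, hb⟩ : QDag.RunCtx S Q c qI b α ρ ν).hasAcceptingPath_iff hInd⟩
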